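/- Let $n\ge 4$ and let $Q$ be any Dynkin quiver of type $D_n$, i.e. an orientation of the Dynkin diagram with edges $i - (i+1)$ for $1\le i\le n-2$ and $(n-2) - n$. Let $\Phi^+=\{\varepsilon_i\pm\varepsilon_j : 1\le i<j\le n\}$ be the set of positive roots, with simple roots $\alpha_i=\varepsilon_i-\varepsilon_{i+1}$ $(1\le i\le n-1)$ and $\alpha_n=\varepsilon_{n-1}+\varepsilon_n$. Let $\Gamma_Q$ be the Auslander–Reiten quiver of $Q$: fixing a height function $\xi$ on the vertices ($\xi_j=\xi_i-1$ for every arrow $i\to j$), its vertices have coordinates $(i,p)$ with $1\le i\le n$ and $p-\xi_i\in 2\mathbb Z$, and are identified with the elements of $\Phi^+$ so that $(i,\xi_i)$ is the sum $\eta_i$ of all $\alpha_j$ such that $Q$ has a (possibly trivial) path from $j$ to $i$, and a step $(i,p)\mapsto(i,p-2)$ is the action of the Coxeter element $\tau$ adapted to $Q$; its arrows are all $(i,p)\to(j,p+1)$ with $i,j$ adjacent in the diagram. Write $\alpha\prec_Q\beta$ if there is a path of positive length from $\beta$ to $\alpha$ in $\Gamma_Q$. A total order $<$ on $\Phi^+$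 is convex if whenever $\alpha,\beta,\alpha+\beta\in\Phi^+$, either $\alpha<\alpha+\beta<\beta$ or $\beta<\alpha+\beta<\alpha$; it is compatible with $\prec_Q$ if $\alpha\prec_Q\beta$ implies $\alpha<\beta$. A pair of $\gamma\in\Phi^+$ is an unordered pair $\{\alpha,\beta\}\subset\Phi^+$ with $\alpha+\beta=\gamma$. With respect to a total order $<$ and listed so that $\alpha<\beta$, it is minimal if there is no pair $(\alpha',\beta')$ in $\Phi^+$ with $\alpha'+\beta'=\gamma$ and $\alpha<\alpha'<\gamma<\beta'<\beta$. It is non-minimal if it is not minimal with respect to any convex total order compatible with $\prec_Q$. A sectional path is a connected subquiver of $\Gamma_Q$ consisting only of arrows $(i,p)\to(i+1,p+1)$ $(1\le i\le n-2)$ and $(n-2,p)\to(n,p+1)$, or only of arrows $(i,p)\to(i-1,p+1)$ $(2\le i\le n-1)$ and $(n,p)\to(n-2,p+1)$. Theorem. Let $\gamma=\varepsilon_a+\varepsilon_b$ with $1\le a<b\le n$ be a positive root which is not multiplicity free, i.e. some coefficient of $\gamma$ in the simple roots is at least $2$. Then $b\le n-2$, and $\gamma$ has exactly $n-b-1$ non-minimal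 pairs. Moreover, the non-minimal pairs of $\gamma$ are precisely the pairs of the form $\{\varepsilon_a+\varepsilon_c,\ \varepsilon_b-\varepsilon_c\}$ or $\{\varepsilon_a-\varepsilon_c,\ \varepsilon_b+\varepsilon_c\}$ with $b<c\le n$ neither of whose members lies on a sectional path of $\Gamma_Q$ containing $\gamma$. -/

import Mathlib

namespace TypeD

/-! ## The root system of type `D_n`

Vectors live in `ℤ^n`; the standard basis vectors `ε_1, …, ε_n` and the vertices `1, …, n` of the
Dynkin diagram are numbered from `1`. -/

/-- The standard basis vector `ε_k` of `ℤ^n`, for `1 ≤ k ≤ n`. -/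
def eps (n k : ℕ) : Fin n → ℤ := fun i => if (i : ℕ) + 1 = k then 1 else 0

/-- The positive roots of type `D_n` are the vectors `ε_i ± ε_j` with `1 ≤ i < j ≤ n`. -/
def IsPosRoot (n : ℕ) (v : Fin n → ℤ) : Prop :=
  ∃ i j : ℕ, 1 ≤ i ∧ i < j ∧ j ≤ n ∧ (v = eps n i - eps n j ∨ v = eps n i + eps n j)

/-- The set `Φ⁺` of positive roots of type `D_n`. -/
abbrev PosRoot (n : ℕ) : Type := {v : Fin n → ℤ // IsPosRoot n v}

/-- The simple roots: `α_i = ε_i - ε_{i+1}` for `1 ≤ i ≤ n - 1` and `α_n = ε_{n-1} + ε_n`. -/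
def simpleRoot (n i : ℕ) : Fin n → ℤ :=
  if i < n then eps n i - eps n (i + 1) else eps n (n - 1) + eps n n

/-- A positive root is multiplicity free if all its coefficients in the simple roots are at
most `1`. -/
def IsMultiplicityFree {n : ℕ} (β : PosRoot n) : Prop :=
  ∃ m : ℕ → ℕ, (∀ i, m i ≤ 1) ∧ β.1 = ∑ i ∈ Finset.Icc 1 n, m i • simpleRoot n i

/-- The simple reflection `s_i(v) = v - (v, α_i) α_i` (every root has square length `2`). -/
def simpleReflection (n i : ℕ) (v : Fin n → ℤ) : Fin n → ℤ :=
  v - (v ⬝ᵥ simpleRoot n i) • simpleRoot n i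

/-- The product `s_{i_1} s_{i_2} ⋯ s_{i_r}` of simple reflections, for a word
`i_1, i_2, …, i_r` in the vertices. -/
def wordAction (n : ℕ) (w : List ℕ) (v : Fin n → ℤ) : Fin n → ℤ :=
  w.foldr (fun i u => simpleReflection n i u) v

theorem eps_dot_eps {n i j : ℕ} (hi : 1 ≤ i) (hin : i ≤ n) :
    eps n i ⬝ᵥ eps n j = if i = j then 1 else 0 := by
  have h1 : ∀ x : Fin n, eps n i x * eps n j x
      = if x = (⟨i - 1, by omega⟩ : Fin n) then (if i = j then 1 else 0) else 0 := by
    intro x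
    have hx : (x = (⟨i - 1, by omega⟩ : Fin n)) ↔ (x : ℕ) + 1 = i := by
      rw [Fin.ext_iff]
      show (x : ℕ) = i - 1 ↔ _
      omega
    simp only [eps, hx]
    split_ifs <;> simp_all
  simp only [dotProduct, h1]
  simp

theorem simpleRoot_dot_self {n i : ℕ} (hn : 2 ≤ n) (hi : 1 ≤ i) (hin : i ≤ n) :
    simpleRoot n i ⬝ᵥ simpleRoot n i = 2 := by
  unfold simpleRoot
  split_ifs with h
  · simp only [sub_dotProduct, dotProduct_sub]
    rw [eps_dot_eps hi hin, eps_dot_eps hi hin, eps_dot_eps (by omega) (by omega),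
      eps_dot_eps (by omega) (by omega)]
    simp
  · simp only [add_dotProduct, dotProduct_add]
    rw [eps_dot_eps (by omega) (by omega), eps_dot_eps (by omega) (by omega),
      eps_dot_eps (by omega) (by omega), eps_dot_eps (by omega) (by omega)]
    have h1 : n - 1 ≠ n := by omega
    simp [h1, h1.symm]

theorem simpleReflection_simpleReflection {n i : ℕ} (hn : 2 ≤ n) (hi : 1 ≤ i) (hin : i ≤ n)
    (v : Fin n → ℤ) : simpleReflection n i (simpleReflection n i v) = v := by
  simp only [simpleReflection, sub_dotProduct, smul_dotProduct, simpleRoot_dot_self hn hi hin]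
  simp only [smul_eq_mul]
  module

/-- The product of simple reflections along the reversed word is the inverse of the product
along the word. -/
theorem wordAction_reverse {n : ℕ} (hn : 2 ≤ n) (w : List ℕ) (hw : ∀ i ∈ w, 1 ≤ i ∧ i ≤ n)
    (v : Fin n → ℤ) : wordAction n w.reverse (wordAction n w v) = v := by
  induction w generalizing v with
  | nil => rfl
  | cons i w ih =>
    have hi := hw i (by simp)
    simp only [wordAction, List.reverse_cons, List.foldr_append, List.foldr_cons, List.foldr_nil]
    rw [simpleReflection_simpleReflection hn hi.1 hi.2]
    exact ih (fun j hj => hw j (by simp [hj])) v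

/-! ## Dynkin quivers of type `D_n` -/

/-- Adjacency in the Dynkin diagram of type `D_n`: the chain `1 - 2 - ⋯ - (n-1)` together with
the edge joining `n - 2` and `n`. -/
def DiagramAdj (n i j : ℕ) : Prop :=
  (1 ≤ i ∧ j = i + 1 ∧ j ≤ n - 1) ∨ (1 ≤ j ∧ i = j + 1 ∧ i ≤ n - 1) ∨
    (i = n - 2 ∧ j = n) ∨ (i = n ∧ j = n - 2)

/-- A Dynkin quiver of type `D_n`: an orientation of the edges of the Dynkin diagram. -/
structure DynkinQuiver (n : ℕ) where
  arrow : ℕ → ℕ → Prop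
  adj_iff : ∀ i j, DiagramAdj n i j ↔ (arrow i j ∨ arrow j i)
  asymm : ∀ i j, arrow i j → ¬ arrow j i

/-- `i` is a source if every arrow touching `i` starts at `i`. -/
def DynkinQuiver.IsSource {n : ℕ} (Q : DynkinQuiver n) (i : ℕ) : Prop :=
  ∀ j, ¬ Q.arrow j i

/-- The quiver `s_i Q`, in which all arrows touching `i` are reversed. -/
def DynkinQuiver.reflect {n : ℕ} (Q : DynkinQuiver n) (i : ℕ) : DynkinQuiver n where
  arrow x y := ((x = i ∨ y = i) ∧ Q.arrow y x) ∨ (¬ (x = i ∨ y = i) ∧ Q.arrow x y)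
  adj_iff x y := by
    rw [Q.adj_iff x y]
    by_cases hx : x = i <;> by_cases hy : y = i <;> simp [hx, hy, or_comm]
  asymm x y := by
    have := Q.asymm x y
    have := Q.asymm y x
    tauto

/-- The word `i_1, …, i_r` is adapted to `Q`: each `i_k` is a source of
`s_{i_{k-1}} ⋯ s_{i_1} Q`. -/
def DynkinQuiver.IsAdapted {n : ℕ} : DynkinQuiver n → List ℕ → Prop
  | _, [] => True
  | Q, i :: w => Q.IsSource i ∧ (Q.reflect i).IsAdapted w

/-- `w` is a word for the Coxeter element adapted to `Q`: every vertex occurs in `w` exactly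
once, and `w` is adapted to `Q`. -/
def DynkinQuiver.IsCoxeterWord {n : ℕ} (Q : DynkinQuiver n) (w : List ℕ) : Prop :=
  w.Nodup ∧ (∀ i, i ∈ w ↔ 1 ≤ i ∧ i ≤ n) ∧ Q.IsAdapted w

/-- `ξ` is a height function on `Q`: `ξ_j = ξ_i - 1` for every arrow `i → j`. -/
def DynkinQuiver.IsHeightFunction {n : ℕ} (Q : DynkinQuiver n) (ξ : ℕ → ℤ) : Prop :=
  ∀ i j, Q.arrow i j → ξ j = ξ i - 1

open Classical in
/-- `η_i` is the sum of the simple roots `α_j` over all vertices `j` from which there is a path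
(possibly trivial) to `i` in `Q`. -/
noncomputable def DynkinQuiver.eta {n : ℕ} (Q : DynkinQuiver n) (i : ℕ) : Fin n → ℤ :=
  ∑ j ∈ (Finset.Icc 1 n).filter (fun j => Relation.ReflTransGen Q.arrow j i), simpleRoot n j

/-! ## The Auslander-Reiten quiver

Below, `ξ` is a height function on `Q` and `w` is a word for the adapted Coxeter element `τ`, so
that `τ = wordAction n w` and `τ⁻¹ = wordAction n w.reverse`. -/

open Classical in
/-- One move `(i, p) ↦ (i, p - 2)`, on labels: `(β, m)` becomes `(τ β, m)` if `τ β` is a positive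
root, and `(-τ β, m - 1)` otherwise. -/
noncomputable def stepDown (n : ℕ) (w : List ℕ) (x : (Fin n → ℤ) × ℤ) : (Fin n → ℤ) × ℤ :=
  if IsPosRoot n (wordAction n w x.1) then (wordAction n w x.1, x.2)
  else (-wordAction n w x.1, x.2 - 1)

open Classical in
/-- One move `(i, p) ↦ (i, p + 2)`, on labels: `(β, m)` becomes `(τ⁻¹ β, m)` if `τ⁻¹ β` is a
positive root, and `(-τ⁻¹ β, m + 1)` otherwise. -/
noncomputable def stepUp (n : ℕ) (w : List ℕ) (x : (Fin n → ℤ) × ℤ) : (Fin n → ℤ) × ℤ :=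
  if IsPosRoot n (wordAction n w.reverse x.1) then (wordAction n w.reverse x.1, x.2)
  else (-wordAction n w.reverse x.1, x.2 + 1)

/-- The vertices `(i, p)` of the repetition quiver `ℤQ`: `p` and `ξ_i` have the same parity. -/
def IsRepVertex (n : ℕ) (ξ : ℕ → ℤ) (v : ℕ × ℤ) : Prop :=
  1 ≤ v.1 ∧ v.1 ≤ n ∧ Even (v.2 - ξ v.1)

/-- The arrows of `ℤQ` between its vertices: `(i, p) → (j, p + 1)` for `i`, `j` adjacent. -/
def RepArrow (n : ℕ) (u v : ℕ × ℤ) : Prop :=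
  DiagramAdj n u.1 v.1 ∧ v.2 = u.2 + 1

/-- The labelling of the vertices of `ℤQ` by `Φ⁺ × ℤ`: the label of `(i, ξ_i)` is `(η_i, 0)`, and
the other labels are obtained by the moves `stepDown` and `stepUp`. -/
noncomputable def phiHat {n : ℕ} (Q : DynkinQuiver n) (ξ : ℕ → ℤ) (w : List ℕ) (v : ℕ × ℤ) :
    (Fin n → ℤ) × ℤ :=
  if v.2 ≤ ξ v.1 then (stepDown n w)^[((ξ v.1 - v.2) / 2).toNat] (Q.eta v.1, 0)
  else (stepUp n w)^[((v.2 - ξ v.1) / 2).toNat] (Q.eta v.1, 0)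

/-- The positive root `β` is located at the vertex `v` of `ℤQ`, i.e. `v` has label `(β, 0)`. -/
def IsLocatedAt {n : ℕ} (Q : DynkinQuiver n) (ξ : ℕ → ℤ) (w : List ℕ) (β : PosRoot n)
    (v : ℕ × ℤ) : Prop :=
  IsRepVertex n ξ v ∧ phiHat Q ξ w v = (β.1, 0)

/-- The vertices of the Auslander-Reiten quiver `Γ_Q`: those vertices of `ℤQ` whose label is
in `Φ⁺ × {0}`. -/
def IsARVertex {n : ℕ} (Q : DynkinQuiver n) (ξ : ℕ → ℤ) (w : List ℕ) (v : ℕ × ℤ) : Prop :=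
  ∃ β : PosRoot n, IsLocatedAt Q ξ w β v

/-- The arrows of `Γ_Q`, the full subquiver of `ℤQ` on its vertices. -/
def ARArrow {n : ℕ} (Q : DynkinQuiver n) (ξ : ℕ → ℤ) (w : List ℕ) (u v : ℕ × ℤ) : Prop :=
  IsARVertex Q ξ w u ∧ IsARVertex Q ξ w v ∧ RepArrow n u v

/-- The partial order `≺_Q`: `α ≺_Q β` if there is a path (of positive length) from `β` to `α`
in `Γ_Q`. -/
def PrecQ {n : ℕ} (Q : DynkinQuiver n) (ξ : ℕ → ℤ) (w : List ℕ) (α β : PosRoot n) : Prop :=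
  ∃ u v : ℕ × ℤ, IsLocatedAt Q ξ w β u ∧ IsLocatedAt Q ξ w α v ∧
    Relation.TransGen (ARArrow Q ξ w) u v

/-! ## Sectional paths

A subquiver of `Γ_Q` is given by its set of arrows; an arrow is the pair of its end points. -/

/-- Arrows of the form `(i, p) → (i + 1, p + 1)` for `1 ≤ i ≤ n - 2`, or
`(n - 2, p) → (n, p + 1)`. -/
def IsSArrow (n : ℕ) (e : (ℕ × ℤ) × (ℕ × ℤ)) : Prop :=
  e.2.2 = e.1.2 + 1 ∧
    ((1 ≤ e.1.1 ∧ e.1.1 ≤ n - 2 ∧ e.2.1 = e.1.1 + 1) ∨ (e.1.1 = n - 2 ∧ e.2.1 = n))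

/-- Arrows of the form `(i, p) → (i - 1, p + 1)` for `2 ≤ i ≤ n - 1`, or
`(n, p) → (n - 2, p + 1)`. -/
def IsNArrow (n : ℕ) (e : (ℕ × ℤ) × (ℕ × ℤ)) : Prop :=
  e.2.2 = e.1.2 + 1 ∧
    ((2 ≤ e.1.1 ∧ e.1.1 ≤ n - 1 ∧ e.2.1 = e.1.1 - 1) ∨ (e.1.1 = n ∧ e.2.1 = n - 2))

/-- The vertex `v` is an end point of an arrow in `ρ`. -/
def IsVertexOf (ρ : Set ((ℕ × ℤ) × (ℕ × ℤ))) (v : ℕ × ℤ) : Prop :=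
  ∃ e ∈ ρ, v = e.1 ∨ v = e.2

/-- `ρ` is a connected subquiver of `Γ_Q`. -/
def IsConnectedSubquiver {n : ℕ} (Q : DynkinQuiver n) (ξ : ℕ → ℤ) (w : List ℕ)
    (ρ : Set ((ℕ × ℤ) × (ℕ × ℤ))) : Prop :=
  (∀ e ∈ ρ, ARArrow Q ξ w e.1 e.2) ∧
    ∀ u v, IsVertexOf ρ u → IsVertexOf ρ v → Relation.EqvGen (fun x y => (x, y) ∈ ρ) u v

/-- A sectional path is a connected subquiver of `Γ_Q` that either consists of S-arrows only
(an S-sectional path) or consists of N-arrows only (an N-sectional path). -/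
def IsSectionalPath {n : ℕ} (Q : DynkinQuiver n) (ξ : ℕ → ℤ) (w : List ℕ)
    (ρ : Set ((ℕ × ℤ) × (ℕ × ℤ))) : Prop :=
  IsConnectedSubquiver Q ξ w ρ ∧ ((∀ e ∈ ρ, IsSArrow n e) ∨ (∀ e ∈ ρ, IsNArrow n e))

/-- The positive root `β` is contained in `ρ`. -/
def IsContainedIn {n : ℕ} (Q : DynkinQuiver n) (ξ : ℕ → ℤ) (w : List ℕ) (β : PosRoot n)
    (ρ : Set ((ℕ × ℤ) × (ℕ × ℤ))) : Prop :=
  ∃ v, IsLocatedAt Q ξ w β v ∧ IsVertexOf ρ v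

/-- `β` and `γ` are contained in a common sectional path of `Γ_Q`; that is, `β` lies on a
sectional path through `γ`. -/
def LieOnCommonSectionalPath {n : ℕ} (Q : DynkinQuiver n) (ξ : ℕ → ℤ) (w : List ℕ)
    (β γ : PosRoot n) : Prop :=
  ∃ ρ, IsSectionalPath Q ξ w ρ ∧ IsContainedIn Q ξ w β ρ ∧ IsContainedIn Q ξ w γ ρ

/-! ## Convex orders and minimal pairs -/

/-- Convexity of an order on `Φ⁺`. -/
def IsConvexOrder {n : ℕ} (lt : PosRoot n → PosRoot n → Prop) : Prop :=
  ∀ α β γ : PosRoot n, γ.1 = α.1 + β.1 → (lt α γ ∧ lt γ β) ∨ (lt β γ ∧ lt γ α)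

/-- The order `lt` is compatible with `≺_Q`. -/
def IsCompatible {n : ℕ} (Q : DynkinQuiver n) (ξ : ℕ → ℤ) (w : List ℕ)
    (lt : PosRoot n → PosRoot n → Prop) : Prop :=
  ∀ α β : PosRoot n, PrecQ Q ξ w α β → lt α β

/-- `(α, β)` is a minimal pair of `γ` with respect to the order `lt`. -/
def IsMinimalPair {n : ℕ} (lt : PosRoot n → PosRoot n → Prop) (γ α β : PosRoot n) : Prop :=
  lt α β ∧ γ.1 = α.1 + β.1 ∧
    ¬ ∃ α' β' : PosRoot n, γ.1 = α'.1 + β'.1 ∧ lt α α' ∧ lt α' γ ∧ lt γ β' ∧ lt β' β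

/-- `{α, β}` is a non-minimal pair of `γ`: it is a pair of positive roots with sum `γ` which, in
whichever order its members are listed, is not a minimal pair of `γ` for any convex total order
compatible with `≺_Q`. -/
def IsNonMinimalPair {n : ℕ} (Q : DynkinQuiver n) (ξ : ℕ → ℤ) (w : List ℕ)
    (γ α β : PosRoot n) : Prop :=
  γ.1 = α.1 + β.1 ∧
    ∀ lt : PosRoot n → PosRoot n → Prop, IsStrictTotalOrder (PosRoot n) lt →
      IsConvexOrder lt → IsCompatible Q ξ w lt →
        ¬ IsMinimalPair lt γ α β ∧ ¬ IsMinimalPair lt γ β α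

/-- `{α, β}` is `{ε_a + ε_c, ε_b - ε_c}` or `{ε_a - ε_c, ε_b + ε_c}` for some `c` with
`b < c ≤ n`. -/
def IsSplitPair {n : ℕ} (a b : ℕ) (α β : PosRoot n) : Prop :=
  ∃ c : ℕ, b < c ∧ c ≤ n ∧ ∃ σ : ℤ, (σ = 1 ∨ σ = -1) ∧
    ((α.1 = eps n a + σ • eps n c ∧ β.1 = eps n b - σ • eps n c) ∨
      (β.1 = eps n a + σ • eps n c ∧ α.1 = eps n b - σ • eps n c))

end TypeD

/-!
The proof puts the Auslander-Reiten quiver into coordinates. The Coxeter element `τ` permutes the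
vectors `±ε_1, …, ±ε_n` and has two orbits on them. One orbit is `{ε_t, -ε_t}` with `t = twist n ξ`
equal to `n - 1` or `n`. The other one consists of the remaining `2n - 2` vectors, which are arranged
on a wheel: `wheel n ξ x` is defined for `x` in a fixed class modulo `2`, it changes its sign after
the period `N = per n = 2n - 2`, and `τ` moves `x` to `x - 2`. To see this, the recursion
`η_i = α_i + Σ_{j → i} η_j` is solved explicitly on the wheel (`IsHeight.isKnitting_startRoot`); the
same recursion determines `τ` (`DynkinQuiver.IsKnitting.wordAction_eq`).

A vertex `(i, p)` with `i ≤ n - 2` then carries `wheel (p - i) - wheel (p + i)`, and the vertices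
with `i = n - 1` and `i = n` carry the two vectors `wheel (p - n + 1) ± ε_t`. So every vertex has two
coordinates, `cx` and `cy`. The roots sit in a narrow strip (`IsHeight.strip`), which allows one to
read off the location of a root from its expression on the wheel (`IsHeight.coords_of_wheel`,
`IsHeight.coords_of_twist`). Paths in the quiver are the increasing pairs of coordinates
(`DynkinQuiver.IsHeightFunction.precQ_iff`), and sectional paths are those along which one coordinate
is constant (`DynkinQuiver.IsHeightFunction.lieOnCommonSectionalPath_iff`).

Let now `γ = ε_a + ε_b` have the coordinates `(x, y)`; not being multiplicity free means
`b ≤ n - 2`. A pair of `γ` arises by adding a signed unit vector to `wheel x` and subtracting it from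
`-wheel y`. It is straight, with a member sharing a coordinate with `γ`, or it is crossing:
its members are located at `(y - N, z)` and `(z, x + N)` for some `x < z < y`
(`IsHeight.pair_coords`). The sum of two roots always lies between them in the quiver, so that
every compatible total order is convex. A straight pair is minimal for the compatible order in which
only the roots of the interval spanned by the pair lie between its members
(`DynkinQuiver.IsHeightFunction.not_isNonMinimalPair_of_isStraight`). A crossing pair is never
minimal, because the pair at `(y - N, y)` and `(x, x + N)`, which is `wheel x + ε_t` and
`-wheel y - ε_t`, lies inside it (`DynkinQuiver.IsHeightFunction.isNonMinimalPair_of_isCrossing`).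

To count the crossing pairs, one uses that the positions of `-ε_1, -ε_2, …` on the wheel grow from
the inside to the outside: each one lies at an end of the previous ones (`IsHeight.pos_valley`).
Therefore the values `±ε_c` with `c > b`, `c ≠ t`, all occur between `x` and `y`, and they give
crossing pairs, whereas the values between `x` and `y` with `c < b` have the wrong sign for both
members to be positive. This leaves `n - b - 1` pairs.
-/

namespace TypeD

/-! ### Linear algebra of the root system -/

/-- A linear functional which is positive on every positive root. -/
def weight {n : ℕ} (v : Fin n → ℤ) : ℤ := ∑ k : Fin n, ((n : ℤ) - ((k : ℕ) + 1)) * v k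

theorem weight_add {n : ℕ} (u v : Fin n → ℤ) : weight (u + v) = weight u + weight v := by
  simp [weight, mul_add, Finset.sum_add_distrib]

theorem weight_neg {n : ℕ} (u : Fin n → ℤ) : weight (-u) = -weight u := by
  simp [weight]

theorem weight_sub {n : ℕ} (u v : Fin n → ℤ) : weight (u - v) = weight u - weight v := by
  rw [sub_eq_add_neg, weight_add, weight_neg, sub_eq_add_neg]

theorem weight_eps {n k : ℕ} (hk : 1 ≤ k) (hkn : k ≤ n) : weight (eps n k) = n - k := by
  have h : ∀ x : Fin n, ((n : ℤ) - ((x : ℕ) + 1)) * eps n k x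
      = if x = (⟨k - 1, by omega⟩ : Fin n) then (n : ℤ) - k else 0 := by
    intro x
    have hx : (x = (⟨k - 1, by omega⟩ : Fin n)) ↔ (x : ℕ) + 1 = k := by
      rw [Fin.ext_iff]
      show (x : ℕ) = k - 1 ↔ _
      omega
    simp only [eps, hx]
    split_ifs with h1
    · rw [← h1]; push_cast; ring
    · simp
  simp only [weight, h]
  simp

theorem IsPosRoot.weight_pos {n : ℕ} {v : Fin n → ℤ} (h : IsPosRoot n v) : 0 < weight v := by
  obtain ⟨i, j, hi, hij, hj, rfl | rfl⟩ := h
  · rw [weight_sub, weight_eps hi (by omega), weight_eps (by omega) hj]; omega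
  · rw [weight_add, weight_eps hi (by omega), weight_eps (by omega) hj]; omega

theorem IsPosRoot.not_neg {n : ℕ} {v : Fin n → ℤ} (h : IsPosRoot n v) : ¬ IsPosRoot n (-v) := by
  intro h'
  have h1 := h.weight_pos
  have h2 := h'.weight_pos
  rw [weight_neg] at h2
  omega

theorem simpleReflection_add (n i : ℕ) (u v : Fin n → ℤ) :
    simpleReflection n i (u + v) = simpleReflection n i u + simpleReflection n i v := by
  simp only [simpleReflection, add_dotProduct]; module

theorem simpleReflection_smul (n i : ℕ) (c : ℤ) (v : Fin n → ℤ) :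
    simpleReflection n i (c • v) = c • simpleReflection n i v := by
  simp only [simpleReflection, smul_dotProduct, smul_eq_mul]; module

theorem wordAction_add (n : ℕ) (w : List ℕ) (u v : Fin n → ℤ) :
    wordAction n w (u + v) = wordAction n w u + wordAction n w v := by
  induction w with
  | nil => rfl
  | cons i w ih =>
    show simpleReflection n i (wordAction n w _) = simpleReflection n i (wordAction n w _) +
      simpleReflection n i (wordAction n w _)
    rw [ih, simpleReflection_add]

theorem wordAction_smul (n : ℕ) (w : List ℕ) (c : ℤ) (v : Fin n → ℤ) :
    wordAction n w (c • v) = c • wordAction n w v := by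
  induction w with
  | nil => rfl
  | cons i w ih =>
    show simpleReflection n i (wordAction n w _) = c • simpleReflection n i (wordAction n w _)
    rw [ih, simpleReflection_smul]

theorem wordAction_neg (n : ℕ) (w : List ℕ) (v : Fin n → ℤ) :
    wordAction n w (-v) = -wordAction n w v := by
  simpa using wordAction_smul n w (-1) v

theorem wordAction_sub (n : ℕ) (w : List ℕ) (u v : Fin n → ℤ) :
    wordAction n w (u - v) = wordAction n w u - wordAction n w v := by
  rw [sub_eq_add_neg, wordAction_add, wordAction_neg, ← sub_eq_add_neg]

theorem wordAction_append (n : ℕ) (l r : List ℕ) (v : Fin n → ℤ) :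
    wordAction n (l ++ r) v = wordAction n l (wordAction n r v) := by
  simp [wordAction, List.foldr_append]

theorem eps_dot_simpleRoot {n i j : ℕ} (hn : 2 ≤ n) (hi : 1 ≤ i) (hin : i ≤ n)
    (hjn : j ≤ n) :
    eps n i ⬝ᵥ simpleRoot n j =
      if i = j then 1 else if j < n ∧ i = j + 1 then -1 else if j = n ∧ i = n - 1 then 1 else 0 := by
  unfold simpleRoot
  split_ifs <;> simp only [dotProduct_sub, dotProduct_add, eps_dot_eps hi hin] <;>
    split_ifs <;> first | rfl | omega

theorem simpleRoot_dot_of_ne {n i j : ℕ} (hn : 4 ≤ n) (hi : 1 ≤ i) (hin : i ≤ n)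
    (hj : 1 ≤ j) (hjn : j ≤ n) (hij : i ≠ j) [Decidable (DiagramAdj n i j)] :
    simpleRoot n i ⬝ᵥ simpleRoot n j = if DiagramAdj n i j then -1 else 0 := by
  have key : simpleRoot n i ⬝ᵥ simpleRoot n j =
      if i < n then eps n i ⬝ᵥ simpleRoot n j - eps n (i + 1) ⬝ᵥ simpleRoot n j
      else eps n (n - 1) ⬝ᵥ simpleRoot n j + eps n n ⬝ᵥ simpleRoot n j := by
    conv_lhs => rw [simpleRoot]
    split_ifs <;> simp [sub_dotProduct, add_dotProduct]
  rw [key]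
  by_cases h : i < n
  · rw [if_pos h, eps_dot_simpleRoot (by omega) hi hin hjn,
      eps_dot_simpleRoot (by omega) (by omega) (by omega) hjn]
    unfold DiagramAdj
    split_ifs <;> first | rfl | omega
  · rw [if_neg h, eps_dot_simpleRoot (by omega) (by omega) (by omega) hjn,
      eps_dot_simpleRoot (by omega) (by omega) (by omega) hjn]
    unfold DiagramAdj
    split_ifs <;> first | rfl | omega

/-! ### The Coxeter element of an adapted word -/

/-- In an adapted word without repetitions the vertices with an arrow to `i` come before `i`, and
the vertices which receive an arrow from `i` come after it. -/
theorem DynkinQuiver.IsAdapted.mem_iff {n : ℕ} {i : ℕ} {r : List ℕ} :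
    ∀ {l : List ℕ} {Q : DynkinQuiver n}, Q.IsAdapted (l ++ i :: r) → i ∉ l → l.Nodup →
      ∀ j, (Q.arrow j i → j ∈ l) ∧ (Q.arrow i j → j ∉ l)
  | [], Q, h, _, _, j => ⟨fun hj => absurd hj (h.1 j), fun _ => by simp⟩
  | a :: l, Q, h, hi, hl, j => by
    have hia : i ≠ a := fun e => hi (by simp [e])
    have hal : a ∉ l := (List.nodup_cons.1 hl).1
    have ih := fun k => DynkinQuiver.IsAdapted.mem_iff (l := l) (Q := Q.reflect a) h.2
      (fun e => hi (by simp [e])) (List.nodup_cons.1 hl).2 k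
    have e1 : ∀ k, (Q.reflect a).arrow k i ↔ (k = a ∧ Q.arrow i k) ∨ (k ≠ a ∧ Q.arrow k i) := by
      intro k; simp [DynkinQuiver.reflect, hia]
    have e2 : ∀ k, (Q.reflect a).arrow i k ↔ (k = a ∧ Q.arrow k i) ∨ (k ≠ a ∧ Q.arrow i k) := by
      intro k; simp [DynkinQuiver.reflect, hia]
    constructor
    · intro h1
      by_cases hj : j = a
      · simp [hj]
      · exact List.mem_cons_of_mem _ ((ih j).1 ((e1 j).2 (Or.inr ⟨hj, h1⟩)))
    · intro h1 hmem
      by_cases hj : j = a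
      · subst hj
        exact hal ((ih j).1 ((e1 j).2 (Or.inl ⟨rfl, h1⟩)))
      · rcases List.mem_cons.1 hmem with e | e
        · exact hj e
        · exact (ih j).2 ((e2 j).2 (Or.inr ⟨hj, h1⟩)) e

open Classical in
/-- A family of vectors indexed by the vertices satisfies the knitting recursion of `Q` if its
value at `i` is `α_i` plus the sum of its values at the vertices with an arrow to `i`. Both the
vectors `η_i` and their explicit form in coordinates satisfy it, and the recursion determines the
Coxeter element. -/
def DynkinQuiver.IsKnitting {n : ℕ} (Q : DynkinQuiver n) (h : ℕ → Fin n → ℤ) : Prop :=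
  ∀ i, 1 ≤ i → i ≤ n →
    h i = simpleRoot n i + ∑ j ∈ (Finset.Icc 1 n).filter (fun j => Q.arrow j i), h j

/-- Along a prefix `l` of an adapted word, the product of the reflections is
`v ↦ v - Σ_{j ∈ l} (v, α_j) h_j`, and it sends the next simple root `α_i` to `h_i`. The two claims
are proved together: the first one, for `v = α_i`, turns the knitting recursion into the second
one, because the vertices of `l` adjacent to `i` are exactly those with an arrow to `i`. -/
theorem DynkinQuiver.IsKnitting.prefix_eq {n : ℕ} (hn : 4 ≤ n) {Q : DynkinQuiver n}
    {h : ℕ → Fin n → ℤ} (hh : Q.IsKnitting h) {w : List ℕ} (hnd : w.Nodup)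
    (hrange : ∀ i ∈ w, 1 ≤ i ∧ i ≤ n) (had : Q.IsAdapted w) :
    ∀ l r : List ℕ, w = l ++ r →
      (∀ v, wordAction n l v = v - ∑ j ∈ l.toFinset, (v ⬝ᵥ simpleRoot n j) • h j) ∧
      ∀ i r', r = i :: r' → h i = wordAction n l (simpleRoot n i) := by
  classical
  intro l
  induction l using List.reverseRecOn with
  | nil =>
    intro r hw
    refine ⟨fun v => by simp [wordAction], fun i r' hr => ?_⟩
    have hiw : i ∈ w := by rw [hw, hr]; simp
    rw [hh i (hrange i hiw).1 (hrange i hiw).2]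
    rw [hw, hr] at had
    rw [Finset.sum_eq_zero]
    · simp [wordAction]
    · intro j hj
      exact absurd (Finset.mem_filter.1 hj).2 (had.1 j)
  | append_singleton l a ih =>
    intro r hw
    have hw' : w = l ++ (a :: r) := by rw [hw]; simp
    obtain ⟨ih1, ih2⟩ := ih (a :: r) hw'
    have ha := ih2 a r rfl
    have hnd' : (l ++ [a]).Nodup := by
      rw [hw] at hnd; exact (List.nodup_append.1 hnd).1
    have hal : a ∉ l := by
      intro hmem
      have := (List.nodup_append.1 hnd').2.2 a hmem a (by simp)
      exact this rfl
    have P1 : ∀ v, wordAction n (l ++ [a]) v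
        = v - ∑ j ∈ (l ++ [a]).toFinset, (v ⬝ᵥ simpleRoot n j) • h j := by
      intro v
      have e : (l ++ [a]).toFinset = insert a l.toFinset := by ext; simp
      rw [e, Finset.sum_insert (by simpa using hal), wordAction_append]
      have : wordAction n [a] v = v - (v ⬝ᵥ simpleRoot n a) • simpleRoot n a := rfl
      rw [this, wordAction_sub, wordAction_smul, ← ha, ih1 v]
      abel
    refine ⟨P1, fun i r' hr => ?_⟩
    have hiw : i ∈ w := by rw [hw, hr]; simp
    have hil : i ∉ l ++ [a] := by
      intro hmem
      rw [hw, hr] at hnd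
      exact (List.nodup_append.1 hnd).2.2 i hmem i (by simp) rfl
    have had' : Q.IsAdapted ((l ++ [a]) ++ i :: r') := by rw [← hr, ← hw]; exact had
    have hmem := had'.mem_iff hil hnd'
    rw [P1, hh i (hrange i hiw).1 (hrange i hiw).2, sub_eq_add_neg, ← Finset.sum_neg_distrib]
    congr 1
    rw [Finset.sum_filter]
    have hsub : (l ++ [a]).toFinset ⊆ Finset.Icc 1 n := by
      intro j hj
      have : j ∈ w := by rw [hw]; exact List.mem_append_left _ (List.mem_toFinset.1 hj)
      exact Finset.mem_Icc.2 (hrange j this)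
    rw [← Finset.sum_subset hsub]
    · refine Finset.sum_congr rfl fun j hj => ?_
      have hjm := List.mem_toFinset.1 hj
      have hjr := Finset.mem_Icc.1 (hsub hj)
      have hij : i ≠ j := fun e => hil (e ▸ hjm)
      rw [simpleRoot_dot_of_ne hn (hrange i hiw).1 (hrange i hiw).2 hjr.1 hjr.2 hij]
      have : DiagramAdj n i j ↔ Q.arrow j i := by
        rw [Q.adj_iff]
        exact ⟨fun hh => hh.resolve_left fun h1 => (hmem j).2 h1 hjm, Or.inr⟩
      by_cases hA : Q.arrow j i
      · rw [if_pos hA, if_pos (this.2 hA)]; simp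
      · rw [if_neg hA, if_neg (fun h1 => hA (this.1 h1))]; simp
    · intro j _ hj
      rw [if_neg]
      intro hA
      exact hj (List.mem_toFinset.2 ((hmem j).1 hA))

/-- The Coxeter element in terms of a family satisfying the knitting recursion. -/
theorem DynkinQuiver.IsKnitting.wordAction_eq {n : ℕ} (hn : 4 ≤ n) {Q : DynkinQuiver n}
    {h : ℕ → Fin n → ℤ} (hh : Q.IsKnitting h) {w : List ℕ} (hw : Q.IsCoxeterWord w)
    (v : Fin n → ℤ) :
    wordAction n w v = v - ∑ j ∈ Finset.Icc 1 n, (v ⬝ᵥ simpleRoot n j) • h j := by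
  have := (hh.prefix_eq hn hw.1 (fun i hi => (hw.2.1 i).1 hi) hw.2.2 w [] (by simp)).1 v
  rw [this]
  congr 2
  ext j
  rw [List.mem_toFinset, hw.2.1 j, Finset.mem_Icc]

theorem DynkinQuiver.IsKnitting.unique {n : ℕ} (hn : 4 ≤ n) {Q : DynkinQuiver n}
    {h h' : ℕ → Fin n → ℤ} (hh : Q.IsKnitting h) (hh' : Q.IsKnitting h') {w : List ℕ}
    (hw : Q.IsCoxeterWord w) {i : ℕ} (hi : 1 ≤ i) (hin : i ≤ n) : h i = h' i := by
  obtain ⟨l, r, e⟩ := List.append_of_mem ((hw.2.1 i).2 ⟨hi, hin⟩)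
  rw [(hh.prefix_eq hn hw.1 (fun i hi => (hw.2.1 i).1 hi) hw.2.2 l _ e).2 i r rfl,
    (hh'.prefix_eq hn hw.1 (fun i hi => (hw.2.1 i).1 hi) hw.2.2 l _ e).2 i r rfl]

/-! ### The vectors `η_i` -/

theorem DynkinQuiver.IsHeightFunction.arrow_iff {n : ℕ} {Q : DynkinQuiver n} {ξ : ℕ → ℤ}
    (hξ : Q.IsHeightFunction ξ) (i j : ℕ) : Q.arrow i j ↔ DiagramAdj n i j ∧ ξ j = ξ i - 1 := by
  constructor
  · exact fun h => ⟨(Q.adj_iff i j).2 (Or.inl h), hξ i j h⟩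
  · rintro ⟨h1, h2⟩
    rcases (Q.adj_iff i j).1 h1 with h | h
    · exact h
    · have := hξ j i h; omega

theorem DynkinQuiver.IsHeightFunction.le_of_path {n : ℕ} {Q : DynkinQuiver n} {ξ : ℕ → ℤ}
    (hξ : Q.IsHeightFunction ξ) {k j : ℕ} (h : Relation.ReflTransGen Q.arrow k j) : ξ j ≤ ξ k := by
  induction h with
  | refl => exact le_rfl
  | tail _ h ih => have := hξ _ _ h; omega

/-- The diagram is a tree: a vertex with a path to `i` reaches `i` through a unique neighbour. -/
theorem DynkinQuiver.IsHeightFunction.last_arrow_unique {n : ℕ} (hn : 4 ≤ n) {Q : DynkinQuiver n}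
    {ξ : ℕ → ℤ} (hξ : Q.IsHeightFunction ξ) {i j j' k : ℕ} (h1 : Relation.ReflTransGen Q.arrow k j)
    (h2 : Q.arrow j i) (h1' : Relation.ReflTransGen Q.arrow k j') (h2' : Q.arrow j' i) :
    j = j' := by
  -- `side` numbers the branches of the diagram with `i` removed, for `i ≤ n - 2`
  set side : ℕ → ℕ := fun m => if m < i then 0 else if i < n - 2 then 1 else m with hside
  have a1 := ((hξ.arrow_iff _ _).1 h2).1
  have a2 := ((hξ.arrow_iff _ _).1 h2').1
  by_cases hi : n - 2 < i
  · unfold DiagramAdj at a1 a2; omega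
  have key : ∀ j, Q.arrow j i → ∀ m, Relation.ReflTransGen Q.arrow m j → side m = side j := by
    intro j hj m hm
    induction hm using Relation.ReflTransGen.head_induction_on with
    | refl => rfl
    | @head a b hab hbj ih =>
      rw [← ih]
      have e1 := hξ.le_of_path hbj
      have e2 := hξ _ _ hj
      have e3 := hξ _ _ hab
      have hbi : b ≠ i := by rintro rfl; omega
      have hai : a ≠ i := by rintro rfl; omega
      have e4 := ((hξ.arrow_iff _ _).1 hab).1
      unfold DiagramAdj at e4
      simp only [hside]
      split_ifs <;> omega
  have := (key j h2 k h1).symm.trans (key j' h2' k h1')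
  simp only [hside] at this
  unfold DiagramAdj at a1 a2
  split_ifs at this <;> omega

theorem DynkinQuiver.IsHeightFunction.isKnitting_eta {n : ℕ} (hn : 4 ≤ n) {Q : DynkinQuiver n}
    {ξ : ℕ → ℤ} (hξ : Q.IsHeightFunction ξ) : Q.IsKnitting Q.eta := by
  classical
  intro i hi hin
  have e : (Finset.Icc 1 n).filter (fun j => Relation.ReflTransGen Q.arrow j i) =
      insert i (((Finset.Icc 1 n).filter (fun j => Q.arrow j i)).biUnion fun j =>
        (Finset.Icc 1 n).filter (fun k => Relation.ReflTransGen Q.arrow k j)) := by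
    ext k
    simp only [Finset.mem_filter, Finset.mem_insert, Finset.mem_biUnion, Finset.mem_Icc]
    constructor
    · rintro ⟨hk, h⟩
      rcases Relation.ReflTransGen.cases_tail h with h | ⟨j, h1, h2⟩
      · exact Or.inl h.symm
      · have := ((hξ.arrow_iff _ _).1 h2).1
        exact Or.inr ⟨j, ⟨by unfold DiagramAdj at this; omega, h2⟩, hk, h1⟩
    · rintro (rfl | ⟨j, ⟨_, h2⟩, hk, h1⟩)
      · exact ⟨⟨hi, hin⟩, Relation.ReflTransGen.refl⟩
      · exact ⟨hk, h1.tail h2⟩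
  unfold DynkinQuiver.eta
  simp only [e]
  rw [Finset.sum_insert, Finset.sum_biUnion]
  · intro j hj j' hj' hne
    simp only [Finset.coe_filter, Set.mem_ofPred_eq] at hj hj'
    rw [Function.onFun, Finset.disjoint_left]
    intro k hk hk'
    exact hne (hξ.last_arrow_unique hn (Finset.mem_filter.1 hk).2 hj.2
      (Finset.mem_filter.1 hk').2 hj'.2)
  · intro hmem
    simp only [Finset.mem_filter, Finset.mem_biUnion] at hmem
    obtain ⟨j, ⟨_, h2⟩, _, h1⟩ := hmem
    have := hξ _ _ h2
    have := hξ.le_of_path h1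
    omega


/-! ### The wheel of signed unit vectors -/

/-- The properties of a height function of a quiver of type `D_n` used below: adjacent vertices
have heights differing by one. -/
structure IsHeight (n : ℕ) (ξ : ℕ → ℤ) : Prop where
  four_le : 4 ≤ n
  chain : ∀ k, 1 ≤ k → k + 1 ≤ n - 1 → ξ (k + 1) = ξ k + 1 ∨ ξ (k + 1) = ξ k - 1
  last : ξ n = ξ (n - 2) + 1 ∨ ξ n = ξ (n - 2) - 1

theorem DynkinQuiver.IsHeightFunction.isHeight {n : ℕ} (hn : 4 ≤ n) {Q : DynkinQuiver n}
    {ξ : ℕ → ℤ} (hξ : Q.IsHeightFunction ξ) : IsHeight n ξ := by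
  have key : ∀ i j, DiagramAdj n i j → ξ j = ξ i + 1 ∨ ξ j = ξ i - 1 := by
    intro i j h
    rcases (Q.adj_iff i j).1 h with h | h <;> have := hξ _ _ h <;> omega
  refine ⟨hn, fun k h1 h2 => key _ _ (Or.inl ⟨h1, rfl, h2⟩), key _ _ ?_⟩
  exact Or.inr (Or.inr (Or.inl ⟨rfl, rfl⟩))

/-- The height function on the chain `1, …, n - 2`, prolonged by an additional vertex `0` with an
arrow `0 → 1`. -/
def chainHeight (ξ : ℕ → ℤ) (k : ℕ) : ℤ := if k = 0 then ξ 1 + 1 else ξ k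

/-- The left coordinate `ξ_k - k` of the vertex `(k, ξ_k)`. -/
def leftEnd (ξ : ℕ → ℤ) (k : ℕ) : ℤ := chainHeight ξ k - k

/-- The right coordinate `ξ_k + k` of the vertex `(k, ξ_k)`. -/
def rightEnd (ξ : ℕ → ℤ) (k : ℕ) : ℤ := chainHeight ξ k + k

/-- The position on the wheel of minus the `j`-th unit vector. The vectors `-ε_1, …, -ε_k` occupy
the positions in `[leftEnd k + 2, rightEnd k]`, so that `-ε_{k+1}` is adjoined on the left or on
the right according to the orientation of the edge between `k` and `k + 1`. -/
def pos (n : ℕ) (ξ : ℕ → ℤ) (j : ℕ) : ℤ :=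
  if j = n - 1 ∨ chainHeight ξ j < chainHeight ξ (j - 1) then leftEnd ξ (j - 1) else rightEnd ξ j

/-- The `n - 1` unit vectors on the wheel: `ε_1, …, ε_{n-2}`, and as the last one `±ε_{n-1}` or
`±ε_n`. -/
def unitVec (n : ℕ) (ξ : ℕ → ℤ) (j : ℕ) : Fin n → ℤ :=
  if j ≤ n - 2 then eps n j
  else if ξ (n - 1) = ξ n then (if ξ (n - 1) < ξ (n - 2) then eps n (n - 1) else -eps n (n - 1))
  else (if ξ (n - 1) < ξ (n - 2) then -eps n n else eps n n)

/-- The index of the unit vector which the Coxeter element multiplies by `-1`. -/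
def twist (n : ℕ) (ξ : ℕ → ℤ) : ℕ := if ξ (n - 1) = ξ n then n else n - 1

/-- The sign of `ε_t`, `t = twist n ξ`, in `η_i` for `i = n - 1` and `i = n`. -/
def spinSign (n : ℕ) (ξ : ℕ → ℤ) (i : ℕ) : ℤ := if ξ (n - 1) = ξ n ∧ i = n - 1 then -1 else 1

/-- The period `2n - 2`, after which the wheel repeats itself up to sign; it is the Coxeter
number. -/
def per (n : ℕ) : ℤ := 2 * (n : ℤ) - 2

/-- The sign with which the wheel at distance `d` repeats its value; zero if `d` is not a multiple
of the period. -/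
def perSign (n : ℕ) (d : ℤ) : ℤ := if per n ∣ d then ((d / per n).negOnePow : ℤ) else 0

/-- The wheel: a sequence of signed unit vectors, antiperiodic with period `per n`, on which the
Coxeter element acts by `x ↦ x - 2`. The meaningful positions are those congruent to `leftEnd ξ 0`
modulo `2`. -/
def wheel (n : ℕ) (ξ : ℕ → ℤ) (x : ℤ) : Fin n → ℤ :=
  -∑ j ∈ Finset.Icc 1 (n - 1), perSign n (x - pos n ξ j) • unitVec n ξ j

theorem perSign_add {n : ℕ} (hn : 4 ≤ n) (d : ℤ) : perSign n (d + per n) = -perSign n d := by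
  have hp : per n ≠ 0 := by unfold per; omega
  unfold perSign
  by_cases h : per n ∣ d
  · have h' : per n ∣ d + per n := dvd_add h dvd_rfl
    rw [if_pos h, if_pos h', Int.add_ediv_of_dvd_left h, Int.ediv_self hp, Int.negOnePow_succ]
    simp
  · have h' : ¬ per n ∣ d + per n := fun h1 => h ((dvd_add_left dvd_rfl).1 h1)
    rw [if_neg h, if_neg h', neg_zero]

theorem wheel_add_per {n : ℕ} (hn : 4 ≤ n) (ξ : ℕ → ℤ) (x : ℤ) :
    wheel n ξ (x + per n) = -wheel n ξ x := by
  simp only [wheel, neg_neg]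
  rw [← Finset.sum_neg_distrib]
  refine Finset.sum_congr rfl fun j _ => ?_
  rw [show x + per n - pos n ξ j = (x - pos n ξ j) + per n by ring, perSign_add hn, neg_smul, neg_neg]

theorem wheel_sub_per {n : ℕ} (hn : 4 ≤ n) (ξ : ℕ → ℤ) (x : ℤ) :
    wheel n ξ (x - per n) = -wheel n ξ x := by
  have := wheel_add_per hn ξ (x - per n)
  rw [sub_add_cancel] at this
  rw [this, neg_neg]

section
variable {n : ℕ} {ξ : ℕ → ℤ}

theorem IsHeight.step (H : IsHeight n ξ) {k : ℕ} (hk : k + 1 ≤ n - 2) :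
    chainHeight ξ (k + 1) = chainHeight ξ k + 1 ∨ chainHeight ξ (k + 1) = chainHeight ξ k - 1 := by
  unfold chainHeight
  rcases Nat.eq_zero_or_pos k with h | h
  · subst h; simp
  · rw [if_neg (by omega), if_neg (by omega)]
    exact H.chain k h (by omega)

theorem IsHeight.ends_step (H : IsHeight n ξ) {k : ℕ} (hk : k + 1 ≤ n - 2) :
    (leftEnd ξ (k + 1) = leftEnd ξ k - 2 ∧ rightEnd ξ (k + 1) = rightEnd ξ k ∧
      pos n ξ (k + 1) = leftEnd ξ k ∧ chainHeight ξ (k + 1) = chainHeight ξ k - 1) ∨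
    (leftEnd ξ (k + 1) = leftEnd ξ k ∧ rightEnd ξ (k + 1) = rightEnd ξ k + 2 ∧
      pos n ξ (k + 1) = rightEnd ξ (k + 1) ∧ chainHeight ξ (k + 1) = chainHeight ξ k + 1) := by
  have h4 := H.four_le
  have := H.step hk
  unfold pos leftEnd rightEnd
  rw [Nat.add_sub_cancel]
  push_cast
  split_ifs <;> omega

theorem IsHeight.ends_mono (H : IsHeight n ξ) {j k : ℕ} (hjk : j ≤ k) (hk : k ≤ n - 2) :
    leftEnd ξ k ≤ leftEnd ξ j ∧ rightEnd ξ j ≤ rightEnd ξ k := by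
  induction k, hjk using Nat.le_induction with
  | base => exact ⟨le_rfl, le_rfl⟩
  | succ k _ ih =>
    have := ih (by omega)
    rcases H.ends_step hk with h | h <;> omega

theorem rightEnd_sub_leftEnd (ξ : ℕ → ℤ) (k : ℕ) : rightEnd ξ k = leftEnd ξ k + 2 * k := by
  unfold leftEnd rightEnd; ring

theorem IsHeight.pos_mem (H : IsHeight n ξ) {j : ℕ} (hj : 1 ≤ j) (hjn : j ≤ n - 2) :
    leftEnd ξ j + 2 ≤ pos n ξ j ∧ pos n ξ j ≤ rightEnd ξ j := by
  obtain ⟨k, rfl⟩ : ∃ k, j = k + 1 := ⟨j - 1, by omega⟩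
  have h1 := rightEnd_sub_leftEnd ξ k
  have h2 := rightEnd_sub_leftEnd ξ (k + 1)
  push_cast at *
  rcases H.ends_step hjn with h | h <;> omega

/-- The unit vectors with indices up to `m` occupy the block `[leftEnd m + 2, rightEnd m]`. -/
theorem IsHeight.pos_mem_block (H : IsHeight n ξ) {j m : ℕ} (hj : 1 ≤ j) (hjm : j ≤ m)
    (hm : m ≤ n - 2) : leftEnd ξ m + 2 ≤ pos n ξ j ∧ pos n ξ j ≤ rightEnd ξ m := by
  have h1 := H.pos_mem hj (by omega)
  have h2 := H.ends_mono hjm hm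
  omega

theorem IsHeight.pos_last (H : IsHeight n ξ) : pos n ξ (n - 1) = leftEnd ξ (n - 2) := by
  have h4 := H.four_le
  unfold pos
  rw [if_pos (Or.inl rfl)]
  congr 1

/-- Each position is an end of the range of the positions before it. -/
theorem IsHeight.pos_valley (H : IsHeight n ξ) {k : ℕ} (hkn : k ≤ n - 1) :
    (∀ j, 1 ≤ j → j < k → pos n ξ k < pos n ξ j) ∨
      (∀ j, 1 ≤ j → j < k → pos n ξ j < pos n ξ k) := by
  have h4 := H.four_le
  rcases Nat.eq_zero_or_pos k with hk | hk
  · left; intro j _ _; omega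
  have hblock : ∀ j, 1 ≤ j → j < k → leftEnd ξ (k - 1) + 2 ≤ pos n ξ j ∧
      pos n ξ j ≤ rightEnd ξ (k - 1) := fun j h1 h2 => H.pos_mem_block h1 (by omega) (by omega)
  rcases Nat.lt_or_ge (n - 2) k with h | h
  · left
    intro j h1 h2
    have e : k = n - 1 := by omega
    have := hblock j h1 h2
    rw [e, H.pos_last]
    rw [e, show n - 1 - 1 = n - 2 by omega] at this
    omega
  · obtain ⟨m, rfl⟩ : ∃ m, k = m + 1 := ⟨k - 1, by omega⟩
    rw [Nat.add_sub_cancel] at hblock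
    rcases H.ends_step h with h' | h'
    · left; intro j h1 h2; have := hblock j h1 h2; omega
    · right; intro j h1 h2; have := hblock j h1 h2; omega

theorem IsHeight.pos_window (H : IsHeight n ξ) {j : ℕ} (hj : 1 ≤ j) (hjn : j ≤ n - 1) :
    leftEnd ξ (n - 2) ≤ pos n ξ j ∧ pos n ξ j ≤ leftEnd ξ (n - 2) + per n - 2 := by
  have h4 := H.four_le
  have h1 := rightEnd_sub_leftEnd ξ (n - 2)
  unfold per
  rcases Nat.lt_or_ge (n - 2) j with h | h
  · rw [show j = n - 1 by omega, H.pos_last]; omega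
  · have := H.pos_mem_block hj h le_rfl; omega

theorem IsHeight.pos_ne (H : IsHeight n ξ) {i j : ℕ} (hi : 1 ≤ i) (hin : i ≤ n - 1) (hj : 1 ≤ j)
    (hjn : j ≤ n - 1) (hij : i ≠ j) : pos n ξ i ≠ pos n ξ j := by
  rcases Nat.lt_or_gt_of_ne hij with h | h
  · rcases H.pos_valley hjn with h' | h' <;> have := h' i hi h <;> omega
  · rcases H.pos_valley hin with h' | h' <;> have := h' j hj h <;> omega

theorem IsHeight.per_pos (H : IsHeight n ξ) : 6 ≤ per n := by
  have := H.four_le; unfold per; omega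

/-- Positions of different unit vectors are incongruent modulo the period. -/
theorem IsHeight.pos_not_dvd (H : IsHeight n ξ) {i j : ℕ} (hi : 1 ≤ i) (hin : i ≤ n - 1)
    (hj : 1 ≤ j) (hjn : j ≤ n - 1) (hij : i ≠ j) : ¬ per n ∣ pos n ξ i - pos n ξ j := by
  intro h
  have h1 := H.pos_window hi hin
  have h2 := H.pos_window hj hjn
  have h3 := H.per_pos
  have := Int.eq_zero_of_abs_lt_dvd h (by rw [abs_lt]; omega)
  have := H.pos_ne hi hin hj hjn hij
  omega

theorem IsHeight.wheel_pos (H : IsHeight n ξ) {j : ℕ} (hj : 1 ≤ j) (hjn : j ≤ n - 1) :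
    wheel n ξ (pos n ξ j) = -unitVec n ξ j := by
  unfold wheel
  rw [Finset.sum_eq_single j]
  · simp [perSign]
  · intro i hi hij
    have hi := Finset.mem_Icc.1 hi
    rw [perSign, if_neg (H.pos_not_dvd hj hjn hi.1 hi.2 hij.symm), zero_smul]
  · intro h; exact absurd (Finset.mem_Icc.2 ⟨hj, hjn⟩) h

theorem unitVec_of_le {j : ℕ} (hj : j ≤ n - 2) : unitVec n ξ j = eps n j := if_pos hj

theorem IsHeight.wheel_pos_of_le (H : IsHeight n ξ) {j : ℕ} (hj : 1 ≤ j) (hjn : j ≤ n - 2) :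
    wheel n ξ (pos n ξ j) = -eps n j := by
  rw [H.wheel_pos hj (by omega), unitVec_of_le hjn]

theorem IsHeight.wheel_leftEnd (H : IsHeight n ξ) :
    wheel n ξ (leftEnd ξ (n - 2)) = -unitVec n ξ (n - 1) := by
  have h4 := H.four_le
  rw [← H.pos_last, H.wheel_pos (by omega) le_rfl]

theorem IsHeight.rightEnd_last (H : IsHeight n ξ) :
    rightEnd ξ (n - 2) = leftEnd ξ (n - 2) - 2 + per n := by
  have h4 := H.four_le
  have h1 := rightEnd_sub_leftEnd ξ (n - 2)
  unfold per
  omega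

/-! ### The vectors `η_i` on the wheel -/

/-- The vector `η_i` in terms of the wheel. -/
def startRoot (n : ℕ) (ξ : ℕ → ℤ) (i : ℕ) : Fin n → ℤ :=
  if i ≤ n - 2 then wheel n ξ (leftEnd ξ i) - wheel n ξ (rightEnd ξ i)
  else wheel n ξ (ξ i - ((n : ℤ) - 1)) + spinSign n ξ i • eps n (twist n ξ)

theorem startRoot_of_le {i : ℕ} (hi : i ≤ n - 2) :
    startRoot n ξ i = wheel n ξ (leftEnd ξ i) - wheel n ξ (rightEnd ξ i) := if_pos hi

theorem startRoot_zero : startRoot n ξ 0 = 0 := by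
  rw [startRoot_of_le (Nat.zero_le _)]
  simp [leftEnd, rightEnd]

theorem chainHeight_of_pos {i : ℕ} (hi : 1 ≤ i) : chainHeight ξ i = ξ i :=
  if_neg (by omega)

/-- The contribution of the left neighbour to the knitting recursion. -/
theorem IsHeight.knit_left (H : IsHeight n ξ) {i : ℕ} (hi : 1 ≤ i) (hin : i ≤ n - 2) :
    (if chainHeight ξ (i - 1) = chainHeight ξ i + 1 then startRoot n ξ (i - 1) else 0) =
      -eps n i - wheel n ξ (rightEnd ξ i) := by
  obtain ⟨k, rfl⟩ : ∃ k, i = k + 1 := ⟨i - 1, by omega⟩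
  rw [Nat.add_sub_cancel]
  have hw := H.wheel_pos_of_le hi hin
  rcases H.ends_step hin with h | h
  · rw [if_pos (by omega), startRoot_of_le (by omega), ← h.2.2.1, hw, h.2.1]
  · rw [if_neg (by omega), ← h.2.2.1, hw, sub_self]

/-- The contribution of the right neighbour to the knitting recursion on the chain. -/
theorem IsHeight.knit_right (H : IsHeight n ξ) {i : ℕ} (hin : i + 1 ≤ n - 2) :
    (if chainHeight ξ (i + 1) = chainHeight ξ i + 1 then startRoot n ξ (i + 1) else 0) =
      wheel n ξ (leftEnd ξ i) + eps n (i + 1) := by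
  have hw := H.wheel_pos_of_le (Nat.le_add_left 1 i) hin
  rcases H.ends_step hin with h | h
  · rw [if_neg (by omega), ← h.2.2.1, hw, neg_add_cancel]
  · rw [if_pos (by omega), startRoot_of_le hin, ← h.2.2.1, hw, h.1, sub_neg_eq_add]

theorem IsHeight.height_pred (H : IsHeight n ξ) :
    ξ (n - 1) = ξ (n - 2) + 1 ∨ ξ (n - 1) = ξ (n - 2) - 1 := by
  have h4 := H.four_le
  have := H.chain (n - 2) (by omega) (by omega)
  rwa [show n - 2 + 1 = n - 1 by omega] at this

theorem IsHeight.leftEnd_last (H : IsHeight n ξ) :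
    leftEnd ξ (n - 2) = ξ (n - 2) - ((n : ℤ) - 2) := by
  have h4 := H.four_le
  unfold leftEnd
  rw [chainHeight_of_pos (by omega)]
  omega

theorem IsHeight.wheel_before_last (H : IsHeight n ξ) :
    wheel n ξ (leftEnd ξ (n - 2) - 2) = -wheel n ξ (rightEnd ξ (n - 2)) := by
  rw [H.rightEnd_last, wheel_add_per H.four_le, neg_neg]

/-- The vector `η_i` for `i = n - 1` or `i = n`, if `i` has an arrow to `n - 2`. -/
theorem IsHeight.startRoot_up (H : IsHeight n ξ) {i : ℕ} (hi : i = n - 1 ∨ i = n)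
    (h : ξ i = ξ (n - 2) + 1) :
    startRoot n ξ i = -unitVec n ξ (n - 1) + spinSign n ξ i • eps n (twist n ξ) := by
  have h4 := H.four_le
  rw [startRoot, if_neg (by omega), ← H.wheel_leftEnd, H.leftEnd_last]
  congr 2
  omega

theorem IsHeight.startRoot_down (H : IsHeight n ξ) {i : ℕ} (hi : i = n - 1 ∨ i = n)
    (h : ξ i = ξ (n - 2) - 1) :
    startRoot n ξ i = -wheel n ξ (rightEnd ξ (n - 2)) + spinSign n ξ i • eps n (twist n ξ) := by
  have h4 := H.four_le
  rw [startRoot, if_neg (by omega), ← H.wheel_before_last, H.leftEnd_last]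
  congr 2
  omega

/-- The four orientations of the two edges at the end of the diagram. -/
theorem IsHeight.last_cases (H : IsHeight n ξ) :
    (ξ (n - 1) = ξ (n - 2) - 1 ∧ ξ n = ξ (n - 2) - 1 ∧ twist n ξ = n ∧
      unitVec n ξ (n - 1) = eps n (n - 1) ∧ spinSign n ξ (n - 1) = -1 ∧ spinSign n ξ n = 1) ∨
    (ξ (n - 1) = ξ (n - 2) + 1 ∧ ξ n = ξ (n - 2) + 1 ∧ twist n ξ = n ∧
      unitVec n ξ (n - 1) = -eps n (n - 1) ∧ spinSign n ξ (n - 1) = -1 ∧ spinSign n ξ n = 1) ∨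
    (ξ (n - 1) = ξ (n - 2) + 1 ∧ ξ n = ξ (n - 2) - 1 ∧ twist n ξ = n - 1 ∧
      unitVec n ξ (n - 1) = eps n n ∧ spinSign n ξ (n - 1) = 1 ∧ spinSign n ξ n = 1) ∨
    (ξ (n - 1) = ξ (n - 2) - 1 ∧ ξ n = ξ (n - 2) + 1 ∧ twist n ξ = n - 1 ∧
      unitVec n ξ (n - 1) = -eps n n ∧ spinSign n ξ (n - 1) = 1 ∧ spinSign n ξ n = 1) := by
  have h4 := H.four_le
  have e1 : ¬ n - 1 ≤ n - 2 := by omega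
  have e2 : n ≠ n - 1 := by omega
  unfold twist unitVec spinSign
  rw [if_neg e1]
  simp only [e2, and_false, if_false, and_true]
  rcases H.height_pred with h1 | h1 <;> rcases H.last with h2 | h2
  · right; left
    have hc : ξ (n - 1) = ξ n := by omega
    have hl : ¬ ξ (n - 1) < ξ (n - 2) := by omega
    simp only [if_pos hc, if_neg hl]
    exact ⟨h1, h2, by simp⟩
  · right; right; left
    have hc : ¬ ξ (n - 1) = ξ n := by omega
    have hl : ¬ ξ (n - 1) < ξ (n - 2) := by omega
    simp only [if_neg hc, if_neg hl]
    exact ⟨h1, h2, by simp⟩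
  · right; right; right
    have hc : ¬ ξ (n - 1) = ξ n := by omega
    have hl : ξ (n - 1) < ξ (n - 2) := by omega
    simp only [if_neg hc, if_pos hl]
    exact ⟨h1, h2, by simp⟩
  · left
    have hc : ξ (n - 1) = ξ n := by omega
    have hl : ξ (n - 1) < ξ (n - 2) := by omega
    simp only [if_pos hc, if_pos hl]
    exact ⟨h1, h2, by simp⟩

/-- The contribution of the vertices `n - 1` and `n` to the knitting recursion. -/
theorem IsHeight.knit_branch (H : IsHeight n ξ) :
    (if ξ (n - 1) = ξ (n - 2) + 1 then startRoot n ξ (n - 1) else 0) +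
      (if ξ n = ξ (n - 2) + 1 then startRoot n ξ n else 0) =
      wheel n ξ (leftEnd ξ (n - 2)) + eps n (n - 1) := by
  rw [H.wheel_leftEnd]
  rcases H.last_cases with h | h | h | h <;> obtain ⟨h1, h2, h3, h5, h6, h7⟩ := h
  · rw [if_neg (by omega), if_neg (by omega), h5]; abel
  · rw [if_pos h1, if_pos h2, H.startRoot_up (Or.inl rfl) h1, H.startRoot_up (Or.inr rfl) h2, h3,
      h5, h6, h7]; module
  · rw [if_pos h1, if_neg (by omega), H.startRoot_up (Or.inl rfl) h1, h3, h5, h6]; module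
  · rw [if_neg (by omega), if_pos h2, H.startRoot_up (Or.inr rfl) h2, h3, h5, h7]; module

theorem simpleRoot_of_lt {i : ℕ} (hi : i < n) : simpleRoot n i = eps n i - eps n (i + 1) :=
  if_pos hi

theorem simpleRoot_self : simpleRoot n n = eps n (n - 1) + eps n n := if_neg (by omega)

theorem IsHeight.knit_last (H : IsHeight n ξ) {i : ℕ} (hi : i = n - 1 ∨ i = n) :
    startRoot n ξ i =
      simpleRoot n i + if ξ (n - 2) = ξ i + 1 then startRoot n ξ (n - 2) else 0 := by
  have h4 := H.four_le
  have e : simpleRoot n (n - 1) = eps n (n - 1) - eps n n := by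
    rw [simpleRoot_of_lt (by omega), show n - 1 + 1 = n by omega]
  rcases H.last_cases with h | h | h | h <;> obtain ⟨h1, h2, h3, h5, h6, h7⟩ := h <;>
    rcases hi with rfl | rfl
  · rw [H.startRoot_down (Or.inl rfl) h1, if_pos (by omega), startRoot_of_le le_rfl,
      H.wheel_leftEnd, e, h3, h5, h6]; module
  · rw [H.startRoot_down (Or.inr rfl) h2, if_pos (by omega), startRoot_of_le le_rfl,
      H.wheel_leftEnd, simpleRoot_self, h3, h5, h7]; module
  · rw [H.startRoot_up (Or.inl rfl) h1, if_neg (by omega), e, h3, h5, h6]; module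
  · rw [H.startRoot_up (Or.inr rfl) h2, if_neg (by omega), simpleRoot_self, h3, h5, h7]; module
  · rw [H.startRoot_up (Or.inl rfl) h1, if_neg (by omega), e, h3, h5, h6]; module
  · rw [H.startRoot_down (Or.inr rfl) h2, if_pos (by omega), startRoot_of_le le_rfl,
      H.wheel_leftEnd, simpleRoot_self, h3, h5, h7]; module
  · rw [H.startRoot_down (Or.inl rfl) h1, if_pos (by omega), startRoot_of_le le_rfl,
      H.wheel_leftEnd, e, h3, h5, h6]; module
  · rw [H.startRoot_up (Or.inr rfl) h2, if_neg (by omega), simpleRoot_self, h3, h5, h7]; module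

/-- The explicit vectors satisfy the same recursion as the `η_i`, hence they agree with them. -/
theorem IsHeight.isKnitting_startRoot (H : IsHeight n ξ) {Q : DynkinQuiver n}
    (hξ : Q.IsHeightFunction ξ) : Q.IsKnitting (startRoot n ξ) := by
  classical
  intro i hi hin
  have h4 := H.four_le
  -- the vertices with an arrow to `i`, from an explicit list of the neighbours of `i`
  have key : ∀ S : Finset ℕ, (∀ j, j ∈ S ↔ DiagramAdj n j i) →
      (Finset.Icc 1 n).filter (fun j => Q.arrow j i) = S.filter (fun j => ξ j = ξ i + 1) := by
    intro S hS
    ext j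
    rw [Finset.mem_filter, Finset.mem_filter, hS, hξ.arrow_iff, Finset.mem_Icc]
    constructor
    · rintro ⟨_, h1, h2⟩; exact ⟨h1, by omega⟩
    · rintro ⟨h1, h2⟩
      refine ⟨?_, h1, by omega⟩
      unfold DiagramAdj at h1; omega
  rcases Nat.lt_or_ge (n - 2) i with hb | hb
  · rw [key {n - 2} (by intro j; rw [Finset.mem_singleton]; unfold DiagramAdj; omega),
      Finset.sum_filter, Finset.sum_singleton]
    exact H.knit_last (by omega)
  have hα : simpleRoot n i = eps n i - eps n (i + 1) := simpleRoot_of_lt (by omega)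
  have hL := H.knit_left hi hb
  rw [chainHeight_of_pos hi] at hL
  rw [startRoot_of_le hb, hα]
  rcases Nat.lt_or_ge i (n - 2) with hb' | hb'
  · have hR := H.knit_right (i := i) (by omega)
    rw [chainHeight_of_pos hi, chainHeight_of_pos (Nat.le_add_left 1 i)] at hR
    rcases Nat.lt_or_ge 1 i with hi1 | hi1
    · rw [key {i - 1, i + 1} (by
          intro j; rw [Finset.mem_insert, Finset.mem_singleton]; unfold DiagramAdj; omega),
        Finset.sum_filter, Finset.sum_insert (by rw [Finset.mem_singleton]; omega),
        Finset.sum_singleton, hR]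
      rw [chainHeight_of_pos (by omega)] at hL
      rw [hL]; abel
    · rw [key {i + 1} (by intro j; rw [Finset.mem_singleton]; unfold DiagramAdj; omega),
        Finset.sum_filter, Finset.sum_singleton, hR]
      rw [show i - 1 = 0 by omega, startRoot_zero, ite_self] at hL
      have : wheel n ξ (rightEnd ξ i) = -eps n i := by
        rw [eq_comm, ← sub_eq_zero]; exact hL.symm
      rw [this]; abel
  · have hin2 : i = n - 2 := by omega
    have hR := H.knit_branch
    rw [chainHeight_of_pos (by omega)] at hL
    rw [key {i - 1, n - 1, n} (by
        intro j; rw [Finset.mem_insert, Finset.mem_insert, Finset.mem_singleton]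
        unfold DiagramAdj; omega),
      Finset.sum_filter,
      Finset.sum_insert (by rw [Finset.mem_insert, Finset.mem_singleton]; omega),
      Finset.sum_insert (by rw [Finset.mem_singleton]; omega), Finset.sum_singleton, hL]
    subst hin2
    rw [hR, show n - 2 + 1 = n - 1 by omega]; abel

/-! ### The Coxeter element on the wheel -/

/-- Pairing with the simple roots: only the simple roots involving `ε_c` contribute. -/
theorem sum_eps_dot (hn : 4 ≤ n) (h : ℕ → Fin n → ℤ) {c : ℕ} (hc : 1 ≤ c) (hcn : c ≤ n) :
    ∑ j ∈ Finset.Icc 1 n, (eps n c ⬝ᵥ simpleRoot n j) • h j =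
      h c - (if 2 ≤ c then h (c - 1) else 0) + if c = n - 1 then h n else 0 := by
  have key : ∀ j ∈ Finset.Icc 1 n, (eps n c ⬝ᵥ simpleRoot n j) • h j =
      (if j = c then h c else 0) - (if j = c - 1 then h (c - 1) else 0) +
        (if j = n then (if c = n - 1 then h n else 0) else 0) := by
    intro j hj
    have hj := Finset.mem_Icc.1 hj
    rw [eps_dot_simpleRoot (by omega) hc hcn hj.2]
    by_cases h1 : c = j
    · subst h1
      rw [if_pos rfl, if_pos rfl, if_neg (by omega : ¬ c = c - 1)]
      by_cases h2 : c = n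
      · rw [if_pos h2, if_neg (by omega)]; simp
      · rw [if_neg h2]; simp
    · rw [if_neg h1, if_neg (Ne.symm h1)]
      by_cases h2 : j < n ∧ c = j + 1
      · rw [if_pos h2, if_pos (by omega), if_neg (by omega)]
        rw [show c - 1 = j by omega]; simp
      · rw [if_neg h2, if_neg (by omega : ¬ j = c - 1)]
        by_cases h3 : j = n
        · rw [if_pos h3]
          by_cases h4 : c = n - 1
          · rw [if_pos ⟨h3, h4⟩, if_pos h4, h3]; simp
          · rw [if_neg (by omega), if_neg h4]; simp
        · rw [if_neg (by omega), if_neg h3]; simp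
  rw [Finset.sum_congr rfl key, Finset.sum_add_distrib, Finset.sum_sub_distrib,
    Finset.sum_ite_eq', Finset.sum_ite_eq', Finset.sum_ite_eq']
  rw [if_pos (Finset.mem_Icc.2 ⟨hc, hcn⟩), if_pos (Finset.mem_Icc.2 (by omega : 1 ≤ n ∧ n ≤ n))]
  congr 2
  by_cases h2 : 2 ≤ c
  · rw [if_pos h2, if_pos (Finset.mem_Icc.2 (by omega))]
  · rw [if_neg h2, if_neg (by rw [Finset.mem_Icc]; omega)]

/-- The linear map `v ↦ v - Σ (v, α_j) η_j`, which is the Coxeter element. -/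
def coxeter (n : ℕ) (ξ : ℕ → ℤ) (v : Fin n → ℤ) : Fin n → ℤ :=
  v - ∑ j ∈ Finset.Icc 1 n, (v ⬝ᵥ simpleRoot n j) • startRoot n ξ j

theorem coxeter_smul (c : ℤ) (v : Fin n → ℤ) : coxeter n ξ (c • v) = c • coxeter n ξ v := by
  unfold coxeter
  rw [smul_sub, Finset.smul_sum]
  congr 2
  ext j : 1
  rw [smul_dotProduct, smul_eq_mul, mul_smul]

theorem coxeter_neg (v : Fin n → ℤ) : coxeter n ξ (-v) = -coxeter n ξ v := by
  simpa using coxeter_smul (ξ := ξ) (-1) v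

theorem coxeter_add (u v : Fin n → ℤ) :
    coxeter n ξ (u + v) = coxeter n ξ u + coxeter n ξ v := by
  unfold coxeter
  simp only [add_dotProduct, add_smul, Finset.sum_add_distrib]
  abel

theorem coxeter_sub (u v : Fin n → ℤ) :
    coxeter n ξ (u - v) = coxeter n ξ u - coxeter n ξ v := by
  rw [sub_eq_add_neg, coxeter_add, coxeter_neg, ← sub_eq_add_neg]

theorem IsHeight.coxeter_eps (H : IsHeight n ξ) {c : ℕ} (hc : 1 ≤ c) (hcn : c ≤ n - 2) :
    coxeter n ξ (eps n c) = eps n c - startRoot n ξ c + startRoot n ξ (c - 1) := by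
  have h4 := H.four_le
  rw [coxeter, sum_eps_dot h4 _ hc (by omega), if_neg (by omega : ¬ c = n - 1)]
  by_cases h : 2 ≤ c
  · rw [if_pos h]; abel
  · rw [if_neg h, show c - 1 = 0 by omega, startRoot_zero]; abel

theorem IsHeight.coxeter_eps_pred (H : IsHeight n ξ) : coxeter n ξ (eps n (n - 1)) =
    eps n (n - 1) - startRoot n ξ (n - 1) + startRoot n ξ (n - 2) - startRoot n ξ n := by
  have h4 := H.four_le
  rw [coxeter, sum_eps_dot h4 _ (by omega) (by omega), if_pos rfl, if_pos (by omega),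
    show n - 1 - 1 = n - 2 by omega]
  abel

theorem IsHeight.coxeter_eps_last (H : IsHeight n ξ) : coxeter n ξ (eps n n) =
    eps n n - startRoot n ξ n + startRoot n ξ (n - 1) := by
  have h4 := H.four_le
  rw [coxeter, sum_eps_dot h4 _ (by omega) (by omega), if_neg (by omega : ¬ n = n - 1),
    if_pos (by omega)]
  abel

theorem IsHeight.coxeter_twist (H : IsHeight n ξ) :
    coxeter n ξ (eps n (twist n ξ)) = -eps n (twist n ξ) := by
  rcases H.last_cases with h | h | h | h <;> obtain ⟨h1, h2, h3, h5, h6, h7⟩ := h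
  · rw [h3, H.coxeter_eps_last, H.startRoot_down (Or.inl rfl) h1, H.startRoot_down (Or.inr rfl) h2,
      h3, h6, h7]; module
  · rw [h3, H.coxeter_eps_last, H.startRoot_up (Or.inl rfl) h1, H.startRoot_up (Or.inr rfl) h2,
      h3, h6, h7]; module
  · rw [h3, H.coxeter_eps_pred, H.startRoot_up (Or.inl rfl) h1, H.startRoot_down (Or.inr rfl) h2,
      startRoot_of_le le_rfl, H.wheel_leftEnd, h3, h6, h7]; module
  · rw [h3, H.coxeter_eps_pred, H.startRoot_down (Or.inl rfl) h1, H.startRoot_up (Or.inr rfl) h2,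
      startRoot_of_le le_rfl, H.wheel_leftEnd, h3, h6, h7]; module

theorem IsHeight.coxeter_wheel_pos (H : IsHeight n ξ) {j : ℕ} (hj : 1 ≤ j) (hjn : j ≤ n - 1) :
    coxeter n ξ (wheel n ξ (pos n ξ j)) = wheel n ξ (pos n ξ j - 2) := by
  have h4 := H.four_le
  rcases Nat.lt_or_ge (n - 2) j with hb | hb
  · obtain rfl : j = n - 1 := by omega
    rw [H.wheel_pos hj hjn, H.pos_last, H.wheel_before_last, coxeter_neg]
    rcases H.last_cases with h | h | h | h <;> obtain ⟨h1, h2, h3, h5, h6, h7⟩ := h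
    · rw [h5, H.coxeter_eps_pred, H.startRoot_down (Or.inl rfl) h1,
        H.startRoot_down (Or.inr rfl) h2, startRoot_of_le le_rfl, H.wheel_leftEnd, h5, h6, h7]
      module
    · rw [h5, coxeter_neg, H.coxeter_eps_pred, H.startRoot_up (Or.inl rfl) h1,
        H.startRoot_up (Or.inr rfl) h2, startRoot_of_le le_rfl, H.wheel_leftEnd, h5, h6, h7]
      module
    · rw [h5, H.coxeter_eps_last, H.startRoot_up (Or.inl rfl) h1,
        H.startRoot_down (Or.inr rfl) h2, h5, h6, h7]
      module
    · rw [h5, coxeter_neg, H.coxeter_eps_last, H.startRoot_down (Or.inl rfl) h1,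
        H.startRoot_up (Or.inr rfl) h2, h5, h6, h7]
      module
  · have hw := H.wheel_pos_of_le hj hb
    rw [hw, coxeter_neg, H.coxeter_eps hj hb, startRoot_of_le hb, startRoot_of_le (by omega)]
    obtain ⟨k, rfl⟩ : ∃ k, j = k + 1 := ⟨j - 1, by omega⟩
    rw [Nat.add_sub_cancel]
    rcases H.ends_step hb with ⟨e1, e2, e3, _⟩ | ⟨e1, e2, e3, _⟩
    · rw [e3] at hw
      rw [hw, e3, ← e1, e2]; abel
    · rw [e3] at hw
      rw [hw, e3, e1, e2, add_sub_cancel_right]; abel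

end

section
variable {n : ℕ} {ξ : ℕ → ℤ}

/-! ### Values of the wheel -/

theorem per_even (n : ℕ) : (2 : ℤ) ∣ per n := by unfold per; omega

theorem IsHeight.leftEnd_parity (H : IsHeight n ξ) {k : ℕ} (hk : k ≤ n - 2) :
    (2 : ℤ) ∣ leftEnd ξ k - leftEnd ξ 0 := by
  induction k with
  | zero => simp
  | succ k ih =>
    have := ih (by omega)
    rcases H.ends_step hk with h | h <;> omega

theorem IsHeight.rightEnd_parity (H : IsHeight n ξ) {k : ℕ} (hk : k ≤ n - 2) :
    (2 : ℤ) ∣ rightEnd ξ k - leftEnd ξ 0 := by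
  have := H.leftEnd_parity hk
  have := rightEnd_sub_leftEnd ξ k
  omega

/-- The positions in the block of `m` are those of the first `m` unit vectors. -/
theorem IsHeight.exists_pos_of_block (H : IsHeight n ξ) {m : ℕ} (hm : m ≤ n - 2) {x : ℤ}
    (hx : (2 : ℤ) ∣ x - leftEnd ξ 0) (h1 : leftEnd ξ m + 2 ≤ x) (h2 : x ≤ rightEnd ξ m) :
    ∃ j, 1 ≤ j ∧ j ≤ m ∧ pos n ξ j = x := by
  induction m with
  | zero => have := rightEnd_sub_leftEnd ξ 0; omega
  | succ m ih =>
    have hp := H.leftEnd_parity (k := m) (by omega)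
    have hr := rightEnd_sub_leftEnd ξ m
    rcases H.ends_step hm with h | h
    · by_cases e : x = leftEnd ξ m
      · exact ⟨m + 1, by omega, le_rfl, by omega⟩
      · obtain ⟨j, a, b, c⟩ := ih (by omega) (by omega) (by omega)
        exact ⟨j, a, by omega, c⟩
    · by_cases e : x = rightEnd ξ (m + 1)
      · exact ⟨m + 1, by omega, le_rfl, by omega⟩
      · obtain ⟨j, a, b, c⟩ := ih (by omega) (by omega) (by omega)
        exact ⟨j, a, by omega, c⟩

/-- Within the block of `m` the wheel takes the values `-ε_1, …, -ε_m`. -/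
theorem IsHeight.wheel_of_block (H : IsHeight n ξ) {m : ℕ} (hm : m ≤ n - 2) {x : ℤ}
    (hx : (2 : ℤ) ∣ x - leftEnd ξ 0) (h1 : leftEnd ξ m + 2 ≤ x) (h2 : x ≤ rightEnd ξ m) :
    ∃ j, 1 ≤ j ∧ j ≤ m ∧ pos n ξ j = x ∧ wheel n ξ x = -eps n j := by
  obtain ⟨j, a, b, rfl⟩ := H.exists_pos_of_block hm hx h1 h2
  exact ⟨j, a, b, rfl, H.wheel_pos_of_le a (by omega)⟩

theorem wheel_add_mul_per (hn : 4 ≤ n) (x k : ℤ) :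
    wheel n ξ (x + k * per n) = (k.negOnePow : ℤ) • wheel n ξ x := by
  induction k using Int.induction_on with
  | zero => simp
  | succ k ih =>
    rw [show x + ((k : ℤ) + 1) * per n = (x + k * per n) + per n by ring, wheel_add_per hn, ih,
      Int.negOnePow_succ]
    simp
  | pred k ih =>
    rw [show x + (-(k : ℤ) - 1) * per n = (x + -k * per n) - per n by ring, wheel_sub_per hn, ih,
      Int.negOnePow_sub, Int.negOnePow_one]
    simp

theorem IsHeight.exists_pos_add_mul (H : IsHeight n ξ) {x : ℤ}
    (hx : (2 : ℤ) ∣ x - leftEnd ξ 0) :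
    ∃ j, 1 ≤ j ∧ j ≤ n - 1 ∧ ∃ k : ℤ, x = pos n ξ j + k * per n := by
  have h4 := H.four_le
  have hp := H.per_pos
  set d := x - leftEnd ξ (n - 2) with hd
  have e1 := Int.emod_add_mul_ediv d (per n)
  have e2 := Int.emod_nonneg d (show per n ≠ 0 by omega)
  have e3 := Int.emod_lt_of_pos d (show 0 < per n by omega)
  have hl := H.leftEnd_parity (k := n - 2) le_rfl
  have e4 : (2 : ℤ) ∣ per n * (d / per n) := dvd_mul_of_dvd_left (per_even n) _
  have hpe := per_even n
  by_cases h0 : d % per n = 0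
  · refine ⟨n - 1, by omega, le_rfl, d / per n, ?_⟩
    rw [H.pos_last, mul_comm]; omega
  · have hR := H.rightEnd_last
    obtain ⟨j, a, b, c⟩ := H.exists_pos_of_block (m := n - 2) le_rfl
      (x := leftEnd ξ (n - 2) + d % per n) (by omega) (by omega) (by omega)
    refine ⟨j, a, by omega, d / per n, ?_⟩
    rw [c, mul_comm]; omega

theorem IsHeight.wheel_pos_add_mul (H : IsHeight n ξ) {j : ℕ} (hj : 1 ≤ j) (hjn : j ≤ n - 1)
    (k : ℤ) : wheel n ξ (pos n ξ j + k * per n) = (k.negOnePow : ℤ) • -unitVec n ξ j := by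
  rw [wheel_add_mul_per H.four_le, H.wheel_pos hj hjn]

theorem negOnePow_cases (k : ℤ) : (k.negOnePow : ℤ) = 1 ∨ (k.negOnePow : ℤ) = -1 := by
  rcases Int.even_or_odd k with h | h
  · left; rw [Int.negOnePow_even _ h]; rfl
  · right; rw [Int.negOnePow_odd _ h]; rfl

/-- The last unit vector and `ε_t` are, up to sign, `ε_{n-1}` and `ε_n`. -/
theorem IsHeight.unitVec_last (H : IsHeight n ξ) : ∃ c, (c = n - 1 ∨ c = n) ∧ c ≠ twist n ξ ∧
    (unitVec n ξ (n - 1) = eps n c ∨ unitVec n ξ (n - 1) = -eps n c) := by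
  have h4 := H.four_le
  rcases H.last_cases with h | h | h | h <;> obtain ⟨h1, h2, h3, h5, h6, h7⟩ := h
  · exact ⟨n - 1, by omega, by omega, Or.inl h5⟩
  · exact ⟨n - 1, by omega, by omega, Or.inr h5⟩
  · exact ⟨n, by omega, by omega, Or.inl h5⟩
  · exact ⟨n, by omega, by omega, Or.inr h5⟩

theorem twist_mem : twist n ξ = n - 1 ∨ twist n ξ = n := by
  unfold twist; split_ifs <;> simp

theorem IsHeight.unitVec_eq (H : IsHeight n ξ) {j : ℕ} (hj : 1 ≤ j) (hjn : j ≤ n - 1) :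
    ∃ c, j ≤ c ∧ c ≤ n ∧ c ≠ twist n ξ ∧ (j ≤ n - 2 → c = j) ∧
      (unitVec n ξ j = eps n c ∨ unitVec n ξ j = -eps n c) := by
  have h4 := H.four_le
  rcases Nat.lt_or_ge (n - 2) j with h | h
  · obtain rfl : j = n - 1 := by omega
    obtain ⟨c, h1, h2, h3⟩ := H.unitVec_last
    exact ⟨c, by omega, by omega, h2, by omega, h3⟩
  · have := twist_mem (n := n) (ξ := ξ)
    exact ⟨j, le_rfl, by omega, by omega, fun _ => rfl, Or.inl (unitVec_of_le h)⟩

theorem isPosRoot_add_signed {i c : ℕ} {u : Fin n → ℤ} (hi : 1 ≤ i) (hic : i < c) (hc : c ≤ n)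
    (hu : u = eps n c ∨ u = -eps n c) : IsPosRoot n (eps n i + u) := by
  rcases hu with rfl | rfl
  · exact ⟨i, c, hi, hic, hc, Or.inr rfl⟩
  · exact ⟨i, c, hi, hic, hc, Or.inl (sub_eq_add_neg _ _).symm⟩

theorem IsHeight.isPosRoot_eps_add (H : IsHeight n ξ) {i k : ℕ} {u : Fin n → ℤ} (hi : 1 ≤ i)
    (hik : i < k) (hk : k ≤ n - 1)
    (hu : u = unitVec n ξ k ∨ u = -unitVec n ξ k) : IsPosRoot n (eps n i + u) := by
  obtain ⟨c, h1, h2, _, _, h3⟩ := H.unitVec_eq (show 1 ≤ k by omega) hk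
  refine isPosRoot_add_signed hi (show i < c by omega) h2 ?_
  rcases hu with rfl | rfl <;> rcases h3 with h3 | h3 <;> simp [h3]

theorem IsHeight.isPosRoot_twist (H : IsHeight n ξ) {j : ℕ} {s : ℤ} (hj : 1 ≤ j) (hjn : j ≤ n - 2)
    (hs : s = 1 ∨ s = -1) : IsPosRoot n (eps n j + s • eps n (twist n ξ)) := by
  have h4 := H.four_le
  have := twist_mem (n := n) (ξ := ξ)
  refine isPosRoot_add_signed hj (show j < twist n ξ by omega) (by omega) ?_
  rcases hs with rfl | rfl <;> simp

/-! ### Positivity -/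

/-- The value of the wheel at a position which, modulo the period, lies outside the block of
`m`. -/
theorem IsHeight.wheel_of_gap (H : IsHeight n ξ) {m : ℕ} (hm : m ≤ n - 2) {x : ℤ}
    (hx : (2 : ℤ) ∣ x - leftEnd ξ 0) (h1 : rightEnd ξ m - per n + 2 ≤ x) (h2 : x ≤ leftEnd ξ m) :
    ∃ k, m < k ∧ k ≤ n - 1 ∧ (wheel n ξ x = unitVec n ξ k ∨ wheel n ξ x = -unitVec n ξ k) := by
  obtain ⟨j, a, b, k, e⟩ := H.exists_pos_add_mul hx
  refine ⟨j, ?_, b, ?_⟩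
  · by_contra hjm
    have hb := H.pos_mem_block a (show j ≤ m by omega) hm
    have hdvd : per n ∣ x - pos n ξ j := ⟨k, by rw [e]; ring⟩
    have := Int.eq_zero_of_abs_lt_dvd hdvd (by rw [abs_lt]; omega)
    omega
  · rw [e, H.wheel_pos_add_mul a b]
    rcases negOnePow_cases k with h | h <;> rw [h] <;> simp

/-- Outside the block of `m` the wheel is decreasing: its value minus a later value is a positive
root. Enlarging the block takes away the extreme positions of its complement one by one, and they
carry `ε_{m+1}` on the left and `-ε_{m+1}` on the right. -/
theorem IsHeight.isPosRoot_of_gap (H : IsHeight n ξ) {x y : ℤ} (hx : (2 : ℤ) ∣ x - leftEnd ξ 0)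
    (hy : (2 : ℤ) ∣ y - leftEnd ξ 0) (hxy : x < y) (d : ℕ) : ∀ m, m + d = n - 2 →
    rightEnd ξ m - per n + 2 ≤ x → y ≤ leftEnd ξ m →
    IsPosRoot n (wheel n ξ x - wheel n ξ y) := by
  induction d with
  | zero =>
    intro m hm h1 h2
    have := H.rightEnd_last
    obtain rfl : m = n - 2 := by omega
    omega
  | succ d ih =>
    intro m hm h1 h2
    have hl := H.leftEnd_parity (show m ≤ n - 2 by omega)
    have hr := H.rightEnd_parity (show m ≤ n - 2 by omega)
    have hpe := per_even n
    have hw := H.wheel_pos_of_le (j := m + 1) (by omega) (by omega)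
    rcases H.ends_step (show m + 1 ≤ n - 2 by omega) with h | h
    · by_cases e : y = leftEnd ξ m
      · obtain ⟨k, b1, b2, b3⟩ := H.wheel_of_gap (show m + 1 ≤ n - 2 by omega) hx (by omega)
          (by omega)
        rw [e, ← h.2.2.1, hw, sub_neg_eq_add, add_comm]
        exact H.isPosRoot_eps_add (by omega) b1 b2 b3
      · exact ih (m + 1) (by omega) (by omega) (by omega)
    · by_cases e : x = rightEnd ξ m - per n + 2
      · obtain ⟨k, b1, b2, b3⟩ := H.wheel_of_gap (show m + 1 ≤ n - 2 by omega) hy (by omega)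
          (by omega)
        rw [show x = pos n ξ (m + 1) - per n by omega, wheel_sub_per H.four_le, hw, neg_neg,
          sub_eq_add_neg]
        refine H.isPosRoot_eps_add (by omega) b1 b2 ?_
        rcases b3 with b3 | b3 <;> simp [b3]
      · exact ih (m + 1) (by omega) (by omega) (by omega)

/-- On the residue `l ≤ n - 2` the labels are positive throughout one period. The roots among
them with a coordinate in the block of `l` have a summand `ε_j` with `j ≤ l`. -/
theorem IsHeight.isPosRoot_wheel (H : IsHeight n ξ) {l : ℕ} (hl : 1 ≤ l) (hln : l ≤ n - 2) {x y : ℤ}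
    (hx : (2 : ℤ) ∣ x - leftEnd ξ 0) (hxy : y = x + 2 * l) (h1 : leftEnd ξ l - per n + 2 ≤ x)
    (h2 : x ≤ leftEnd ξ l) : IsPosRoot n (wheel n ξ x - wheel n ξ y) := by
  have h4 := H.four_le
  have hy : (2 : ℤ) ∣ y - leftEnd ξ 0 := by omega
  have hle := H.leftEnd_parity hln
  have hre := H.rightEnd_parity hln
  have hpe := per_even n
  have hr := rightEnd_sub_leftEnd ξ l
  have hlper : 2 * (l : ℤ) ≤ per n - 2 := by unfold per; omega
  by_cases hyb : leftEnd ξ l + 2 ≤ y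
  · obtain ⟨j, a1, a2, a3, a4⟩ := H.wheel_of_block hln hy hyb (by omega)
    rw [a4, sub_neg_eq_add]
    by_cases hxb : x ≤ rightEnd ξ l - per n
    · obtain ⟨i, b1, b2, b3, b4⟩ := H.wheel_of_block hln (x := x + per n) (by omega) (by omega)
        (by omega)
      rw [wheel_add_per h4] at b4
      rw [neg_injective b4]
      have hij : i ≠ j := by rintro rfl; omega
      rcases Nat.lt_or_gt_of_ne hij with h | h
      · exact ⟨i, j, b1, h, by omega, Or.inr rfl⟩
      · exact ⟨j, i, a1, h, by omega, Or.inr (add_comm _ _)⟩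
    · obtain ⟨k, b1, b2, b3⟩ := H.wheel_of_gap hln hx (by omega) h2
      rw [add_comm]
      exact H.isPosRoot_eps_add a1 (by omega) b2 b3
  · by_cases hxb : x ≤ rightEnd ξ l - per n
    · obtain ⟨i, b1, b2, b3, b4⟩ := H.wheel_of_block hln (x := x + per n) (by omega) (by omega)
        (by omega)
      rw [wheel_add_per h4] at b4
      rw [neg_injective b4]
      obtain ⟨k, c1, c2, c3⟩ := H.wheel_of_gap hln hy (by omega) (by omega)
      rw [sub_eq_add_neg]
      refine H.isPosRoot_eps_add b1 (by omega) c2 ?_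
      rcases c3 with c3 | c3 <;> simp [c3]
    · exact H.isPosRoot_of_gap hx hy (by omega) (n - 2 - l) l (by omega) (by omega) (by omega)

/-! ### Labels of the vertices of the repetition quiver -/

/-- The vector `τ^k η_i` at the vertex `(i, ξ_i - 2k)`, in terms of the wheel. -/
def label (n : ℕ) (ξ : ℕ → ℤ) (v : ℕ × ℤ) : Fin n → ℤ :=
  if v.1 ≤ n - 2 then wheel n ξ (v.2 - v.1) - wheel n ξ (v.2 + v.1)
  else wheel n ξ (v.2 - ((n : ℤ) - 1)) +
    (spinSign n ξ v.1 * (((ξ v.1 - v.2) / 2).negOnePow : ℤ)) • eps n (twist n ξ)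

theorem label_of_le {i : ℕ} {p : ℤ} (hi : i ≤ n - 2) :
    label n ξ (i, p) = wheel n ξ (p - i) - wheel n ξ (p + i) := if_pos hi

theorem spinSign_cases (i : ℕ) : spinSign n ξ i = 1 ∨ spinSign n ξ i = -1 := by
  unfold spinSign; split_ifs <;> simp

theorem label_of_gt {i : ℕ} {p : ℤ} (hi : ¬ i ≤ n - 2) : ∃ s : ℤ, (s = 1 ∨ s = -1) ∧
    label n ξ (i, p) = wheel n ξ (p - ((n : ℤ) - 1)) + s • eps n (twist n ξ) := by
  refine ⟨_, ?_, if_neg hi⟩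
  rcases spinSign_cases (n := n) (ξ := ξ) i with h | h <;>
    rcases negOnePow_cases ((ξ i - p) / 2) with h' | h' <;> simp only [h, h'] <;> simp

theorem label_start {i : ℕ} (hi : 1 ≤ i) : label n ξ (i, ξ i) = startRoot n ξ i := by
  unfold label startRoot leftEnd rightEnd
  rw [chainHeight_of_pos hi]
  simp

/-- The parity of the positions on the wheel belonging to a vertex. -/
theorem IsHeight.height_parity (H : IsHeight n ξ) {i : ℕ} (hi : 1 ≤ i) (hin : i ≤ n) :
    (2 : ℤ) ∣ ξ i - ((min i (n - 1) : ℕ) : ℤ) - leftEnd ξ 0 := by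
  have h4 := H.four_le
  have hl := H.leftEnd_parity (k := n - 2) le_rfl
  have hll := H.leftEnd_last
  rcases Nat.lt_or_ge (n - 2) i with h | h
  · have h1 := H.height_pred
    have h2 := H.last
    rw [Nat.min_eq_right (by omega)]
    rcases (show i = n - 1 ∨ i = n by omega) with rfl | rfl <;> omega
  · rw [Nat.min_eq_left (by omega)]
    have := H.leftEnd_parity h
    unfold leftEnd at this ⊢
    rw [chainHeight_of_pos hi] at this
    exact this

theorem isRepVertex_parity {i : ℕ} {p : ℤ} (h : IsRepVertex n ξ (i, p)) : (2 : ℤ) ∣ p - ξ i :=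
  even_iff_two_dvd.1 h.2.2

theorem IsHeight.rep_parity_of_le (H : IsHeight n ξ) {i : ℕ} {p : ℤ} (h : IsRepVertex n ξ (i, p))
    (hi : i ≤ n - 2) : (2 : ℤ) ∣ p - i - leftEnd ξ 0 := by
  have h1 : 1 ≤ i := h.1
  have := H.height_parity h1 h.2.1
  have := isRepVertex_parity h
  omega

theorem IsHeight.rep_parity_of_gt (H : IsHeight n ξ) {i : ℕ} {p : ℤ} (h : IsRepVertex n ξ (i, p))
    (hi : ¬ i ≤ n - 2) : (2 : ℤ) ∣ p - ((n : ℤ) - 1) - leftEnd ξ 0 := by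
  have h4 := H.four_le
  have h1 : i ≤ n := h.2.1
  have := H.height_parity (i := i) h.1 h1
  have := isRepVertex_parity h
  omega

theorem IsHeight.coxeter_wheel (H : IsHeight n ξ) {x : ℤ} (hx : (2 : ℤ) ∣ x - leftEnd ξ 0) :
    coxeter n ξ (wheel n ξ x) = wheel n ξ (x - 2) := by
  obtain ⟨j, a, b, k, rfl⟩ := H.exists_pos_add_mul hx
  rw [wheel_add_mul_per H.four_le, coxeter_smul, H.coxeter_wheel_pos a b,
    ← wheel_add_mul_per H.four_le]
  congr 1
  ring

theorem IsHeight.coxeter_label (H : IsHeight n ξ) {i : ℕ} {p : ℤ} (h : IsRepVertex n ξ (i, p)) :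
    coxeter n ξ (label n ξ (i, p)) = label n ξ (i, p - 2) := by
  have h4 := H.four_le
  have hp := isRepVertex_parity h
  by_cases hi : i ≤ n - 2
  · have hh := H.rep_parity_of_le h hi
    rw [label_of_le hi, label_of_le hi, coxeter_sub, H.coxeter_wheel (by omega),
      H.coxeter_wheel (by omega)]
    congr 2 <;> ring
  · have hh := H.rep_parity_of_gt h hi
    unfold label
    rw [if_neg hi, if_neg hi, coxeter_add, coxeter_smul, H.coxeter_twist, H.coxeter_wheel (by omega),
      show (ξ i - (p - 2)) / 2 = (ξ i - p) / 2 + 1 by omega, Int.negOnePow_succ,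
      show p - ((n : ℤ) - 1) - 2 = p - 2 - ((n : ℤ) - 1) by ring]
    simp

theorem IsHeight.label_add_per (H : IsHeight n ξ) {i : ℕ} {p : ℤ} (hi : i ≤ n - 2) :
    label n ξ (i, p + per n) = -label n ξ (i, p) := by
  rw [label_of_le hi, label_of_le hi,
    show p + per n - i = (p - i) + per n by ring, show p + per n + i = (p + i) + per n by ring,
    wheel_add_per H.four_le, wheel_add_per H.four_le]
  abel

theorem IsHeight.isPosRoot_label_of_le (H : IsHeight n ξ) {i : ℕ} {p : ℤ}
    (h : IsRepVertex n ξ (i, p)) (hi : i ≤ n - 2) (h1 : ξ i - per n + 2 ≤ p) (h2 : p ≤ ξ i) :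
    IsPosRoot n (label n ξ (i, p)) := by
  have h4 := H.four_le
  have hp := isRepVertex_parity h
  have hh := H.rep_parity_of_le h hi
  have e : leftEnd ξ i = ξ i - i := by unfold leftEnd; rw [chainHeight_of_pos (i := i) h.1]
  rw [label_of_le hi]
  exact H.isPosRoot_wheel (l := i) h.1 hi (by omega) (by ring) (by omega) (by omega)

/-- On the two last residues the label is positive as long as the wheel shows one of
`ε_1, …, ε_{n-2}`. -/
theorem IsHeight.isPosRoot_label_of_gt (H : IsHeight n ξ) {i : ℕ} {p : ℤ}
    (h : IsRepVertex n ξ (i, p)) (hi : ¬ i ≤ n - 2)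
    (h1 : leftEnd ξ (n - 2) - per n + 2 ≤ p - ((n : ℤ) - 1))
    (h2 : p - ((n : ℤ) - 1) ≤ leftEnd ξ (n - 2) - 2) : IsPosRoot n (label n ξ (i, p)) := by
  have h4 := H.four_le
  have hp := isRepVertex_parity h
  have hh := H.rep_parity_of_gt h hi
  have hR := H.rightEnd_last
  have hpe := per_even n
  obtain ⟨s, hs, e⟩ := label_of_gt (n := n) (ξ := ξ) (p := p) hi
  obtain ⟨j, b1, b2, b3, b4⟩ := H.wheel_of_block (m := n - 2) le_rfl
    (x := p - ((n : ℤ) - 1) + per n) (by omega) (by omega) (by omega)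
  rw [wheel_add_per h4] at b4
  rw [e, neg_injective b4]
  exact H.isPosRoot_twist b1 b2 hs

/-- On the two last residues the label is negative as long as the wheel shows one of
`-ε_1, …, -ε_{n-2}`. -/
theorem IsHeight.not_isPosRoot_label_of_gt (H : IsHeight n ξ) {i : ℕ} {p : ℤ}
    (h : IsRepVertex n ξ (i, p)) (hi : ¬ i ≤ n - 2)
    (h1 : leftEnd ξ (n - 2) + 2 ≤ p - ((n : ℤ) - 1))
    (h2 : p - ((n : ℤ) - 1) ≤ leftEnd ξ (n - 2) + per n - 2) :
    ¬ IsPosRoot n (label n ξ (i, p)) := by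
  have h4 := H.four_le
  have hp := isRepVertex_parity h
  have hh := H.rep_parity_of_gt h hi
  have hR := H.rightEnd_last
  obtain ⟨s, hs, e⟩ := label_of_gt (n := n) (ξ := ξ) (p := p) hi
  obtain ⟨j, b1, b2, b3, b4⟩ := H.wheel_of_block (m := n - 2) le_rfl
    (x := p - ((n : ℤ) - 1)) (by omega) (by omega) (by omega)
  intro hpos
  refine (H.isPosRoot_twist b1 b2 (s := -s) (by omega)).not_neg ?_
  rw [e, b4] at hpos
  convert hpos using 1
  module

theorem IsHeight.not_isPosRoot_label_bottom (H : IsHeight n ξ) {i : ℕ} {p : ℤ}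
    (h : IsRepVertex n ξ (i, p)) (hi : ¬ i ≤ n - 2)
    (h1 : p - ((n : ℤ) - 1) = leftEnd ξ (n - 2) - per n - 2) :
    ¬ IsPosRoot n (label n ξ (i, p)) := by
  have h4 := H.four_le
  have hp := isRepVertex_parity h
  have hpp := H.per_pos
  obtain ⟨s, hs, e⟩ := label_of_gt (n := n) (ξ := ξ) (p := p) hi
  intro hpos
  have hw : wheel n ξ (p - ((n : ℤ) - 1)) = wheel n ξ (rightEnd ξ (n - 2)) := by
    rw [h1, H.rightEnd_last, wheel_add_per h4,
      show leftEnd ξ (n - 2) - per n - 2 = (leftEnd ξ (n - 2) - 2) - per n by ring,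
      wheel_sub_per h4]
  obtain ⟨j, b1, b2, b3, b4⟩ := H.wheel_of_block (m := n - 2) le_rfl
    (H.rightEnd_parity le_rfl) (by have := H.rightEnd_last; omega) le_rfl
  refine (H.isPosRoot_twist b1 b2 (s := -s) (by omega)).not_neg ?_
  rw [e, hw, b4] at hpos
  convert hpos using 1
  module

theorem IsHeight.isPosRoot_start_up (H : IsHeight n ξ) {i : ℕ} (hi : i = n - 1 ∨ i = n)
    (h : ξ i = ξ (n - 2) + 1) : startRoot n ξ i = simpleRoot n i := by
  rw [H.knit_last hi, if_neg (by omega), add_zero]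

theorem isPosRoot_simpleRoot (hn : 4 ≤ n) {i : ℕ} (hi : 1 ≤ i) (hin : i ≤ n) :
    IsPosRoot n (simpleRoot n i) := by
  unfold simpleRoot
  split_ifs with h
  · exact ⟨i, i + 1, hi, by omega, by omega, Or.inl rfl⟩
  · exact ⟨n - 1, n, by omega, by omega, le_rfl, Or.inr rfl⟩

/-- Above the Auslander-Reiten quiver the labels are negative. -/
theorem IsHeight.not_isPosRoot_top (H : IsHeight n ξ) {i : ℕ} (hi : 1 ≤ i) (hin : i ≤ n) :
    ¬ IsPosRoot n (label n ξ (i, ξ i + 2)) := by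
  have h4 := H.four_le
  have hpp := H.per_pos
  have hpe := per_even n
  by_cases h : i ≤ n - 2
  · have hr : IsRepVertex n ξ (i, ξ i + 2 - per n) :=
      ⟨hi, hin, even_iff_two_dvd.2 (by show (2 : ℤ) ∣ ξ i + 2 - per n - ξ i; omega)⟩
    have := (H.isPosRoot_label_of_le hr h (by omega) (by omega)).not_neg
    rwa [← H.label_add_per h, sub_add_cancel] at this
  · have hr : IsRepVertex n ξ (i, ξ i + 2) :=
      ⟨hi, hin, even_iff_two_dvd.2 (by show (2 : ℤ) ∣ ξ i + 2 - ξ i; omega)⟩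
    have hll := H.leftEnd_last
    have hi' : i = n - 1 ∨ i = n := by omega
    have hx : ξ i = ξ (n - 2) + 1 ∨ ξ i = ξ (n - 2) - 1 := by
      rcases hi' with rfl | rfl
      · exact H.height_pred
      · exact H.last
    rcases hx with hx | hx
    · exact H.not_isPosRoot_label_of_gt hr h (by omega) (by omega)
    · -- here `i` is a sink, and the label is `-α_i`
      have e : label n ξ (i, ξ i + 2) = -simpleRoot n i := by
        have h1 := H.knit_last hi'
        rw [if_pos (by omega), H.startRoot_down hi' hx, startRoot_of_le le_rfl,
          H.wheel_leftEnd] at h1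
        have h2 : simpleRoot n i = unitVec n ξ (n - 1) + spinSign n ξ i • eps n (twist n ξ) := by
          rw [eq_comm, ← sub_eq_zero] at h1 ⊢
          rw [← neg_eq_zero, ← h1]; module
        unfold label
        rw [if_neg h, show ξ i + 2 - ((n : ℤ) - 1) = leftEnd ξ (n - 2) by omega, H.wheel_leftEnd, h2,
          show (ξ i - (ξ i + 2)) / 2 = -1 by omega]
        simp
        abel
      rw [e]
      exact (isPosRoot_simpleRoot h4 hi hin).not_neg

/-! ### The vertices of the Auslander-Reiten quiver -/

/-- The lower boundary of the Auslander-Reiten quiver in the repetition quiver. On the last two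
residues it depends on the sign of the label at the lowest position. -/
def IsLow (n : ℕ) (ξ : ℕ → ℤ) (v : ℕ × ℤ) : Prop :=
  if v.1 ≤ n - 2 then ξ v.1 - per n + 2 ≤ v.2
  else leftEnd ξ (n - 2) - per n + 2 ≤ v.2 - ((n : ℤ) - 1) ∨
    (v.2 - ((n : ℤ) - 1) = leftEnd ξ (n - 2) - per n ∧ IsPosRoot n (label n ξ v))

theorem isRepVertex_of_dvd {i : ℕ} {p q : ℤ} (h : IsRepVertex n ξ (i, p)) (hq : (2 : ℤ) ∣ q - ξ i) :
    IsRepVertex n ξ (i, q) := ⟨h.1, h.2.1, even_iff_two_dvd.2 hq⟩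

theorem IsHeight.height_last (H : IsHeight n ξ) {i : ℕ} (hi : ¬ i ≤ n - 2) (hin : i ≤ n) :
    ξ i - ((n : ℤ) - 1) = leftEnd ξ (n - 2) ∨ ξ i - ((n : ℤ) - 1) = leftEnd ξ (n - 2) - 2 := by
  have h4 := H.four_le
  have hll := H.leftEnd_last
  have h1 := H.height_pred
  have h2 := H.last
  rcases (show i = n - 1 ∨ i = n by omega) with rfl | rfl <;> omega

/-- A vertex is above the lower boundary exactly if all labels from it up to `(i, ξ_i)` are
positive. -/
theorem IsHeight.isLow_iff (H : IsHeight n ξ) {i : ℕ} {p : ℤ} (h : IsRepVertex n ξ (i, p))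
    (hpξ : p ≤ ξ i) :
    IsLow n ξ (i, p) ↔
      ∀ q, p ≤ q → q ≤ ξ i → (2 : ℤ) ∣ q - ξ i → IsPosRoot n (label n ξ (i, q)) := by
  have h4 := H.four_le
  have hp := isRepVertex_parity h
  have hpp := H.per_pos
  have hpe := per_even n
  unfold IsLow
  by_cases hi : i ≤ n - 2
  · rw [if_pos hi]
    constructor
    · intro h1 q hq1 hq2 hq3
      exact H.isPosRoot_label_of_le (isRepVertex_of_dvd h hq3) hi
        (le_trans h1 hq1) hq2
    · intro hall
      show ξ i - per n + 2 ≤ p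
      by_contra hlt
      have h1 := hall (ξ i - per n) (by omega) (by omega) (by omega)
      have h2 := hall (ξ i) hpξ le_rfl (by simp)
      have h3 := H.label_add_per (p := ξ i - per n) hi
      rw [sub_add_cancel] at h3
      rw [h3] at h2
      exact h1.not_neg h2
  · rw [if_neg hi]
    have hh := H.rep_parity_of_gt h hi
    have hl := H.leftEnd_parity (k := n - 2) le_rfl
    have hx := H.height_last hi h.2.1
    constructor
    · intro h1 q hq1 hq2 hq3
      have hqr := isRepVertex_of_dvd h hq3
      by_cases hb : p - ((n : ℤ) - 1) = leftEnd ξ (n - 2) - per n ∧ q = p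
      · rcases h1 with h1 | h1
        · have h1 : leftEnd ξ (n - 2) - per n + 2 ≤ p - ((n : ℤ) - 1) := h1
          omega
        · rw [hb.2]; exact h1.2
      have h1' : leftEnd ξ (n - 2) - per n + 2 ≤ q - ((n : ℤ) - 1) := by
        rcases h1 with h1 | h1
        · exact le_trans h1 (by show p - _ ≤ _; omega)
        · have h1 : p - ((n : ℤ) - 1) = leftEnd ξ (n - 2) - per n := h1.1
          omega
      by_cases hq : q - ((n : ℤ) - 1) ≤ leftEnd ξ (n - 2) - 2
      · exact H.isPosRoot_label_of_gt hqr hi h1' hq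
      · have hll := H.leftEnd_last
        obtain rfl : q = ξ i := by omega
        rw [label_start h.1, H.isPosRoot_start_up (i := i) (by have := h.2.1; dsimp at this; omega) (by omega)]
        exact isPosRoot_simpleRoot h4 h.1 h.2.1
    · intro hall
      by_cases hb : leftEnd ξ (n - 2) - per n + 2 ≤ p - ((n : ℤ) - 1)
      · exact Or.inl hb
      by_cases he : p - ((n : ℤ) - 1) = leftEnd ξ (n - 2) - per n
      · exact Or.inr ⟨he, hall p le_rfl hpξ hp⟩
      · exfalso
        set q := leftEnd ξ (n - 2) - per n - 2 + ((n : ℤ) - 1) with hq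
        have hqd : (2 : ℤ) ∣ q - ξ i := by omega
        exact H.not_isPosRoot_label_bottom (isRepVertex_of_dvd h hqd) hi (by omega)
          (hall q (by omega) (by omega) hqd)

theorem stepDown_iterate_le (w : List ℕ) (x : (Fin n → ℤ) × ℤ) (k : ℕ) :
    ((stepDown n w)^[k] x).2 ≤ x.2 := by
  induction k with
  | zero => simp
  | succ k ih =>
    rw [Function.iterate_succ_apply', stepDown]
    split_ifs <;> simp only <;> omega

theorem stepUp_iterate_ge (w : List ℕ) (x : (Fin n → ℤ) × ℤ) (k : ℕ) :
    x.2 ≤ ((stepUp n w)^[k] x).2 := by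
  induction k with
  | zero => simp
  | succ k ih =>
    rw [Function.iterate_succ_apply', stepUp]
    split_ifs <;> simp only <;> omega

theorem IsHeight.stepDown_iterate_eq_iff (H : IsHeight n ξ) {w : List ℕ}
    (hτ : ∀ v, wordAction n w v = coxeter n ξ v) {i : ℕ} (hi : 1 ≤ i) (hin : i ≤ n) (k : ℕ) :
    (((stepDown n w)^[k] (label n ξ (i, ξ i), 0)).2 = 0 ↔
      ∀ m : ℕ, 1 ≤ m → m ≤ k → IsPosRoot n (label n ξ (i, ξ i - 2 * m))) ∧
    (((stepDown n w)^[k] (label n ξ (i, ξ i), 0)).2 = 0 →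
      (stepDown n w)^[k] (label n ξ (i, ξ i), 0) = (label n ξ (i, ξ i - 2 * k), 0)) := by
  induction k with
  | zero => simp; intro m; omega
  | succ k ih =>
    obtain ⟨ih1, ih2⟩ := ih
    have hle := stepDown_iterate_le w (label n ξ (i, ξ i), 0) k
    rw [Function.iterate_succ_apply']
    by_cases h0 : ((stepDown n w)^[k] (label n ξ (i, ξ i), 0)).2 = 0
    · have hτk : wordAction n w (label n ξ (i, ξ i - 2 * k)) =
          label n ξ (i, ξ i - 2 * ((k + 1 : ℕ) : ℤ)) := by
        rw [hτ, H.coxeter_label ⟨hi, hin, even_iff_two_dvd.2 (by simp)⟩]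
        congr 2; push_cast; ring
      rw [ih2 h0, stepDown]
      simp only [hτk]
      split_ifs with hpos <;> rw [hτk] at hpos
      · refine ⟨⟨fun _ m h1 h2 => ?_, fun _ => rfl⟩, fun _ => rfl⟩
        rcases Nat.lt_or_ge k m with h | h
        · obtain rfl : m = k + 1 := by omega
          exact hpos
        · exact ih1.1 h0 m h1 h
      · refine ⟨⟨fun h => ?_, fun h => absurd (h (k + 1) (by omega) le_rfl) hpos⟩, fun h => ?_⟩
        · simp at h
        · simp at h
    · have hlt : ((stepDown n w)^[k] (label n ξ (i, ξ i), 0)).2 < 0 := lt_of_le_of_ne hle h0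
      have hstep : (stepDown n w ((stepDown n w)^[k] (label n ξ (i, ξ i), 0))).2 < 0 := by
        rw [stepDown]
        split_ifs <;> simp only <;> omega
      refine ⟨⟨fun h => absurd h hstep.ne, fun h => ?_⟩, fun h => absurd h hstep.ne⟩
      exact absurd (ih1.2 fun m h1 h2 => h m h1 (by omega)) h0

/-- The location of a root in the Auslander-Reiten quiver, in terms of the wheel. -/
theorem DynkinQuiver.IsHeightFunction.isLocatedAt_iff (hn : 4 ≤ n) {Q : DynkinQuiver n}
    (hξ : Q.IsHeightFunction ξ) {w : List ℕ} (hw : Q.IsCoxeterWord w) {β : PosRoot n} {v : ℕ × ℤ} :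
    IsLocatedAt Q ξ w β v ↔
      IsRepVertex n ξ v ∧ v.2 ≤ ξ v.1 ∧ IsLow n ξ v ∧ label n ξ v = β.1 := by
  have H := hξ.isHeight hn
  have hK := H.isKnitting_startRoot hξ
  have hτ : ∀ v, wordAction n w v = coxeter n ξ v := hK.wordAction_eq hn hw
  obtain ⟨i, p⟩ := v
  unfold IsLocatedAt phiHat
  refine and_congr_right fun hv => ?_
  have hi : 1 ≤ i := hv.1
  have hin : i ≤ n := hv.2.1
  have hp := isRepVertex_parity hv
  have hη : Q.eta i = label n ξ (i, ξ i) := by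
    rw [label_start hi]
    exact (hξ.isKnitting_eta hn).unique hn hK hw hi hin
  simp only [hη]
  by_cases hpξ : p ≤ ξ i
  · rw [if_pos hpξ]
    obtain ⟨h1, h2⟩ := H.stepDown_iterate_eq_iff hτ hi hin ((ξ i - p) / 2).toNat
    have e : ξ i - 2 * (((ξ i - p) / 2).toNat : ℤ) = p := by omega
    rw [e] at h2
    have hlow : ((stepDown n w)^[((ξ i - p) / 2).toNat] (label n ξ (i, ξ i), 0)).2 = 0 ↔
        IsLow n ξ (i, p) := by
      rw [h1, H.isLow_iff hv hpξ]
      constructor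
      · intro hall q hq1 hq2 hq3
        by_cases hq : q = ξ i
        · rw [hq]
          by_cases hb : i ≤ n - 2
          · exact H.isPosRoot_label_of_le ⟨hi, hin, by simp⟩ hb (by have := H.per_pos; omega) le_rfl
          · have hll := H.leftEnd_last
            have hpp := H.per_pos
            rcases H.height_last hb hin with hx | hx
            · rw [label_start hi, H.isPosRoot_start_up (by omega) (by omega)]
              exact isPosRoot_simpleRoot hn hi hin
            · exact H.isPosRoot_label_of_gt ⟨hi, hin, by simp⟩ hb (by omega) (by omega)
        · have := hall ((ξ i - q) / 2).toNat (by omega) (by omega)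
          rwa [show ξ i - 2 * (((ξ i - q) / 2).toNat : ℤ) = q by omega] at this
      · intro hall m hm1 hm2
        exact hall _ (by omega) (by omega) (by omega)
    constructor
    · intro h
      have h0 : ((stepDown n w)^[((ξ i - p) / 2).toNat] (label n ξ (i, ξ i), 0)).2 = 0 := by
        rw [h]
      rw [h2 h0] at h
      exact ⟨hpξ, hlow.1 h0, congrArg Prod.fst h⟩
    · rintro ⟨_, hl, he⟩
      rw [h2 (hlow.2 hl), he]
  · rw [if_neg hpξ]
    refine ⟨fun h => ?_, fun h => absurd h.1 hpξ⟩
    exfalso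
    obtain ⟨k, hk⟩ : ∃ k, ((p - ξ i) / 2).toNat = k + 1 :=
      ⟨((p - ξ i) / 2).toNat - 1, by omega⟩
    rw [hk, Function.iterate_succ_apply] at h
    have hτ' : wordAction n w.reverse (label n ξ (i, ξ i)) = label n ξ (i, ξ i + 2) := by
      have hr : IsRepVertex n ξ (i, ξ i + 2) := isRepVertex_of_dvd hv (by omega)
      have := H.coxeter_label hr
      rw [add_sub_cancel_right] at this
      rw [← this, ← hτ]
      exact wordAction_reverse (by omega) w (fun i hi => (hw.2.1 i).1 hi) _
    have hs : stepUp n w (label n ξ (i, ξ i), 0) = (-label n ξ (i, ξ i + 2), 0 + 1) := by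
      rw [stepUp]
      simp only [hτ']
      rw [if_neg (by rw [hτ']; exact H.not_isPosRoot_top hi hin)]
    have := stepUp_iterate_ge w (stepUp n w (label n ξ (i, ξ i), 0)) k
    rw [h, hs] at this
    simp at this

end

section
variable {n : ℕ} {ξ : ℕ → ℤ}

/-! ### Signed unit vectors -/

/-- The vectors `±ε_c`. -/
def IsUnitVec (n : ℕ) (u : Fin n → ℤ) : Prop :=
  ∃ c, 1 ≤ c ∧ c ≤ n ∧ (u = eps n c ∨ u = -eps n c)

theorem IsUnitVec.neg {u : Fin n → ℤ} (h : IsUnitVec n u) : IsUnitVec n (-u) := by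
  obtain ⟨c, h1, h2, h3⟩ := h
  refine ⟨c, h1, h2, ?_⟩
  rcases h3 with rfl | rfl <;> simp

theorem IsUnitVec.smul {u : Fin n → ℤ} (h : IsUnitVec n u) {s : ℤ} (hs : s = 1 ∨ s = -1) :
    IsUnitVec n (s • u) := by
  rcases hs with rfl | rfl
  · simpa using h
  · simpa using h.neg

theorem isUnitVec_eps {c : ℕ} (h1 : 1 ≤ c) (h2 : c ≤ n) : IsUnitVec n (eps n c) :=
  ⟨c, h1, h2, Or.inl rfl⟩

theorem IsUnitVec.dot_self {u : Fin n → ℤ} (h : IsUnitVec n u) : u ⬝ᵥ u = 1 := by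
  obtain ⟨c, h1, h2, h3⟩ := h
  rcases h3 with rfl | rfl <;> simp [eps_dot_eps h1 h2]

theorem IsUnitVec.dot_cases {u v : Fin n → ℤ} (hu : IsUnitVec n u) (hv : IsUnitVec n v) :
    u ⬝ᵥ v = 0 ∨ (u ⬝ᵥ v = 1 ∧ u = v) ∨ (u ⬝ᵥ v = -1 ∧ u = -v) := by
  obtain ⟨c, h1, h2, h3⟩ := hu
  obtain ⟨d, k1, k2, k3⟩ := hv
  have e := eps_dot_eps (j := d) h1 h2
  by_cases hcd : c = d
  · subst hcd
    rw [if_pos rfl] at e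
    rcases h3 with rfl | rfl <;> rcases k3 with rfl | rfl <;> simp [e]
  · rw [if_neg hcd] at e
    left
    rcases h3 with rfl | rfl <;> rcases k3 with rfl | rfl <;> simp [e]

/-- A sum of two orthogonal signed unit vectors determines its summands. -/
theorem IsUnitVec.add_eq_add {a b u v : Fin n → ℤ} (ha : IsUnitVec n a)
    (hu : IsUnitVec n u) (hv : IsUnitVec n v) (hab : a ⬝ᵥ b = 0)
    (h : a + b = u + v) : (a = u ∧ b = v) ∨ (a = v ∧ b = u) := by
  have e : a ⬝ᵥ u + a ⬝ᵥ v = 1 := by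
    rw [← dotProduct_add, ← h, dotProduct_add, hab, ha.dot_self, add_zero]
  rcases ha.dot_cases hu with h1 | ⟨h1, rfl⟩ | ⟨h1, _⟩
  · rcases ha.dot_cases hv with h2 | ⟨h2, rfl⟩ | ⟨h2, _⟩
    · omega
    · right; exact ⟨rfl, by rw [add_comm u] at h; exact add_left_cancel h⟩
    · omega
  · left; exact ⟨rfl, add_left_cancel h⟩
  · rcases ha.dot_cases hv with h2 | ⟨h2, _⟩ | ⟨h2, _⟩ <;> omega

theorem IsPosRoot.exists_unit {β : Fin n → ℤ} (h : IsPosRoot n β) :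
    ∃ u v, IsUnitVec n u ∧ IsUnitVec n v ∧ u ⬝ᵥ v = 0 ∧ β = u + v := by
  obtain ⟨i, j, hi, hij, hj, h⟩ := h
  have e := eps_dot_eps (j := j) hi (show i ≤ n by omega)
  rw [if_neg (by omega)] at e
  rcases h with rfl | rfl
  · exact ⟨_, _, isUnitVec_eps hi (by omega), (isUnitVec_eps (by omega) hj).neg, by simp [e],
      sub_eq_add_neg _ _⟩
  · exact ⟨_, _, isUnitVec_eps hi (by omega), isUnitVec_eps (by omega) hj, e, rfl⟩

theorem IsPosRoot.dot_self {β : Fin n → ℤ} (h : IsPosRoot n β) : β ⬝ᵥ β = 2 := by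
  obtain ⟨u, v, hu, hv, huv, rfl⟩ := h.exists_unit
  rw [add_dotProduct, dotProduct_add, dotProduct_add, dotProduct_comm v u, huv, hu.dot_self,
    hv.dot_self]
  norm_num

/-- If `u + v` is the sum of two positive roots, then these are `u + ζ` and `v - ζ` for a signed
unit vector `ζ`. -/
theorem exists_unit_of_pair {α β u v : Fin n → ℤ} (hα : IsPosRoot n α) (hβ : IsPosRoot n β)
    (hu : IsUnitVec n u) (hv : IsUnitVec n v) (huv : u ⬝ᵥ v = 0) (h : u + v = α + β) :
    ∃ ζ, IsUnitVec n ζ ∧ u ⬝ᵥ ζ = 0 ∧ v ⬝ᵥ ζ = 0 ∧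
      ((α = u + ζ ∧ β = v - ζ) ∨ (β = u + ζ ∧ α = v - ζ)) := by
  obtain ⟨a, b, ha, hb, hab, e⟩ := hα.exists_unit
  have hγ : (u + v) ⬝ᵥ (u + v) = 2 := by
    rw [add_dotProduct, dotProduct_add, dotProduct_add, dotProduct_comm v u, huv, hu.dot_self,
      hv.dot_self]
    norm_num
  have hβ' : β = (u + v) - α := by rw [h]; abel
  have h1 : α ⬝ᵥ (u + v) = 1 := by
    have := hβ.dot_self
    rw [hβ', sub_dotProduct, dotProduct_sub, dotProduct_sub, hγ, hα.dot_self,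
      dotProduct_comm (u + v) α] at this
    omega
  -- one of the two summands of `α` occurs in `u + v`
  have key : ∀ x y, IsUnitVec n x → IsUnitVec n y → x ⬝ᵥ y = 0 → α = x + y → x = u ∨ x = v →
      ∃ ζ, IsUnitVec n ζ ∧ u ⬝ᵥ ζ = 0 ∧ v ⬝ᵥ ζ = 0 ∧
      ((α = u + ζ ∧ β = v - ζ) ∨ (β = u + ζ ∧ α = v - ζ)) := by
    rintro x y hx hy hxy e' (rfl | rfl)
    · refine ⟨y, hy, hxy, ?_, Or.inl ⟨e', by rw [hβ', e']; abel⟩⟩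
      rw [e', add_dotProduct, dotProduct_add, dotProduct_add, hx.dot_self, huv,
        dotProduct_comm y, hxy, dotProduct_comm y] at h1
      omega
    · refine ⟨-y, hy.neg, ?_, by rw [dotProduct_neg, hxy, neg_zero],
        Or.inr ⟨by rw [hβ', e']; abel, by rw [e']; abel⟩⟩
      rw [e', add_dotProduct, dotProduct_add, dotProduct_add, hx.dot_self, dotProduct_comm x u, huv,
        dotProduct_comm y x, hxy, dotProduct_comm y] at h1
      rw [dotProduct_neg]
      omega
  by_cases c1 : a = u ∨ a = v
  · exact key a b ha hb hab e c1
  by_cases c2 : b = u ∨ b = v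
  · exact key b a hb ha (by rw [dotProduct_comm]; exact hab) (by rw [e, add_comm]) c2
  exfalso
  rw [e, add_dotProduct, dotProduct_add, dotProduct_add] at h1
  have d1 := ha.dot_cases hu
  have d2 := ha.dot_cases hv
  have d3 := hb.dot_cases hu
  have d4 := hb.dot_cases hv
  rw [not_or] at c1 c2
  simp only [c1, c2, and_false, false_or] at d1 d2 d3 d4
  omega

theorem IsHeight.isUnitVec_wheel (H : IsHeight n ξ) {x : ℤ} (hx : (2 : ℤ) ∣ x - leftEnd ξ 0) :
    IsUnitVec n (wheel n ξ x) := by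
  obtain ⟨j, a, b, k, rfl⟩ := H.exists_pos_add_mul hx
  rw [H.wheel_pos_add_mul a b]
  obtain ⟨c, c1, c2, _, _, c3⟩ := H.unitVec_eq a b
  refine IsUnitVec.smul (IsUnitVec.neg ⟨c, by omega, c2, c3⟩) (negOnePow_cases k)

theorem IsHeight.isUnitVec_twist (H : IsHeight n ξ) : IsUnitVec n (eps n (twist n ξ)) := by
  have := H.four_le
  have := twist_mem (n := n) (ξ := ξ)
  exact isUnitVec_eps (by omega) (by omega)

theorem IsHeight.wheel_dot_twist (H : IsHeight n ξ) {x : ℤ} (hx : (2 : ℤ) ∣ x - leftEnd ξ 0) :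
    wheel n ξ x ⬝ᵥ eps n (twist n ξ) = 0 := by
  obtain ⟨j, a, b, k, rfl⟩ := H.exists_pos_add_mul hx
  rw [H.wheel_pos_add_mul a b]
  obtain ⟨c, c1, c2, c4, _, c3⟩ := H.unitVec_eq a b
  have := eps_dot_eps (j := twist n ξ) (show 1 ≤ c by omega) c2
  rw [if_neg c4] at this
  rw [smul_dotProduct, neg_dotProduct]
  rcases c3 with c3 | c3 <;> simp [c3, this, -Int.coe_negOnePow]

/-- At positions which are incongruent modulo the period, the wheel takes orthogonal values. -/
theorem IsHeight.wheel_dot_wheel (H : IsHeight n ξ) {x y : ℤ} (hx : (2 : ℤ) ∣ x - leftEnd ξ 0)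
    (hy : (2 : ℤ) ∣ y - leftEnd ξ 0) (hxy : ¬ per n ∣ x - y) :
    wheel n ξ x ⬝ᵥ wheel n ξ y = 0 := by
  have h4 := H.four_le
  obtain ⟨j, a, b, k, rfl⟩ := H.exists_pos_add_mul hx
  obtain ⟨i, a', b', k', rfl⟩ := H.exists_pos_add_mul hy
  have hij : j ≠ i := by
    rintro rfl
    exact hxy ⟨k - k', by ring⟩
  rw [H.wheel_pos_add_mul a b, H.wheel_pos_add_mul a' b']
  have key : unitVec n ξ j ⬝ᵥ unitVec n ξ i = 0 := by
    obtain ⟨c, c1, c2, c4, c5, c3⟩ := H.unitVec_eq a b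
    obtain ⟨d, d1, d2, d4, d5, d3⟩ := H.unitVec_eq a' b'
    have := eps_dot_eps (j := d) (show 1 ≤ c by omega) c2
    rw [if_neg (by omega)] at this
    rcases c3 with c3 | c3 <;> rcases d3 with d3 | d3 <;> simp [c3, d3, this]
  rw [smul_dotProduct, dotProduct_smul, neg_dotProduct, dotProduct_neg, key]
  simp

theorem IsHeight.two_per_dvd_of_wheel_eq (H : IsHeight n ξ) {x y : ℤ}
    (hx : (2 : ℤ) ∣ x - leftEnd ξ 0) (hy : (2 : ℤ) ∣ y - leftEnd ξ 0)
    (h : wheel n ξ x = wheel n ξ y) : 2 * per n ∣ x - y := by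
  have hd : per n ∣ x - y := by
    by_contra hn
    have h1 := H.wheel_dot_wheel hx hy hn
    rw [h, (H.isUnitVec_wheel hy).dot_self] at h1
    omega
  obtain ⟨k, hk⟩ := hd
  have e : x = y + k * per n := by rw [mul_comm]; omega
  rw [e, wheel_add_mul_per H.four_le] at h
  rcases Int.even_or_odd' k with ⟨m, rfl | rfl⟩
  · exact ⟨m, by rw [hk]; ring⟩
  · rw [Int.negOnePow_odd _ (by simp)] at h
    have h1 := (H.isUnitVec_wheel hy).dot_self
    have h2 := congrArg (fun v => v ⬝ᵥ wheel n ξ y) h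
    simp [h1] at h2

theorem IsHeight.wheel_of_two_per_dvd (H : IsHeight n ξ) {x y : ℤ} (h : 2 * per n ∣ x - y) :
    wheel n ξ x = wheel n ξ y := by
  obtain ⟨k, hk⟩ := h
  rw [show x = y + (2 * k) * per n by linarith, wheel_add_mul_per H.four_le,
    Int.negOnePow_even _ (by simp)]
  simp

/-- Every value of the wheel is taken in each window of two periods. -/
theorem IsHeight.exists_window (H : IsHeight n ξ) {z : ℤ} (hz : (2 : ℤ) ∣ z - leftEnd ξ 0) (x : ℤ) :
    ∃ z', x ≤ z' ∧ z' < x + 2 * per n ∧ (2 : ℤ) ∣ z' - leftEnd ξ 0 ∧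
      wheel n ξ z' = wheel n ξ z := by
  have hp := H.per_pos
  have e1 := Int.emod_add_mul_ediv (z - x) (2 * per n)
  have e2 := Int.emod_nonneg (z - x) (show 2 * per n ≠ 0 by omega)
  have e3 := Int.emod_lt_of_pos (z - x) (show 0 < 2 * per n by omega)
  have e4 : (2 : ℤ) ∣ 2 * per n * ((z - x) / (2 * per n)) := ⟨per n * ((z - x) / (2 * per n)), by ring⟩
  refine ⟨x + (z - x) % (2 * per n), by omega, by omega, by omega,
    H.wheel_of_two_per_dvd ⟨-((z - x) / (2 * per n)), ?_⟩⟩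
  rw [mul_neg]; omega

/-- A signed unit vector is either on the wheel or `±ε_t`. -/
theorem IsHeight.unit_cases (H : IsHeight n ξ) {u : Fin n → ℤ} (hu : IsUnitVec n u) :
    (∃ z, (2 : ℤ) ∣ z - leftEnd ξ 0 ∧ u = wheel n ξ z) ∨
      ∃ s : ℤ, (s = 1 ∨ s = -1) ∧ u = s • eps n (twist n ξ) := by
  have h4 := H.four_le
  have hpe := per_even n
  obtain ⟨c, h1, h2, h3⟩ := hu
  by_cases ht : c = twist n ξ
  · right
    rcases h3 with rfl | rfl
    · exact ⟨1, Or.inl rfl, by rw [ht, one_smul]⟩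
    · exact ⟨-1, Or.inr rfl, by rw [ht, neg_smul, one_smul]⟩
  left
  have key : ∃ z, (2 : ℤ) ∣ z - leftEnd ξ 0 ∧ (u = wheel n ξ z ∨ u = -wheel n ξ z) := by
    by_cases hc : c ≤ n - 2
    · refine ⟨pos n ξ c, ?_, ?_⟩
      · obtain ⟨k, rfl⟩ : ∃ k, c = k + 1 := ⟨c - 1, by omega⟩
        have e1 := H.leftEnd_parity (k := k) (by omega)
        have e2 := H.rightEnd_parity hc
        rcases H.ends_step hc with h | h <;> omega
      · rw [H.wheel_pos_of_le h1 hc, neg_neg]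
        exact h3.symm
    · obtain ⟨d, d1, d2, d3⟩ := H.unitVec_last
      have := twist_mem (n := n) (ξ := ξ)
      obtain rfl : c = d := by omega
      refine ⟨leftEnd ξ (n - 2), H.leftEnd_parity le_rfl, ?_⟩
      rw [H.wheel_leftEnd, neg_neg]
      rcases h3 with rfl | rfl <;> rcases d3 with d3 | d3 <;> simp [d3]
  obtain ⟨z, hz, h | h⟩ := key
  · exact ⟨z, hz, h⟩
  · exact ⟨z + per n, by omega, by rw [wheel_add_per h4, h]⟩

/-! ### Coordinates of the vertices -/

/-- The left coordinate of a vertex; the last two residues are both treated as `n - 1`. -/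
def cx (n : ℕ) (v : ℕ × ℤ) : ℤ := v.2 - (min v.1 (n - 1) : ℕ)

/-- The right coordinate of a vertex. -/
def cy (n : ℕ) (v : ℕ × ℤ) : ℤ := v.2 + (min v.1 (n - 1) : ℕ)

/-- The vertices of the Auslander-Reiten quiver, as a region of the repetition quiver. -/
def InAR (n : ℕ) (ξ : ℕ → ℤ) (v : ℕ × ℤ) : Prop :=
  IsRepVertex n ξ v ∧ v.2 ≤ ξ v.1 ∧ IsLow n ξ v

theorem IsHeight.cx_parity (H : IsHeight n ξ) {v : ℕ × ℤ} (h : IsRepVertex n ξ v) :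
    (2 : ℤ) ∣ cx n v - leftEnd ξ 0 := by
  have := H.height_parity h.1 h.2.1
  have := even_iff_two_dvd.1 h.2.2
  unfold cx
  omega

theorem IsHeight.cy_parity (H : IsHeight n ξ) {v : ℕ × ℤ} (h : IsRepVertex n ξ v) :
    (2 : ℤ) ∣ cy n v - leftEnd ξ 0 := by
  have := H.cx_parity h
  unfold cy cx at *
  omega

theorem IsHeight.isRepVertex_of_parity (H : IsHeight n ξ) {v : ℕ × ℤ} (h1 : 1 ≤ v.1) (h2 : v.1 ≤ n)
    (h : (2 : ℤ) ∣ cx n v - leftEnd ξ 0) : IsRepVertex n ξ v := by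
  have := H.height_parity h1 h2
  refine ⟨h1, h2, even_iff_two_dvd.2 ?_⟩
  unfold cx at h
  omega

theorem label_of_le' {v : ℕ × ℤ} (hv : v.1 ≤ n - 2) :
    label n ξ v = wheel n ξ (cx n v) - wheel n ξ (cy n v) := by
  unfold label cx cy
  rw [if_pos hv, Nat.min_eq_left (by omega)]

theorem label_of_gt' (hn : 4 ≤ n) {v : ℕ × ℤ} (hv : ¬ v.1 ≤ n - 2) : ∃ s : ℤ, (s = 1 ∨ s = -1) ∧
    label n ξ v = wheel n ξ (cx n v) + s • eps n (twist n ξ) := by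
  obtain ⟨s, hs, e⟩ := label_of_gt (n := n) (ξ := ξ) (i := v.1) (p := v.2) hv
  refine ⟨s, hs, ?_⟩
  rw [show v = (v.1, v.2) from rfl, e]
  unfold cx
  congr 2
  dsimp only
  omega

/-- The Auslander-Reiten quiver is a narrow strip: it cannot contain two vertices which differ by
more than a period in both coordinates. -/
theorem IsHeight.strip (H : IsHeight n ξ) {u v : ℕ × ℤ} (hu : InAR n ξ u) (hv : InAR n ξ v) :
    cx n v - cx n u ≤ per n ∨ cy n v - cy n u ≤ per n := by
  have h4 := H.four_le
  have hpp := H.per_pos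
  have hR := H.rightEnd_last
  -- bounds on the coordinates in terms of the ends of the upper boundary
  have key : ∀ v, InAR n ξ v →
      (v.1 ≤ n - 2 ∧ leftEnd ξ v.1 - per n + 2 ≤ cx n v ∧ cx n v ≤ leftEnd ξ v.1 ∧
        cy n v ≤ rightEnd ξ v.1 ∧ rightEnd ξ v.1 - per n + 2 ≤ cy n v) ∨
      (¬ v.1 ≤ n - 2 ∧ leftEnd ξ (n - 2) - per n ≤ cx n v ∧ cx n v ≤ leftEnd ξ (n - 2) ∧
        cy n v = cx n v + per n) := by
    rintro ⟨i, p⟩ ⟨h1, h2, h3⟩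
    have hi : 1 ≤ i := h1.1
    have hin : i ≤ n := h1.2.1
    have h2 : p ≤ ξ i := h2
    unfold IsLow at h3
    by_cases h : i ≤ n - 2
    · left
      rw [if_pos h] at h3
      have h3 : ξ i - per n + 2 ≤ p := h3
      unfold leftEnd rightEnd cx cy
      rw [chainHeight_of_pos hi]
      dsimp only
      omega
    · right
      rw [if_neg h] at h3
      dsimp only at h3
      have hx := H.height_last h hin
      unfold cx cy per at *
      dsimp only
      omega
  rcases key u hu with ⟨a0, a1, a2, a3, a4⟩ | ⟨a0, a1, a2, a3⟩ <;>
    rcases key v hv with ⟨b0, b1, b2, b3, b4⟩ | ⟨b0, b1, b2, b3⟩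
  · rcases Nat.le_total u.1 v.1 with h | h
    · have := H.ends_mono h b0; omega
    · have := H.ends_mono h a0; omega
  · have := H.ends_mono a0 le_rfl; omega
  · have := H.ends_mono b0 le_rfl; omega
  · omega

theorem IsHeight.label_isPosRoot (H : IsHeight n ξ) {v : ℕ × ℤ} (hv : InAR n ξ v) :
    IsPosRoot n (label n ξ v) :=
  (H.isLow_iff hv.1 hv.2.1).1 hv.2.2 v.2 le_rfl hv.2.1 (even_iff_two_dvd.1 hv.1.2.2)

/-- A point within `N - 2` of `(x, y)` in both coordinates cannot be moved by a nonzero multiple of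
`(2N, 2N)` to a point which stays within `N` of `(x, y)` in the sense of `IsHeight.strip`. -/
theorem eq_zero_of_strip {a b c d k N : ℤ} (hN : 0 < N) (h1 : a - b = 2 * N * k)
    (h2 : c - d = 2 * N * k) {x y : ℤ} (hx : b - x ≤ N - 2) (hx' : x - b ≤ N - 2)
    (hy : d - y ≤ N - 2) (hy' : y - d ≤ N - 2) (h : a - x ≤ N ∨ c - y ≤ N)
    (h' : x - a ≤ N ∨ y - c ≤ N) : k = 0 := by
  by_contra hk
  rcases lt_or_gt_of_ne hk with h0 | h0
  · have : 2 * N * k ≤ 2 * N * (-1) := mul_le_mul_of_nonneg_left (by omega) (by omega)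
    omega
  · have : 2 * N * 1 ≤ 2 * N * k := mul_le_mul_of_nonneg_left (by omega) (by omega)
    omega

theorem IsHeight.wheel_dot_of_lt (H : IsHeight n ξ) {x y : ℤ} (hx : (2 : ℤ) ∣ x - leftEnd ξ 0)
    (hy : (2 : ℤ) ∣ y - leftEnd ξ 0) (hxy : x < y) (hy' : y < x + per n) :
    wheel n ξ x ⬝ᵥ wheel n ξ y = 0 := by
  refine H.wheel_dot_wheel hx hy fun h => ?_
  have := Int.eq_zero_of_abs_lt_dvd h (by rw [abs_lt]; omega)
  omega

theorem cy_sub_cx_of_le (hn : 4 ≤ n) {v : ℕ × ℤ} (h1 : 1 ≤ v.1) (h : v.1 ≤ n - 2) :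
    cx n v < cy n v ∧ cy n v < cx n v + per n := by
  unfold cx cy per; omega

theorem cy_of_gt (hn : 4 ≤ n) {v : ℕ × ℤ} (h : ¬ v.1 ≤ n - 2) : cy n v = cx n v + per n := by
  unfold cx cy per; omega

/-- The location of a root without `ε_t`: it can be read off from any expression on the wheel whose
positions are not too far from some vertex of the Auslander-Reiten quiver. -/
theorem IsHeight.coords_of_wheel (H : IsHeight n ξ) {u v : ℕ × ℤ} (hu : InAR n ξ u)
    (hv : InAR n ξ v) {x y : ℤ} (hx : (2 : ℤ) ∣ x - leftEnd ξ 0) (hy : (2 : ℤ) ∣ y - leftEnd ξ 0)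
    (hxy : x < y) (hyx : y < x + per n) (h : label n ξ v = wheel n ξ x - wheel n ξ y)
    (h1 : x - cx n u ≤ per n - 2) (h2 : cx n u - x ≤ per n - 2) (h3 : y - cy n u ≤ per n - 2)
    (h4 : cy n u - y ≤ per n - 2) : v.1 ≤ n - 2 ∧ cx n v = x ∧ cy n v = y := by
  have hn := H.four_le
  have hpp := H.per_pos
  have hs1 := H.strip hu hv
  have hs2 := H.strip hv hu
  have hcx := H.cx_parity hv.1
  have hcy := H.cy_parity hv.1
  have hux := H.isUnitVec_wheel hx
  have huy := H.isUnitVec_wheel hy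
  have hvi : 1 ≤ v.1 := hv.1.1
  have hpe := per_even n
  by_cases hvl : v.1 ≤ n - 2
  · refine ⟨hvl, ?_⟩
    have hlt := cy_sub_cx_of_le hn hvi hvl
    have hdot := H.wheel_dot_of_lt hcx hcy hlt.1 hlt.2
    rw [label_of_le' hvl, sub_eq_add_neg, sub_eq_add_neg] at h
    rcases (H.isUnitVec_wheel hcx).add_eq_add hux huy.neg (by rw [dotProduct_neg, hdot, neg_zero]) h
      with ⟨e1, e2⟩ | ⟨e1, e2⟩
    · obtain ⟨k, hk⟩ := H.two_per_dvd_of_wheel_eq hcx hx e1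
      obtain ⟨m, hm⟩ := H.two_per_dvd_of_wheel_eq hcy hy (neg_injective e2)
      have hkm : k - m = 0 := by
        have hd : (2 * per n) ∣ (cx n v - x) - (cy n v - y) := ⟨k - m, by rw [hk, hm]; ring⟩
        have h0 := Int.eq_zero_of_abs_lt_dvd hd (by rw [abs_lt]; omega)
        have : 2 * per n * (k - m) = 0 := by linarith
        rcases mul_eq_zero.1 this with h | h <;> omega
      obtain rfl : k = m := by omega
      have := eq_zero_of_strip (by omega) hk hm (by omega) (by omega) (by omega) (by omega) hs1 hs2
      subst this
      omega
    · -- the positions would be exchanged, which contradicts the order of the coordinates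
      exfalso
      rw [← wheel_add_per hn] at e1
      rw [neg_eq_iff_eq_neg, ← wheel_add_per hn] at e2
      obtain ⟨k, hk⟩ := H.two_per_dvd_of_wheel_eq hcx (by omega) e1
      obtain ⟨m, hm⟩ := H.two_per_dvd_of_wheel_eq hcy (by omega) e2
      have hd : (2 * per n) ∣ (cy n v - cx n v) + (y - x) := ⟨m - k, by
        rw [mul_sub, ← hk, ← hm]; ring⟩
      have h0 := Int.le_of_dvd (by omega) hd
      omega
  · exfalso
    obtain ⟨s, hs, e⟩ := label_of_gt' (ξ := ξ) hn hvl
    have h5 := congrArg (fun a => a ⬝ᵥ eps n (twist n ξ)) (e.symm.trans h)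
    simp only [add_dotProduct, sub_dotProduct, smul_dotProduct, H.wheel_dot_twist hcx,
      H.wheel_dot_twist hx, H.wheel_dot_twist hy, H.isUnitVec_twist.dot_self, smul_eq_mul] at h5
    omega

/-- The location of a root involving `ε_t`. -/
theorem IsHeight.coords_of_twist (H : IsHeight n ξ) {u v : ℕ × ℤ} (hu : InAR n ξ u)
    (hv : InAR n ξ v) {x s : ℤ} (hx : (2 : ℤ) ∣ x - leftEnd ξ 0) (hs : s = 1 ∨ s = -1)
    (h : label n ξ v = wheel n ξ x + s • eps n (twist n ξ))
    (h1 : x - cx n u ≤ per n - 2) (h2 : cx n u - x ≤ per n - 2) (h3 : x - cy n u ≤ -2)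
    (h4 : cy n u - x ≤ 2 * per n - 2) : ¬ v.1 ≤ n - 2 ∧ cx n v = x ∧ cy n v = x + per n := by
  have hn := H.four_le
  have hpp := H.per_pos
  have hs1 := H.strip hu hv
  have hs2 := H.strip hv hu
  have hcx := H.cx_parity hv.1
  have hcy := H.cy_parity hv.1
  by_cases hvl : v.1 ≤ n - 2
  · exfalso
    rw [label_of_le' hvl] at h
    have h5 := congrArg (fun a => a ⬝ᵥ eps n (twist n ξ)) h
    simp only [add_dotProduct, sub_dotProduct, smul_dotProduct, H.wheel_dot_twist hcx,
      H.wheel_dot_twist hx, H.wheel_dot_twist hcy, H.isUnitVec_twist.dot_self, smul_eq_mul] at h5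
    omega
  · refine ⟨hvl, ?_⟩
    obtain ⟨s', hs', e⟩ := label_of_gt' (ξ := ξ) hn hvl
    rw [e] at h
    have hy := cy_of_gt hn hvl
    have ht := H.isUnitVec_twist
    rcases (H.isUnitVec_wheel hcx).add_eq_add (H.isUnitVec_wheel hx) (ht.smul hs)
      (by rw [dotProduct_smul, H.wheel_dot_twist hcx, smul_zero]) h with ⟨e1, _⟩ | ⟨e1, _⟩
    · obtain ⟨k, hk⟩ := H.two_per_dvd_of_wheel_eq hcx hx e1
      have hk' : cy n v - (x + per n) = 2 * per n * k := by omega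
      have := eq_zero_of_strip (by omega) hk hk' (by omega) (by omega) (by omega) (by omega) hs1 hs2
      subst this
      omega
    · exfalso
      have h5 := H.wheel_dot_twist hcx
      rw [e1, smul_dotProduct, ht.dot_self, smul_eq_mul] at h5
      omega

/-! ### Existence and uniqueness of locations -/

/-- The two last residues carry opposite signs of `ε_t`. -/
theorem IsHeight.spin_opposite (H : IsHeight n ξ) {p : ℤ} (h : (2 : ℤ) ∣ p - ξ n) :
    spinSign n ξ (n - 1) * (((ξ (n - 1) - p) / 2).negOnePow : ℤ) =
      -(spinSign n ξ n * (((ξ n - p) / 2).negOnePow : ℤ)) := by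
  rcases H.last_cases with h' | h' | h' | h' <;> obtain ⟨h1, h2, _, _, h6, h7⟩ := h'
  · rw [h6, h7, show ξ (n - 1) = ξ n by omega]; ring
  · rw [h6, h7, show ξ (n - 1) = ξ n by omega]; ring
  · rw [h6, h7, show (ξ (n - 1) - p) / 2 = (ξ n - p) / 2 + 1 by omega, Int.negOnePow_succ]; simp
  · rw [h6, h7, show (ξ n - p) / 2 = (ξ (n - 1) - p) / 2 + 1 by omega, Int.negOnePow_succ]; simp

theorem IsHeight.label_spin (H : IsHeight n ξ) {p : ℤ} (h : (2 : ℤ) ∣ p - ξ n) :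
    ∃ s : ℤ, (s = 1 ∨ s = -1) ∧
      label n ξ (n, p) = wheel n ξ (p - ((n : ℤ) - 1)) + s • eps n (twist n ξ) ∧
      label n ξ (n - 1, p) = wheel n ξ (p - ((n : ℤ) - 1)) + (-s) • eps n (twist n ξ) := by
  have h4 := H.four_le
  have hs := H.spin_opposite h
  refine ⟨spinSign n ξ n * (((ξ n - p) / 2).negOnePow : ℤ), ?_, ?_, ?_⟩
  · rcases spinSign_cases (n := n) (ξ := ξ) n with h | h <;>
      rcases negOnePow_cases ((ξ n - p) / 2) with h' | h' <;> simp only [h, h'] <;> simp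
  · unfold label; rw [if_neg (by omega)]
  · unfold label; rw [if_neg (by omega)]; dsimp only; rw [hs]

/-- Both vectors `wheel x ± ε_t` are labels at the last two residues. -/
theorem IsHeight.exists_spin (H : IsHeight n ξ) {x s : ℤ} (hx : (2 : ℤ) ∣ x - leftEnd ξ 0)
    (hs : s = 1 ∨ s = -1) : ∃ i, (i = n - 1 ∨ i = n) ∧ IsRepVertex n ξ (i, x + ((n : ℤ) - 1)) ∧
      label n ξ (i, x + ((n : ℤ) - 1)) = wheel n ξ x + s • eps n (twist n ξ) := by
  have h4 := H.four_le
  have hr : ∀ i, i = n - 1 ∨ i = n → IsRepVertex n ξ (i, x + ((n : ℤ) - 1)) := by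
    intro i hi
    refine H.isRepVertex_of_parity (by dsimp only; omega) (by dsimp only; omega) ?_
    unfold cx
    dsimp only
    omega
  obtain ⟨s', hs', e1, e2⟩ := H.label_spin (isRepVertex_parity (hr n (Or.inr rfl)))
  rw [add_sub_cancel_right] at e1 e2
  by_cases h : s = s'
  · exact ⟨n, Or.inr rfl, hr _ (Or.inr rfl), by rw [h, e1]⟩
  · exact ⟨n - 1, Or.inl rfl, hr _ (Or.inl rfl), by rw [show s = -s' by omega, e2]⟩

theorem IsHeight.label_injective (H : IsHeight n ξ) {u v : ℕ × ℤ} (hu : InAR n ξ u)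
    (hv : InAR n ξ v) (h : label n ξ u = label n ξ v) : u = v := by
  have h4 := H.four_le
  have hpp := H.per_pos
  have hcx := H.cx_parity hu.1
  have hcy := H.cy_parity hu.1
  obtain ⟨i, p⟩ := u
  obtain ⟨j, q⟩ := v
  have hi1 : 1 ≤ i := hu.1.1
  have hin : i ≤ n := hu.1.2.1
  have hj1 : 1 ≤ j := hv.1.1
  have hjn : j ≤ n := hv.1.2.1
  by_cases hi : i ≤ n - 2
  · have hlt := cy_sub_cx_of_le h4 (v := (i, p)) hi1 hi
    obtain ⟨a1, a2, a3⟩ := H.coords_of_wheel hu hv hcx hcy hlt.1 hlt.2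
      (by rw [← h, label_of_le' (v := (i, p)) hi]) (by omega) (by omega) (by omega) (by omega)
    have a1 : j ≤ n - 2 := a1
    have a2 : q - (min j (n - 1) : ℕ) = p - (min i (n - 1) : ℕ) := a2
    have a3 : q + (min j (n - 1) : ℕ) = p + (min i (n - 1) : ℕ) := a3
    rw [Prod.mk.injEq]
    omega
  · obtain ⟨s, hs, e⟩ := label_of_gt' (ξ := ξ) h4 (v := (i, p)) hi
    have hcy := cy_of_gt h4 (v := (i, p)) hi
    obtain ⟨a1, a2, a3⟩ := H.coords_of_twist hu hv hcx hs (by rw [← h, e]) (by omega) (by omega)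
      (by omega) (by omega)
    have a1 : ¬ j ≤ n - 2 := a1
    have a2 : q - (min j (n - 1) : ℕ) = p - (min i (n - 1) : ℕ) := a2
    have hpq : p = q := by omega
    subst hpq
    by_contra hne
    have hij : i ≠ j := fun e => hne (by rw [e])
    have hpar : (2 : ℤ) ∣ p - ξ n := by
      rcases (show i = n ∨ j = n by omega) with rfl | rfl
      · exact isRepVertex_parity hu.1
      · exact isRepVertex_parity hv.1
    obtain ⟨s', hs', e1, e2⟩ := H.label_spin hpar
    have h5 : label n ξ (n, p) = label n ξ (n - 1, p) := by
      rcases (show (i = n ∧ j = n - 1) ∨ (i = n - 1 ∧ j = n) by omega) with ⟨rfl, rfl⟩ | ⟨rfl, rfl⟩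
      · exact h
      · exact h.symm
    rw [e1, e2] at h5
    have h6 := congrArg (fun a => a ⬝ᵥ eps n (twist n ξ)) (add_left_cancel h5)
    simp only [smul_dotProduct, H.isUnitVec_twist.dot_self, smul_eq_mul] at h6
    omega

theorem IsHeight.exists_location_of_wheel (H : IsHeight n ξ) {x y : ℤ}
    (hx : (2 : ℤ) ∣ x - leftEnd ξ 0) (hy : (2 : ℤ) ∣ y - leftEnd ξ 0) (hxy : x < y)
    (hyx : y < x + per n) (hpos : IsPosRoot n (wheel n ξ x - wheel n ξ y)) :
    ∃ v, InAR n ξ v ∧ label n ξ v = wheel n ξ x - wheel n ξ y := by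
  have h4 := H.four_le
  have hpp := H.per_pos
  have hpe := per_even n
  obtain ⟨l, hl⟩ : ∃ l : ℕ, y = x + 2 * l := ⟨((y - x) / 2).toNat, by omega⟩
  have hl1 : 1 ≤ l := by omega
  have hln : l ≤ n - 2 := by unfold per at hyx; omega
  -- move the vertex by a multiple of the period into the strip
  set d := x - (leftEnd ξ l - per n + 2) with hd
  have e1 := Int.emod_add_mul_ediv d (per n)
  have e2 := Int.emod_nonneg d (show per n ≠ 0 by omega)
  have e3 := Int.emod_lt_of_pos d (show 0 < per n by omega)
  have e4 : (2 : ℤ) ∣ per n * (d / per n) := dvd_mul_of_dvd_left (per_even n) _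
  have hle := H.leftEnd_parity hln
  have hL : leftEnd ξ l = ξ l - l := by unfold leftEnd; rw [chainHeight_of_pos hl1]
  set p := leftEnd ξ l - per n + 2 + d % per n + l with hp
  have hrep : IsRepVertex n ξ (l, p) :=
    ⟨hl1, by dsimp only; omega, even_iff_two_dvd.2 (by dsimp only; omega)⟩
  have hpξ : p ≤ ξ l := by omega
  have hlow : IsLow n ξ (l, p) := by
    unfold IsLow
    rw [if_pos hln]
    show ξ l - per n + 2 ≤ p
    omega
  have hAR : InAR n ξ (l, p) := ⟨hrep, hpξ, hlow⟩
  refine ⟨(l, p), hAR, ?_⟩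
  have hlab := H.label_isPosRoot hAR
  have hx' : x = (p - l) + (d / per n) * per n := by rw [mul_comm]; omega
  have hy' : y = (p + l) + (d / per n) * per n := by rw [mul_comm]; omega
  rw [label_of_le hln] at hlab ⊢
  rw [hx', hy', wheel_add_mul_per h4, wheel_add_mul_per h4] at hpos ⊢
  rcases negOnePow_cases (d / per n) with hs | hs
  · rw [hs, one_smul, one_smul]
  · exfalso
    refine hlab.not_neg ?_
    rw [hs] at hpos
    convert hpos using 1
    module

/-- Every positive root is the label of a vertex of the Auslander-Reiten quiver. -/
theorem IsHeight.exists_location (H : IsHeight n ξ) {β : Fin n → ℤ} (hβ : IsPosRoot n β) :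
    ∃ v, InAR n ξ v ∧ label n ξ v = β := by
  have h4 := H.four_le
  have hpp := H.per_pos
  have hpe := per_even n
  obtain ⟨a, b, ha, hb, hab, rfl⟩ := hβ.exists_unit
  have spin : ∀ x s : ℤ, (2 : ℤ) ∣ x - leftEnd ξ 0 → (s = 1 ∨ s = -1) →
      IsPosRoot n (wheel n ξ x + s • eps n (twist n ξ)) →
      ∃ v, InAR n ξ v ∧ label n ξ v = wheel n ξ x + s • eps n (twist n ξ) := by
    intro x s hx hs hpos
    -- the representative of the position in the window from `M - per` to `M + per - 2`
    set M := leftEnd ξ (n - 2) with hM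
    obtain ⟨z, z1, z2, z3, z4⟩ := H.exists_window hx (M - per n)
    have hMp := H.leftEnd_parity (k := n - 2) le_rfl
    rw [← z4] at hpos ⊢
    obtain ⟨i, hi, hrep, hlab⟩ := H.exists_spin z3 hs
    have hi' : ¬ i ≤ n - 2 := by omega
    have hzM : z ≤ M := by
      by_contra hlt
      refine H.not_isPosRoot_label_of_gt hrep hi' (by omega) (by omega) ?_
      rw [hlab]; exact hpos
    have hx := H.height_last hi' hrep.2.1
    refine ⟨_, ⟨hrep, ?_, ?_⟩, hlab⟩
    · show z + ((n : ℤ) - 1) ≤ ξ i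
      by_contra hlt
      have he : z + ((n : ℤ) - 1) = ξ i + 2 := by omega
      refine H.not_isPosRoot_top (i := i) hrep.1 hrep.2.1 ?_
      rw [← he, hlab]; exact hpos
    · unfold IsLow
      rw [if_neg hi', hlab]
      dsimp only
      by_cases hb : z = M - per n
      · exact Or.inr ⟨by omega, hpos⟩
      · left; omega
  rcases H.unit_cases ha with ⟨x, hx, rfl⟩ | ⟨s, hs, rfl⟩
  · rcases H.unit_cases hb with ⟨z, hz, rfl⟩ | ⟨s, hs, rfl⟩
    · obtain ⟨y, y1, y2, y3, y4⟩ := H.exists_window (z := z + per n) (by omega) x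
      rw [wheel_add_per h4] at y4
      have e : wheel n ξ z = -wheel n ξ y := by rw [y4, neg_neg]
      rw [e, ← sub_eq_add_neg] at hβ ⊢
      rw [e, dotProduct_neg, neg_eq_zero] at hab
      have hne : x ≠ y := by
        rintro rfl
        rw [(H.isUnitVec_wheel hx).dot_self] at hab; omega
      have hne' : y ≠ x + per n := by
        rintro rfl
        rw [wheel_add_per h4, dotProduct_neg, (H.isUnitVec_wheel hx).dot_self] at hab; omega
      by_cases hlt : y < x + per n
      · exact H.exists_location_of_wheel hx y3 (by omega) hlt hβ
      · have e' : wheel n ξ x - wheel n ξ y = wheel n ξ (y - per n) - wheel n ξ (x + per n) := by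
          rw [wheel_sub_per h4, wheel_add_per h4]; abel
        rw [e'] at hβ ⊢
        exact H.exists_location_of_wheel (by omega) (by omega) (by omega) (by omega) hβ
    · exact spin x s hx hs hβ
  · rcases H.unit_cases hb with ⟨z, hz, rfl⟩ | ⟨s', hs', rfl⟩
    · rw [add_comm] at hβ ⊢
      exact spin z s hz hs hβ
    · exfalso
      rw [smul_dotProduct, dotProduct_smul, H.isUnitVec_twist.dot_self] at hab
      rcases hs with rfl | rfl <;> rcases hs' with rfl | rfl <;> simp at hab

end

section
variable {n : ℕ} {ξ : ℕ → ℤ}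

/-! ### Paths in the Auslander-Reiten quiver -/

/-- The order on vertices given by paths of positive length: both coordinates increase weakly, and
the second component increases strictly. -/
def Before (n : ℕ) (u v : ℕ × ℤ) : Prop := cx n u ≤ cx n v ∧ cy n u ≤ cy n v ∧ u.2 < v.2

theorem Before.trans {u v t : ℕ × ℤ} (h : Before n u v) (h' : Before n v t) : Before n u t :=
  ⟨h.1.trans h'.1, h.2.1.trans h'.2.1, h.2.2.trans h'.2.2⟩

theorem IsHeight.height_adj (H : IsHeight n ξ) {i j : ℕ} (h : DiagramAdj n i j) :
    ξ j = ξ i + 1 ∨ ξ j = ξ i - 1 := by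
  have h4 := H.four_le
  have hl := H.last
  rcases h with ⟨h1, rfl, h2⟩ | ⟨h1, rfl, h2⟩ | ⟨rfl, rfl⟩ | ⟨rfl, rfl⟩
  · exact H.chain i h1 h2
  · have := H.chain j h1 h2; omega
  · exact hl
  · omega

theorem arrow_coords (hn : 4 ≤ n) {u v : ℕ × ℤ} (h : RepArrow n u v) :
    (cx n v = cx n u ∧ cy n v = cy n u + 2 ∧ u.1 ≤ n - 2) ∨
      (cx n v = cx n u + 2 ∧ cy n v = cy n u ∧ v.1 ≤ n - 2) := by
  obtain ⟨h1, h2⟩ := h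
  unfold DiagramAdj at h1
  unfold cx cy
  omega

theorem arrow_before (hn : 4 ≤ n) {u v : ℕ × ℤ} (h : RepArrow n u v) : Before n u v := by
  have h2 := h.2
  unfold Before
  rcases arrow_coords hn h with h1 | h1 <;> omega

/-- The region of the Auslander-Reiten quiver is closed under arrows towards its upper boundary. -/
theorem IsHeight.isLow_of_arrow (H : IsHeight n ξ) {u v : ℕ × ℤ} (h : RepArrow n u v)
    (hu : IsRepVertex n ξ u) (hv : IsRepVertex n ξ v) (hlow : IsLow n ξ u) : IsLow n ξ v := by
  have h4 := H.four_le
  obtain ⟨i, p⟩ := u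
  obtain ⟨j, q⟩ := v
  have hadj : DiagramAdj n i j := h.1
  have hq : q = p + 1 := h.2
  have hξ := H.height_adj hadj
  have hp1 := isRepVertex_parity hu
  have hp2 := isRepVertex_parity hv
  have hll := H.leftEnd_last
  have hpe := per_even n
  unfold IsLow at *
  dsimp only at *
  by_cases hj : j ≤ n - 2
  · rw [if_pos hj]
    by_cases hi : i ≤ n - 2
    · rw [if_pos hi] at hlow; omega
    · rw [if_neg hi] at hlow
      have : j = n - 2 := by unfold DiagramAdj at hadj; omega
      subst this
      omega
  · rw [if_neg hj]
    left
    have : i = n - 2 := by unfold DiagramAdj at hadj; omega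
    subst this
    rw [if_pos le_rfl] at hlow
    omega

theorem IsHeight.le_of_arrow (H : IsHeight n ξ) {u v : ℕ × ℤ} (h : RepArrow n u v)
    (hv : v.2 ≤ ξ v.1) : u.2 ≤ ξ u.1 := by
  have hξ := H.height_adj h.1
  have := h.2
  omega

/-- Arrows between vertices of the repetition quiver. -/
def VertexArrow (n : ℕ) (ξ : ℕ → ℤ) (u v : ℕ × ℤ) : Prop :=
  IsRepVertex n ξ u ∧ IsRepVertex n ξ v ∧ RepArrow n u v

/-- A path in the repetition quiver exists as soon as the coordinates allow it. -/
theorem IsHeight.exists_path (H : IsHeight n ξ) (d : ℕ) : ∀ {u v : ℕ × ℤ}, v.2 = u.2 + d →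
    IsRepVertex n ξ u → IsRepVertex n ξ v → cx n u ≤ cx n v → cy n u ≤ cy n v →
    (u.2 = v.2 → u.1 = v.1) → Relation.ReflTransGen (VertexArrow n ξ) u v := by
  have h4 := H.four_le
  induction d with
  | zero =>
    intro u v h _ _ _ _ h'
    have : u = v := Prod.ext (h' (by simpa using h.symm)) (by simpa using h.symm)
    rw [this]
  | succ d ih =>
    intro u v h hu hv h1 h2 _
    have hpu := H.cx_parity hu
    have hpv := H.cx_parity hv
    have hqu := H.cy_parity hu
    have hqv := H.cy_parity hv
    have hu1 := hu.1
    have hun := hu.2.1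
    have hv1 := hv.1
    have hvn := hv.2.1
    push_cast at h
    -- the first step goes up as long as the right coordinate has to increase
    have step : ∃ j, 1 ≤ j ∧ j ≤ n ∧ DiagramAdj n u.1 j ∧ cx n (j, u.2 + 1) ≤ cx n v ∧
        cy n (j, u.2 + 1) ≤ cy n v ∧ (u.2 + 1 = v.2 → j = v.1) := by
      unfold cx cy DiagramAdj at *
      dsimp only at *
      by_cases c1 : u.1 < n - 2 ∧ u.2 + (min u.1 (n - 1) : ℕ) < v.2 + (min v.1 (n - 1) : ℕ)
      · exact ⟨u.1 + 1, by omega⟩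
      by_cases c2 : u.1 = n - 2 ∧ u.2 + (min u.1 (n - 1) : ℕ) < v.2 + (min v.1 (n - 1) : ℕ)
      · by_cases c3 : v.1 ≤ n - 2
        · exact ⟨n - 1, by omega⟩
        · exact ⟨v.1, by omega⟩
      by_cases c4 : u.1 ≤ n - 2
      · exact ⟨u.1 - 1, by omega⟩
      · exact ⟨n - 2, by omega⟩
    obtain ⟨j, j1, j2, j3, j4, j5, j6⟩ := step
    have harr : RepArrow n u (j, u.2 + 1) := ⟨j3, rfl⟩
    have hj : IsRepVertex n ξ (j, u.2 + 1) := by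
      refine H.isRepVertex_of_parity j1 j2 ?_
      rcases arrow_coords h4 harr with hc | hc <;> omega
    exact Relation.ReflTransGen.head ⟨hu, hj, harr⟩
      (ih (by dsimp only; omega) hj hv j4 j5 j6)

/-- A path in the repetition quiver between vertices of the Auslander-Reiten quiver stays in it. -/
theorem IsHeight.path_inAR (H : IsHeight n ξ) {u v : ℕ × ℤ}
    (h : Relation.ReflTransGen (VertexArrow n ξ) u v) (hu : InAR n ξ u) (hv : InAR n ξ v) :
    Relation.ReflTransGen (fun a b => InAR n ξ a ∧ InAR n ξ b ∧ RepArrow n a b) u v := by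
  have key : ∀ t, Relation.ReflTransGen (VertexArrow n ξ) u t → t.2 ≤ ξ t.1 →
      Relation.ReflTransGen (fun a b => InAR n ξ a ∧ InAR n ξ b ∧ RepArrow n a b) u t ∧
        (IsRepVertex n ξ t → IsLow n ξ t) := by
    intro t ht
    induction ht with
    | refl => exact fun _ => ⟨Relation.ReflTransGen.refl, fun _ => hu.2.2⟩
    | @tail b c hub hbc ih =>
      intro hc
      have hb := H.le_of_arrow hbc.2.2 hc
      obtain ⟨ih1, ih2⟩ := ih hb
      have hlow := H.isLow_of_arrow hbc.2.2 hbc.1 hbc.2.1 (ih2 hbc.1)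
      exact ⟨ih1.tail ⟨⟨hbc.1, hb, ih2 hbc.1⟩, ⟨hbc.2.1, hc, hlow⟩, hbc.2.2⟩, fun _ => hlow⟩
  exact (key v h hv.2.1).1

theorem transGen_before (hn : 4 ≤ n) {r : ℕ × ℤ → ℕ × ℤ → Prop}
    (hr : ∀ a b, r a b → RepArrow n a b) {u v : ℕ × ℤ} (h : Relation.TransGen r u v) :
    Before n u v := by
  induction h with
  | single h => exact arrow_before hn (hr _ _ h)
  | tail _ h ih => exact ih.trans (arrow_before hn (hr _ _ h))

variable {Q : DynkinQuiver n} {w : List ℕ}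

theorem DynkinQuiver.IsHeightFunction.isLocatedAt_iff_inAR (hn : 4 ≤ n)
    (hξ : Q.IsHeightFunction ξ) (hw : Q.IsCoxeterWord w) {β : PosRoot n} {v : ℕ × ℤ} :
    IsLocatedAt Q ξ w β v ↔ InAR n ξ v ∧ label n ξ v = β.1 := by
  rw [hξ.isLocatedAt_iff hn hw]
  unfold InAR
  tauto

theorem DynkinQuiver.IsHeightFunction.isARVertex_iff (hn : 4 ≤ n)
    (hξ : Q.IsHeightFunction ξ) (hw : Q.IsCoxeterWord w) {v : ℕ × ℤ} :
    IsARVertex Q ξ w v ↔ InAR n ξ v := by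
  constructor
  · rintro ⟨β, h⟩
    exact ((hξ.isLocatedAt_iff_inAR hn hw).1 h).1
  · intro h
    exact ⟨⟨label n ξ v, (hξ.isHeight hn).label_isPosRoot h⟩,
      (hξ.isLocatedAt_iff_inAR hn hw).2 ⟨h, rfl⟩⟩

theorem DynkinQuiver.IsHeightFunction.arArrow_iff (hn : 4 ≤ n)
    (hξ : Q.IsHeightFunction ξ) (hw : Q.IsCoxeterWord w) {u v : ℕ × ℤ} :
    ARArrow Q ξ w u v ↔ InAR n ξ u ∧ InAR n ξ v ∧ RepArrow n u v := by
  unfold ARArrow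
  rw [hξ.isARVertex_iff hn hw, hξ.isARVertex_iff hn hw]

theorem DynkinQuiver.IsHeightFunction.transGen_iff (hn : 4 ≤ n)
    (hξ : Q.IsHeightFunction ξ) (hw : Q.IsCoxeterWord w) {u v : ℕ × ℤ} (hu : InAR n ξ u)
    (hv : InAR n ξ v) : Relation.TransGen (ARArrow Q ξ w) u v ↔ Before n u v := by
  have H := hξ.isHeight hn
  constructor
  · exact transGen_before hn fun a b h => h.2.2
  · intro h
    obtain ⟨d, hd⟩ : ∃ d : ℕ, v.2 = u.2 + d := ⟨(v.2 - u.2).toNat, by have := h.2.2; omega⟩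
    have hp := H.path_inAR (H.exists_path d hd hu.1 hv.1 h.1 h.2.1
      (fun e => absurd e h.2.2.ne)) hu hv
    have e : (fun a b => InAR n ξ a ∧ InAR n ξ b ∧ RepArrow n a b) = ARArrow Q ξ w := by
      ext a b; exact (hξ.arArrow_iff hn hw).symm
    rw [e] at hp
    rcases Relation.reflTransGen_iff_eq_or_transGen.1 hp with rfl | hp
    · exact absurd rfl h.2.2.ne
    · exact hp

/-- The vertex at which a positive root is located. -/
noncomputable def place (n : ℕ) (ξ : ℕ → ℤ) (H : IsHeight n ξ) (β : PosRoot n) : ℕ × ℤ :=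
  (H.exists_location β.2).choose

theorem place_inAR (H : IsHeight n ξ) (β : PosRoot n) : InAR n ξ (place n ξ H β) :=
  (H.exists_location β.2).choose_spec.1

theorem label_place (H : IsHeight n ξ) (β : PosRoot n) : label n ξ (place n ξ H β) = β.1 :=
  (H.exists_location β.2).choose_spec.2

theorem place_injective (H : IsHeight n ξ) : Function.Injective (place n ξ H) := by
  intro α β h
  apply Subtype.ext
  rw [← label_place H α, ← label_place H β, h]

theorem DynkinQuiver.IsHeightFunction.isLocatedAt_iff_eq_place (hn : 4 ≤ n)
    (hξ : Q.IsHeightFunction ξ) (hw : Q.IsCoxeterWord w) {β : PosRoot n} {v : ℕ × ℤ} :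
    IsLocatedAt Q ξ w β v ↔ v = place n ξ (hξ.isHeight hn) β := by
  have H := hξ.isHeight hn
  rw [hξ.isLocatedAt_iff_inAR hn hw]
  constructor
  · rintro ⟨h1, h2⟩
    exact H.label_injective h1 (place_inAR H β) (by rw [h2, label_place])
  · rintro rfl
    exact ⟨place_inAR _ β, label_place _ β⟩

/-- The partial order of the Auslander-Reiten quiver in coordinates. -/
theorem DynkinQuiver.IsHeightFunction.precQ_iff (hn : 4 ≤ n)
    (hξ : Q.IsHeightFunction ξ) (hw : Q.IsCoxeterWord w) {α β : PosRoot n} :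
    PrecQ Q ξ w α β ↔
      Before n (place n ξ (hξ.isHeight hn) β) (place n ξ (hξ.isHeight hn) α) := by
  have H := hξ.isHeight hn
  unfold PrecQ
  simp only [hξ.isLocatedAt_iff_eq_place hn hw]
  constructor
  · rintro ⟨u, v, rfl, rfl, h⟩
    exact (hξ.transGen_iff hn hw (place_inAR _ _) (place_inAR _ _)).1 h
  · intro h
    exact ⟨_, _, rfl, rfl, (hξ.transGen_iff hn hw (place_inAR _ _) (place_inAR _ _)).2 h⟩

/-! ### Sectional paths in coordinates -/

/-- The arrows that can be reached from a vertex along a relation `r` form a connected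
subquiver. -/
theorem isConnectedSubquiver_of_reachable {r : ℕ × ℤ → ℕ × ℤ → Prop}
    (hr : ∀ a b, r a b → ARArrow Q ξ w a b) (u : ℕ × ℤ) :
    IsConnectedSubquiver Q ξ w {e | r e.1 e.2 ∧ Relation.ReflTransGen r u e.1} := by
  set ρ : Set ((ℕ × ℤ) × (ℕ × ℤ)) := {e | r e.1 e.2 ∧ Relation.ReflTransGen r u e.1} with hρ
  have key : ∀ x, Relation.ReflTransGen r u x → Relation.EqvGen (fun x y => (x, y) ∈ ρ) u x := by
    intro x hx
    induction hx with
    | refl => exact Relation.EqvGen.refl _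
    | @tail b c hub hbc ih => exact ih.trans _ _ _ (Relation.EqvGen.rel _ _ ⟨hbc, hub⟩)
  have key' : ∀ x, IsVertexOf ρ x → Relation.EqvGen (fun x y => (x, y) ∈ ρ) u x := by
    rintro x ⟨e, ⟨he1, he2⟩, rfl | rfl⟩
    · exact key _ he2
    · exact key _ (he2.tail he1)
  exact ⟨fun e he => hr _ _ he.1, fun x y hx hy => (key' x hx).symm.trans _ _ _ (key' y hy)⟩

theorem isVertexOf_of_transGen {r : ℕ × ℤ → ℕ × ℤ → Prop} {u v : ℕ × ℤ}
    (h : Relation.TransGen r u v) :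
    IsVertexOf {e | r e.1 e.2 ∧ Relation.ReflTransGen r u e.1} u ∧
      IsVertexOf {e | r e.1 e.2 ∧ Relation.ReflTransGen r u e.1} v := by
  constructor
  · obtain ⟨b, h1, _⟩ := Relation.TransGen.head'_iff.1 h
    exact ⟨(u, b), ⟨h1, Relation.ReflTransGen.refl⟩, Or.inl rfl⟩
  · obtain ⟨b, h1, h2⟩ := Relation.TransGen.tail'_iff.1 h
    exact ⟨(b, v), ⟨h2, h1⟩, Or.inr rfl⟩

/-- Along a path on which the left coordinate is constant, all arrows are S-arrows. -/
theorem transGen_sArrow (hn : 4 ≤ n) {u v : ℕ × ℤ} (h : Relation.TransGen (ARArrow Q ξ w) u v)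
    (hx : cx n u = cx n v) :
    Relation.TransGen (fun a b => ARArrow Q ξ w a b ∧ IsSArrow n (a, b)) u v := by
  have arrow : ∀ a b, ARArrow Q ξ w a b → cx n a = cx n b → IsSArrow n (a, b) := by
    rintro ⟨i, p⟩ ⟨j, q⟩ ⟨_, _, h1, h2⟩ h3
    refine ⟨h2, ?_⟩
    unfold DiagramAdj at h1
    unfold cx at h3
    dsimp only at *
    omega
  induction h with
  | single h => exact Relation.TransGen.single ⟨h, arrow _ _ h hx⟩
  | @tail b c h h' ih =>
    have h1 := transGen_before hn (fun a b (h : ARArrow Q ξ w a b) => h.2.2) h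
    have h2 := arrow_before hn h'.2.2
    unfold Before at h1 h2
    exact (ih (by omega)).tail ⟨h', arrow _ _ h' (by omega)⟩

/-- Along a path on which the right coordinate is constant, all arrows are N-arrows. -/
theorem transGen_nArrow (hn : 4 ≤ n) {u v : ℕ × ℤ} (h : Relation.TransGen (ARArrow Q ξ w) u v)
    (hy : cy n u = cy n v) :
    Relation.TransGen (fun a b => ARArrow Q ξ w a b ∧ IsNArrow n (a, b)) u v := by
  have arrow : ∀ a b, ARArrow Q ξ w a b → cy n a = cy n b → IsNArrow n (a, b) := by
    rintro ⟨i, p⟩ ⟨j, q⟩ ⟨_, _, h1, h2⟩ h3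
    refine ⟨h2, ?_⟩
    unfold DiagramAdj at h1
    unfold cy at h3
    dsimp only at *
    omega
  induction h with
  | single h => exact Relation.TransGen.single ⟨h, arrow _ _ h hy⟩
  | @tail b c h h' ih =>
    have h1 := transGen_before hn (fun a b (h : ARArrow Q ξ w a b) => h.2.2) h
    have h2 := arrow_before hn h'.2.2
    unfold Before at h1 h2
    exact (ih (by omega)).tail ⟨h', arrow _ _ h' (by omega)⟩

theorem exists_sectional_of_transGen (hn : 4 ≤ n) {u v : ℕ × ℤ}
    (h : Relation.TransGen (ARArrow Q ξ w) u v) (hxy : cx n u = cx n v ∨ cy n u = cy n v) :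
    ∃ ρ, IsSectionalPath Q ξ w ρ ∧ IsVertexOf ρ u ∧ IsVertexOf ρ v := by
  rcases hxy with hx | hy
  · have h' := transGen_sArrow hn h hx
    exact ⟨_, ⟨isConnectedSubquiver_of_reachable (fun a b h => h.1) u, Or.inl fun e he => he.1.2⟩,
      isVertexOf_of_transGen h'⟩
  · have h' := transGen_nArrow hn h hy
    exact ⟨_, ⟨isConnectedSubquiver_of_reachable (fun a b h => h.1) u, Or.inr fun e he => he.1.2⟩,
      isVertexOf_of_transGen h'⟩

theorem eqvGen_eq {r : ℕ × ℤ → ℕ × ℤ → Prop} {f : ℕ × ℤ → ℤ} (hr : ∀ a b, r a b → f a = f b)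
    {u v : ℕ × ℤ} (h : Relation.EqvGen r u v) : f u = f v := by
  induction h with
  | rel _ _ h => exact hr _ _ h
  | refl _ => rfl
  | symm _ _ _ ih => exact ih.symm
  | trans _ _ _ _ _ ih1 ih2 => exact ih1.trans ih2

/-- Two comparable roots lie on a common sectional path exactly if one of their coordinates
agrees. -/
theorem DynkinQuiver.IsHeightFunction.lieOnCommonSectionalPath_iff (hn : 4 ≤ n)
    (hξ : Q.IsHeightFunction ξ) (hw : Q.IsCoxeterWord w) {β γ : PosRoot n}
    (hcomp : Before n (place n ξ (hξ.isHeight hn) β) (place n ξ (hξ.isHeight hn) γ) ∨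
      Before n (place n ξ (hξ.isHeight hn) γ) (place n ξ (hξ.isHeight hn) β)) :
    LieOnCommonSectionalPath Q ξ w β γ ↔
      cx n (place n ξ (hξ.isHeight hn) β) = cx n (place n ξ (hξ.isHeight hn) γ) ∨
      cy n (place n ξ (hξ.isHeight hn) β) = cy n (place n ξ (hξ.isHeight hn) γ) := by
  have hAR := place_inAR (hξ.isHeight hn)
  unfold LieOnCommonSectionalPath IsContainedIn
  simp only [hξ.isLocatedAt_iff_eq_place hn hw, exists_eq_left]
  constructor
  · rintro ⟨ρ, ⟨⟨_, hconn⟩, hSN⟩, h1, h2⟩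
    have he := hconn _ _ h1 h2
    rcases hSN with hS | hN
    · left
      refine eqvGen_eq (fun a b hab => ?_) he
      have := hS _ hab
      unfold IsSArrow at this
      unfold cx
      dsimp only at this
      omega
    · right
      refine eqvGen_eq (fun a b hab => ?_) he
      have := hN _ hab
      unfold IsNArrow at this
      unfold cy
      dsimp only at this
      omega
  · intro h
    rcases hcomp with hc | hc
    · exact exists_sectional_of_transGen hn ((hξ.transGen_iff hn hw (hAR _) (hAR _)).2 hc) h
    · obtain ⟨ρ, h1, h2, h3⟩ := exists_sectional_of_transGen hn
        ((hξ.transGen_iff hn hw (hAR _) (hAR _)).2 hc) (h.imp Eq.symm Eq.symm)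
      exact ⟨ρ, h1, h3, h2⟩

end

section
variable {n : ℕ} {ξ : ℕ → ℤ}

/-! ### Pairs of a root in coordinates -/

/-- A pair of the root with coordinates `(x, y)` is straight if at least one of its members shares a
coordinate with this root. The vertex `u` is the member before the root, `v` the one after it. -/
def IsStraight (n : ℕ) (x y : ℤ) (u v : ℕ × ℤ) : Prop :=
  (cx n u = y - per n ∧ cy n u = y ∧ cx n v = x ∧ cy n v = x + per n) ∨
  ∃ z, (x < z ∧ z < y ∧ cx n u = x ∧ cy n u = z ∧ cx n v = z ∧ cy n v = y) ∨
    (y < z ∧ z < x + per n ∧ cx n u = y - per n ∧ cy n u = z - per n ∧ cx n v = x ∧ cy n v = z) ∨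
    (y < z ∧ z < x + per n ∧ cx n u = z - per n ∧ cy n u = y ∧ cx n v = z ∧ cy n v = x + per n)

/-- A pair of the root with coordinates `(x, y)` is crossing if it is of the remaining form, in
which no coordinate is shared. -/
def IsCrossing (n : ℕ) (x y : ℤ) (u v : ℕ × ℤ) : Prop :=
  ∃ z, x < z ∧ z < y ∧ cx n u = y - per n ∧ cy n u = z ∧ cx n v = z ∧ cy n v = x + per n

theorem cx_add_cy (v : ℕ × ℤ) : cx n v + cy n v = 2 * v.2 := by unfold cx cy; ring

theorem IsHeight.pair_coords_aux (H : IsHeight n ξ) {α β γ : PosRoot n}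
    (hγ : (place n ξ H γ).1 ≤ n - 2) {ζ : Fin n → ℤ} (hζ : IsUnitVec n ζ)
    (hxζ : wheel n ξ (cx n (place n ξ H γ)) ⬝ᵥ ζ = 0)
    (hyζ : -wheel n ξ (cy n (place n ξ H γ)) ⬝ᵥ ζ = 0)
    (hα : α.1 = wheel n ξ (cx n (place n ξ H γ)) + ζ)
    (hβ : β.1 = -wheel n ξ (cy n (place n ξ H γ)) - ζ) :
    (IsStraight n (cx n (place n ξ H γ)) (cy n (place n ξ H γ)) (place n ξ H α) (place n ξ H β) ∨
      IsCrossing n (cx n (place n ξ H γ)) (cy n (place n ξ H γ)) (place n ξ H α) (place n ξ H β)) ∨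
    (IsStraight n (cx n (place n ξ H γ)) (cy n (place n ξ H γ)) (place n ξ H β) (place n ξ H α) ∨
      IsCrossing n (cx n (place n ξ H γ)) (cy n (place n ξ H γ)) (place n ξ H β)
        (place n ξ H α)) := by
  have h4 := H.four_le
  have hpe := per_even n
  have hAR := place_inAR H γ
  have hARα := place_inAR H α
  have hARβ := place_inAR H β
  have hlα := label_place H α
  have hlβ := label_place H β
  have hx := H.cx_parity hAR.1
  have hy := H.cy_parity hAR.1
  have hlt := cy_sub_cx_of_le h4 hAR.1.1 hγ
  set x := cx n (place n ξ H γ)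
  set y := cy n (place n ξ H γ)
  rw [hα] at hlα
  rw [hβ] at hlβ
  rcases H.unit_cases hζ.neg with ⟨z₀, hz₀, e₀⟩ | ⟨s, hs, e₀⟩
  · obtain ⟨z, z1, z2, z3, z4⟩ := H.exists_window hz₀ x
    rw [← z4] at e₀
    have e : ζ = -wheel n ξ z := by rw [← e₀, neg_neg]
    rw [e, ← sub_eq_add_neg] at hlα
    rw [e, sub_neg_eq_add, neg_add_eq_sub] at hlβ
    -- `z` is incongruent to `x` and `y`, by orthogonality
    have hself := fun t ht => (H.isUnitVec_wheel (x := t) ht).dot_self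
    rw [e, dotProduct_neg, neg_eq_zero] at hxζ
    rw [e, dotProduct_neg, neg_dotProduct, neg_neg] at hyζ
    have n1 : z ≠ x := by rintro rfl; rw [hself _ hx] at hxζ; omega
    have n2 : z ≠ y := by rintro rfl; rw [hself _ hy] at hyζ; omega
    have n3 : z ≠ x + per n := by
      rintro rfl; rw [wheel_add_per h4, dotProduct_neg, hself _ hx] at hxζ; omega
    have n4 : z ≠ y + per n := by
      rintro rfl; rw [wheel_add_per h4, dotProduct_neg, hself _ hy] at hyζ; omega
    have sub1 : wheel n ξ x = -wheel n ξ (x + per n) := by rw [wheel_add_per h4, neg_neg]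
    have sub2 : wheel n ξ y = -wheel n ξ (y - per n) := by rw [wheel_sub_per h4, neg_neg]
    have sub3 : wheel n ξ z = -wheel n ξ (z - per n) := by rw [wheel_sub_per h4, neg_neg]
    have sub4 : wheel n ξ z = wheel n ξ (z - per n - per n) := by
      rw [wheel_sub_per h4, wheel_sub_per h4, neg_neg]
    by_cases c1 : z < y
    · obtain ⟨_, a1, a2⟩ := H.coords_of_wheel hAR hARα hx z3 (by omega) (by omega) hlα
        (by omega) (by omega) (by omega) (by omega)
      obtain ⟨_, b1, b2⟩ := H.coords_of_wheel hAR hARβ z3 hy (by omega) (by omega) hlβ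
        (by omega) (by omega) (by omega) (by omega)
      exact Or.inl (Or.inl (Or.inr ⟨z, Or.inl (by omega)⟩))
    by_cases c2 : z < x + per n
    · obtain ⟨_, a1, a2⟩ := H.coords_of_wheel hAR hARα hx z3 (by omega) (by omega) hlα
        (by omega) (by omega) (by omega) (by omega)
      obtain ⟨_, b1, b2⟩ := H.coords_of_wheel hAR hARβ (x := y - per n) (y := z - per n)
        (by omega) (by omega) (by omega) (by omega) (by rw [hlβ, sub2, sub3]; abel)
        (by omega) (by omega) (by omega) (by omega)
      exact Or.inr (Or.inl (Or.inr ⟨z, Or.inr (Or.inl (by omega))⟩))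
    by_cases c3 : z < y + per n
    · obtain ⟨_, a1, a2⟩ := H.coords_of_wheel hAR hARα (x := z - per n) (y := x + per n)
        (by omega) (by omega) (by omega) (by omega) (by rw [hlα, sub1, sub3]; abel)
        (by omega) (by omega) (by omega) (by omega)
      obtain ⟨_, b1, b2⟩ := H.coords_of_wheel hAR hARβ (x := y - per n) (y := z - per n)
        (by omega) (by omega) (by omega) (by omega) (by rw [hlβ, sub2, sub3]; abel)
        (by omega) (by omega) (by omega) (by omega)
      exact Or.inr (Or.inr ⟨z - per n, by omega⟩)
    · obtain ⟨_, a1, a2⟩ := H.coords_of_wheel hAR hARα (x := z - per n) (y := x + per n)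
        (by omega) (by omega) (by omega) (by omega) (by rw [hlα, sub1, sub3]; abel)
        (by omega) (by omega) (by omega) (by omega)
      obtain ⟨_, b1, b2⟩ := H.coords_of_wheel hAR hARβ (x := z - per n - per n) (y := y)
        (by omega) (by omega) (by omega) (by omega) (by rw [hlβ, sub4])
        (by omega) (by omega) (by omega) (by omega)
      exact Or.inr (Or.inl (Or.inr ⟨z - per n, Or.inr (Or.inr (by omega))⟩))
  · have e : ζ = (-s) • eps n (twist n ξ) := by rw [neg_smul, ← e₀, neg_neg]
    rw [e] at hlα
    obtain ⟨_, a1, a2⟩ := H.coords_of_twist hAR hARα hx (s := -s) (by omega) hlα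
      (by omega) (by omega) (by omega) (by omega)
    obtain ⟨_, b1, b2⟩ := H.coords_of_twist hAR hARβ (x := y - per n) (by omega) hs
      (by rw [hlβ, wheel_sub_per h4, e]; module) (by omega) (by omega) (by omega) (by omega)
    exact Or.inr (Or.inl (Or.inl (by omega)))

/-- Every pair of a root without `ε_t` is straight or crossing. -/
theorem IsHeight.pair_coords (H : IsHeight n ξ) {α β γ : PosRoot n}
    (hγ : (place n ξ H γ).1 ≤ n - 2) (h : γ.1 = α.1 + β.1) :
    (IsStraight n (cx n (place n ξ H γ)) (cy n (place n ξ H γ)) (place n ξ H α) (place n ξ H β) ∨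
      IsCrossing n (cx n (place n ξ H γ)) (cy n (place n ξ H γ)) (place n ξ H α) (place n ξ H β)) ∨
    (IsStraight n (cx n (place n ξ H γ)) (cy n (place n ξ H γ)) (place n ξ H β) (place n ξ H α) ∨
      IsCrossing n (cx n (place n ξ H γ)) (cy n (place n ξ H γ)) (place n ξ H β)
        (place n ξ H α)) := by
  have h4 := H.four_le
  have hAR := place_inAR H γ
  have hx := H.cx_parity hAR.1
  have hy := H.cy_parity hAR.1
  have hlt := cy_sub_cx_of_le h4 hAR.1.1 hγ
  have hdot := H.wheel_dot_of_lt hx hy hlt.1 hlt.2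
  have hl := label_place H γ
  rw [label_of_le' hγ, sub_eq_add_neg, h] at hl
  obtain ⟨ζ, h1, h2, h3, ⟨e1, e2⟩ | ⟨e1, e2⟩⟩ := exists_unit_of_pair α.2 β.2 (H.isUnitVec_wheel hx)
    (H.isUnitVec_wheel hy).neg (by rw [dotProduct_neg, hdot, neg_zero]) hl
  · exact H.pair_coords_aux hγ h1 h2 h3 e1 e2
  · exact (H.pair_coords_aux hγ h1 h2 h3 e1 e2).symm

theorem IsHeight.before_of_pair_aux (H : IsHeight n ξ) {α β γ : PosRoot n}
    (hγ : ¬ (place n ξ H γ).1 ≤ n - 2) {s : ℤ} (hs : s = 1 ∨ s = -1) {ζ : Fin n → ℤ}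
    (hζ : IsUnitVec n ζ) (hxζ : wheel n ξ (cx n (place n ξ H γ)) ⬝ᵥ ζ = 0)
    (htζ : (s • eps n (twist n ξ)) ⬝ᵥ ζ = 0)
    (hα : α.1 = wheel n ξ (cx n (place n ξ H γ)) + ζ)
    (hβ : β.1 = s • eps n (twist n ξ) - ζ) :
    (Before n (place n ξ H α) (place n ξ H γ) ∧ Before n (place n ξ H γ) (place n ξ H β)) ∨
      (Before n (place n ξ H β) (place n ξ H γ) ∧ Before n (place n ξ H γ) (place n ξ H α)) := by
  have h4 := H.four_le
  have hpe := per_even n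
  have hAR := place_inAR H γ
  have hARα := place_inAR H α
  have hARβ := place_inAR H β
  have hlα := label_place H α
  have hlβ := label_place H β
  have hx := H.cx_parity hAR.1
  have hy := cy_of_gt h4 hγ
  have p1 := cx_add_cy (n := n) (place n ξ H α)
  have p2 := cx_add_cy (n := n) (place n ξ H β)
  have p3 := cx_add_cy (n := n) (place n ξ H γ)
  unfold Before
  set x := cx n (place n ξ H γ)
  rw [hα] at hlα
  rw [hβ] at hlβ
  rcases H.unit_cases hζ.neg with ⟨z₀, hz₀, e₀⟩ | ⟨s', hs', e₀⟩
  · obtain ⟨z, z1, z2, z3, z4⟩ := H.exists_window hz₀ x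
    rw [← z4] at e₀
    have e : ζ = -wheel n ξ z := by rw [← e₀, neg_neg]
    rw [e, ← sub_eq_add_neg] at hlα
    rw [e, sub_neg_eq_add, add_comm] at hlβ
    have hself := fun t ht => (H.isUnitVec_wheel (x := t) ht).dot_self
    rw [e, dotProduct_neg, neg_eq_zero] at hxζ
    have n1 : z ≠ x := by rintro rfl; rw [hself _ hx] at hxζ; omega
    have n3 : z ≠ x + per n := by
      rintro rfl; rw [wheel_add_per h4, dotProduct_neg, hself _ hx] at hxζ; omega
    have sub1 : wheel n ξ x = -wheel n ξ (x + per n) := by rw [wheel_add_per h4, neg_neg]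
    have sub3 : wheel n ξ z = -wheel n ξ (z - per n) := by rw [wheel_sub_per h4, neg_neg]
    have sub4 : wheel n ξ z = wheel n ξ (z - per n - per n) := by
      rw [wheel_sub_per h4, wheel_sub_per h4, neg_neg]
    by_cases c2 : z < x + per n
    · obtain ⟨_, a1, a2⟩ := H.coords_of_wheel hAR hARα hx z3 (by omega) (by omega) hlα
        (by omega) (by omega) (by omega) (by omega)
      obtain ⟨_, b1, b2⟩ := H.coords_of_twist hAR hARβ z3 hs hlβ
        (by omega) (by omega) (by omega) (by omega)
      omega
    · obtain ⟨_, a1, a2⟩ := H.coords_of_wheel hAR hARα (x := z - per n) (y := x + per n)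
        (by omega) (by omega) (by omega) (by omega) (by rw [hlα, sub1, sub3]; abel)
        (by omega) (by omega) (by omega) (by omega)
      obtain ⟨_, b1, b2⟩ := H.coords_of_twist hAR hARβ (x := z - per n - per n) (by omega) hs
        (by rw [hlβ, sub4]) (by omega) (by omega) (by omega) (by omega)
      omega
  · exfalso
    rw [← neg_eq_zero, ← dotProduct_neg, e₀, smul_dotProduct, dotProduct_smul,
      H.isUnitVec_twist.dot_self] at htζ
    rcases hs with rfl | rfl <;> rcases hs' with rfl | rfl <;> simp at htζ

/-- The sum of two roots lies between them in the Auslander-Reiten quiver. Hence every total order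
compatible with the paths of the Auslander-Reiten quiver is convex. -/
theorem IsHeight.before_of_pair (H : IsHeight n ξ) {α β γ : PosRoot n} (h : γ.1 = α.1 + β.1) :
    (Before n (place n ξ H α) (place n ξ H γ) ∧ Before n (place n ξ H γ) (place n ξ H β)) ∨
      (Before n (place n ξ H β) (place n ξ H γ) ∧ Before n (place n ξ H γ) (place n ξ H α)) := by
  have h4 := H.four_le
  have hAR := place_inAR H γ
  have hx := H.cx_parity hAR.1
  by_cases hγ : (place n ξ H γ).1 ≤ n - 2
  · have hlt := cy_sub_cx_of_le h4 hAR.1.1 hγ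
    have p1 := cx_add_cy (n := n) (place n ξ H α)
    have p2 := cx_add_cy (n := n) (place n ξ H β)
    have p3 := cx_add_cy (n := n) (place n ξ H γ)
    have := H.pair_coords hγ h
    unfold IsStraight IsCrossing at this
    unfold Before
    rcases this with ((_ | ⟨z, _ | _ | _⟩) | ⟨z, _⟩) | ((_ | ⟨z, _ | _ | _⟩) | ⟨z, _⟩) <;> omega
  · obtain ⟨s, hs, e⟩ := label_of_gt' (ξ := ξ) h4 hγ
    have hl := label_place H γ
    rw [e, h] at hl
    obtain ⟨ζ, h1, h2, h3, ⟨e1, e2⟩ | ⟨e1, e2⟩⟩ := exists_unit_of_pair α.2 β.2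
      (H.isUnitVec_wheel hx) (H.isUnitVec_twist.smul hs)
      (by rw [dotProduct_smul, H.wheel_dot_twist hx, smul_zero]) hl
    · exact H.before_of_pair_aux hγ hs h1 h2 h3 e1 e2
    · exact (H.before_of_pair_aux hγ hs h1 h2 h3 e1 e2).symm

/-! ### An order in which a straight pair is minimal -/

open Classical in
/-- The roots are divided into three levels by the interval between `α` and `β` (with `β` before
`α` in the Auslander-Reiten quiver): level `0` for the roots which are neither `α` nor before `α`,
level `1` for the roots in the interval, level `2` for the others. -/
noncomputable def level (H : IsHeight n ξ) (α β δ : PosRoot n) : ℕ :=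
  if ¬ (δ = α ∨ Before n (place n ξ H δ) (place n ξ H α)) then 0
  else if δ = β ∨ Before n (place n ξ H β) (place n ξ H δ) then 1 else 2

/-- The key by which the roots are sorted: first the level, then the position in the
Auslander-Reiten quiver. -/
noncomputable def sortKey (H : IsHeight n ξ) (α β δ : PosRoot n) : ℕ ×ₗ ℤ ×ₗ ℕ :=
  toLex (level H α β δ, toLex (-(place n ξ H δ).2, (place n ξ H δ).1))

/-- A total order compatible with the Auslander-Reiten quiver, in which only the roots of the
interval from `α` to `β` lie between `α` and `β`. -/
def intervalOrder (H : IsHeight n ξ) (α β : PosRoot n) (δ δ' : PosRoot n) : Prop :=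
  sortKey H α β δ < sortKey H α β δ'

theorem sortKey_injective (H : IsHeight n ξ) (α β : PosRoot n) :
    Function.Injective (sortKey H α β) := by
  intro δ δ' h
  have h1 := congrArg (fun k => ofLex (ofLex k).2) h
  simp only [sortKey, ofLex_toLex, Prod.mk.injEq, neg_inj] at h1
  exact place_injective H (Prod.ext h1.2 h1.1)

theorem intervalOrder_isStrictTotalOrder (H : IsHeight n ξ) (α β : PosRoot n) :
    IsStrictTotalOrder (PosRoot n) (intervalOrder H α β) :=
  (RelEmbedding.preimage ⟨sortKey H α β, sortKey_injective H α β⟩ (· < ·)).isStrictTotalOrder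

theorem level_mono (H : IsHeight n ξ) (α β : PosRoot n) {δ δ' : PosRoot n}
    (h : Before n (place n ξ H δ') (place n ξ H δ)) : level H α β δ ≤ level H α β δ' := by
  have h1 : (δ = α ∨ Before n (place n ξ H δ) (place n ξ H α)) →
      (δ' = α ∨ Before n (place n ξ H δ') (place n ξ H α)) := by
    rintro (rfl | h2)
    · exact Or.inr h
    · exact Or.inr (h.trans h2)
  have h2 : (δ' = β ∨ Before n (place n ξ H β) (place n ξ H δ')) →
      (δ = β ∨ Before n (place n ξ H β) (place n ξ H δ)) := by
    rintro (rfl | h2)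
    · exact Or.inr h
    · exact Or.inr (h2.trans h)
  unfold level
  split_ifs <;> first | omega | (exfalso; tauto)

theorem intervalOrder_of_before (H : IsHeight n ξ) (α β : PosRoot n) {δ δ' : PosRoot n}
    (h : Before n (place n ξ H δ') (place n ξ H δ)) : intervalOrder H α β δ δ' := by
  unfold intervalOrder sortKey
  rw [Prod.Lex.toLex_lt_toLex]
  rcases lt_or_eq_of_le (level_mono H α β h) with h1 | h1
  · exact Or.inl h1
  · refine Or.inr ⟨h1, ?_⟩
    rw [Prod.Lex.toLex_lt_toLex]
    have := h.2.2
    left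
    dsimp only
    omega

theorem level_le_of_intervalOrder (H : IsHeight n ξ) (α β : PosRoot n) {δ δ' : PosRoot n}
    (h : intervalOrder H α β δ δ') : level H α β δ ≤ level H α β δ' := by
  unfold intervalOrder sortKey at h
  rw [Prod.Lex.toLex_lt_toLex] at h
  rcases h with h | h
  · exact h.le
  · exact h.1.le

variable {Q : DynkinQuiver n} {w : List ℕ}

theorem isConvexOrder_of_before (H : IsHeight n ξ) {lt : PosRoot n → PosRoot n → Prop}
    (h : ∀ δ δ', Before n (place n ξ H δ') (place n ξ H δ) → lt δ δ') : IsConvexOrder lt := by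
  intro α β γ hγ
  rcases H.before_of_pair hγ with ⟨h1, h2⟩ | ⟨h1, h2⟩
  · exact Or.inr ⟨h _ _ h2, h _ _ h1⟩
  · exact Or.inl ⟨h _ _ h2, h _ _ h1⟩

/-- A straight pair is minimal for the order which keeps apart from it all roots outside of the
interval it spans. -/
theorem DynkinQuiver.IsHeightFunction.not_isNonMinimalPair_of_isStraight (hn : 4 ≤ n)
    (hξ : Q.IsHeightFunction ξ) (hw : Q.IsCoxeterWord w) {α β γ : PosRoot n}
    (hγ : (place n ξ (hξ.isHeight hn) γ).1 ≤ n - 2) (h : γ.1 = α.1 + β.1)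
    (hs : IsStraight n (cx n (place n ξ (hξ.isHeight hn) γ)) (cy n (place n ξ (hξ.isHeight hn) γ))
      (place n ξ (hξ.isHeight hn) β) (place n ξ (hξ.isHeight hn) α)) :
    ¬ IsNonMinimalPair Q ξ w γ α β := by
  have H := hξ.isHeight hn
  rintro ⟨_, hall⟩
  set lt := intervalOrder H α β with hlt
  have hST : IsStrictTotalOrder (PosRoot n) lt := intervalOrder_isStrictTotalOrder H α β
  have hb : ∀ δ δ', Before n (place n ξ H δ') (place n ξ H δ) → lt δ δ' :=
    fun δ δ' h => intervalOrder_of_before H α β h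
  refine (hall lt hST (isConvexOrder_of_before H hb)
    (fun δ δ' hp => hb _ _ ((hξ.precQ_iff hn hw).1 hp))).1 ?_
  have hAR := place_inAR H γ
  have hltγ := cy_sub_cx_of_le hn hAR.1.1 hγ
  have p1 := cx_add_cy (n := n) (place n ξ H α)
  have p2 := cx_add_cy (n := n) (place n ξ H β)
  have p3 := cx_add_cy (n := n) (place n ξ H γ)
  have hβα : Before n (place n ξ H β) (place n ξ H α) := by
    unfold IsStraight at hs
    unfold Before
    rcases hs with _ | ⟨z, _ | _ | _⟩ <;> omega
  refine ⟨hb _ _ hβα, h, ?_⟩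
  rintro ⟨α', β', h', k1, k2, k3, k4⟩
  have la : level H α β α = 1 := by
    unfold level
    rw [if_neg (by simp), if_pos (Or.inr hβα)]
  have lb : level H α β β = 1 := by
    unfold level
    rw [if_neg (not_not.2 (Or.inr hβα)), if_pos (Or.inl rfl)]
  have l1 := level_le_of_intervalOrder H α β k1
  have l2 := level_le_of_intervalOrder H α β k2
  have l3 := level_le_of_intervalOrder H α β k3
  have l4 := level_le_of_intervalOrder H α β k4
  -- all roots between `α` and `β` belong to the interval
  have inside : ∀ δ, level H α β δ = 1 → (δ = α ∨ Before n (place n ξ H δ) (place n ξ H α)) ∧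
      (δ = β ∨ Before n (place n ξ H β) (place n ξ H δ)) := by
    intro δ hδ
    unfold level at hδ
    split_ifs at hδ with i1 i2
    · exact ⟨i1, i2⟩
    · omega
  have b1 : Before n (place n ξ H α') (place n ξ H α) := by
    refine (inside α' (by omega)).1.resolve_left ?_
    rintro rfl
    exact irrefl _ k1
  have b2 : Before n (place n ξ H β) (place n ξ H β') := by
    refine (inside β' (by omega)).2.resolve_left ?_
    rintro rfl
    exact irrefl _ k4
  have b3 : ¬ Before n (place n ξ H α') (place n ξ H γ) := fun hc => _root_.asymm k2 (hb _ _ hc)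
  have p4 := cx_add_cy (n := n) (place n ξ H α')
  have p5 := cx_add_cy (n := n) (place n ξ H β')
  have key := H.pair_coords hγ h'
  clear la lb l1 l2 l3 l4 inside hall hST hb k1 k2 k3 k4
  unfold IsStraight IsCrossing at key
  unfold IsStraight at hs
  unfold Before at b1 b2 b3
  rcases key with ((_ | ⟨z, _ | _ | _⟩) | ⟨z, _⟩) | ((_ | ⟨z, _ | _ | _⟩) | ⟨z, _⟩)
  · omega
  · omega
  · omega
  · omega
  · omega
  all_goals rcases hs with _ | ⟨z', _ | _ | _⟩ <;> omega

theorem IsNonMinimalPair.symm {α β γ : PosRoot n} (h : IsNonMinimalPair Q ξ w γ α β) :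
    IsNonMinimalPair Q ξ w γ β α :=
  ⟨by rw [h.1, add_comm], fun lt h1 h2 h3 => (h.2 lt h1 h2 h3).symm⟩

end

section
variable {n : ℕ} {ξ : ℕ → ℤ}

/-! ### The roots which are not multiplicity free -/

theorem sum_simpleRoot_Ico {a c : ℕ} (hac : a ≤ c) (hc : c ≤ n) :
    ∑ i ∈ Finset.Ico a c, simpleRoot n i = eps n a - eps n c := by
  induction c, hac using Nat.le_induction with
  | base => simp
  | succ c hac ih =>
    rw [Finset.sum_Ico_succ_top hac, ih (by omega), simpleRoot_of_lt (by omega)]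
    abel

theorem le_of_not_isMultiplicityFree (hn : 4 ≤ n) {γ : PosRoot n} (hγ : ¬ IsMultiplicityFree γ)
    {a b : ℕ} (ha : 1 ≤ a) (hab : a < b) (hb : b ≤ n) (h : γ.1 = eps n a + eps n b) :
    b ≤ n - 2 := by
  by_contra hlt
  -- the support is `{a, …, n - 2, n}` or `{a, …, n}`
  have key : ∀ c, a ≤ c → c ≤ n → eps n a + eps n b = simpleRoot n n + (eps n a - eps n c) →
      IsMultiplicityFree γ := by
    intro c hac hcn e
    refine ⟨fun i => if i = n ∨ (a ≤ i ∧ i < c) then 1 else 0, fun i => by dsimp only; split_ifs <;> simp, ?_⟩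
    have hS : (Finset.Icc 1 n).filter (fun i => i = n ∨ (a ≤ i ∧ i < c)) =
        insert n (Finset.Ico a c) := by
      ext i
      simp only [Finset.mem_filter, Finset.mem_insert, Finset.mem_Icc, Finset.mem_Ico]
      omega
    simp only [ite_smul, one_smul, zero_smul]
    rw [← Finset.sum_filter, hS, Finset.sum_insert (by rw [Finset.mem_Ico]; omega),
      sum_simpleRoot_Ico hac hcn, h, e]
  refine hγ ?_
  rcases (show b = n ∨ b = n - 1 by omega) with rfl | rfl
  · exact key (b - 1) (by omega) (by omega) (by rw [simpleRoot_self]; abel)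
  · exact key n (by omega) le_rfl (by rw [simpleRoot_self]; abel)

/-! ### The wheel around a root `ε_a + ε_b` -/

/-- The data of the root `ε_a + ε_b` at the coordinates `(x, y)`. The function `q` lists the
positions of the vectors `-unitVec n ξ j`, all moved by the same multiple of two periods. As the
root has no other expression as a sum of two signed unit vectors, `x` and `y` are, in one of the two
orders, a position of one of `ε_a`, `ε_b` and a position of minus the other one. By `valley`, the
position `q k` lies at one end of the positions `q 1, …, q k`, which decides the order of `q a`,
`q b` and the other positions. -/
structure RootData (n : ℕ) (ξ : ℕ → ℤ) (a b : ℕ) (x y : ℤ) (q : ℕ → ℤ) : Prop where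
  wheel_q : ∀ j, 1 ≤ j → j ≤ n - 1 → wheel n ξ (q j) = -unitVec n ξ j
  parity_q : ∀ j, 1 ≤ j → j ≤ n - 1 → (2 : ℤ) ∣ q j - leftEnd ξ 0
  valley : ∀ k, k ≤ n - 1 → (∀ j, 1 ≤ j → j < k → q k < q j) ∨ (∀ j, 1 ≤ j → j < k → q j < q k)
  window : ∀ i j, 1 ≤ i → i ≤ n - 1 → 1 ≤ j → j ≤ n - 1 → q i - q j ≤ per n - 2
  rep : ∀ z, (2 : ℤ) ∣ z - leftEnd ξ 0 → ∃ j, 1 ≤ j ∧ j ≤ n - 1 ∧ per n ∣ z - q j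
  cases : (q b < q a ∧ x = q a - per n ∧ y = q b ∧ wheel n ξ x = eps n a ∧
      wheel n ξ y = -eps n b) ∨
    (q a < q b ∧ x = q b - per n ∧ y = q a ∧ wheel n ξ x = eps n b ∧ wheel n ξ y = -eps n a)

theorem IsHeight.pos_parity (H : IsHeight n ξ) {j : ℕ} (hj : 1 ≤ j) (hjn : j ≤ n - 1) :
    (2 : ℤ) ∣ pos n ξ j - leftEnd ξ 0 := by
  obtain ⟨k, rfl⟩ : ∃ k, j = k + 1 := ⟨j - 1, by omega⟩
  have h4 := H.four_le
  have e1 := H.leftEnd_parity (k := k) (by omega)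
  by_cases h : k + 1 ≤ n - 2
  · have e2 := H.rightEnd_parity h
    rcases H.ends_step h with h | h <;> omega
  · rw [show k + 1 = n - 1 by omega, H.pos_last]
    exact H.leftEnd_parity le_rfl

theorem IsHeight.exists_rootData (H : IsHeight n ξ) {a b : ℕ} (ha : 1 ≤ a) (hab : a < b)
    (hb : b ≤ n - 2) {x y : ℤ} (hx : (2 : ℤ) ∣ x - leftEnd ξ 0) (hy : (2 : ℤ) ∣ y - leftEnd ξ 0)
    (hxy : x < y) (hyx : y < x + per n) (h : wheel n ξ x - wheel n ξ y = eps n a + eps n b) :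
    ∃ q, RootData n ξ a b x y q := by
  have h4 := H.four_le
  have hpp := H.per_pos
  have hpe := per_even n
  have hdot := H.wheel_dot_of_lt hx hy hxy hyx
  have hpa := H.pos_parity ha (by omega)
  have hpb := H.pos_parity (j := b) (by omega) (by omega)
  have hwa : wheel n ξ (pos n ξ a) = -eps n a := H.wheel_pos_of_le ha (by omega)
  have hwb : wheel n ξ (pos n ξ b) = -eps n b := H.wheel_pos_of_le (by omega) hb
  have hwin : ∀ i j, 1 ≤ i → i ≤ n - 1 → 1 ≤ j → j ≤ n - 1 →
      pos n ξ i - pos n ξ j ≤ per n - 2 := by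
    intro i j i1 i2 j1 j2
    have := H.pos_window i1 i2
    have := H.pos_window j1 j2
    omega
  -- the common part, given the number of periods by which the positions are moved
  have mk : ∀ k : ℤ, ((pos n ξ b < pos n ξ a ∧ x = pos n ξ a + k * (2 * per n) - per n ∧
      y = pos n ξ b + k * (2 * per n) ∧ wheel n ξ x = eps n a ∧ wheel n ξ y = -eps n b) ∨
    (pos n ξ a < pos n ξ b ∧ x = pos n ξ b + k * (2 * per n) - per n ∧
      y = pos n ξ a + k * (2 * per n) ∧ wheel n ξ x = eps n b ∧ wheel n ξ y = -eps n a)) →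
      ∃ q, RootData n ξ a b x y q := by
    intro k hk
    refine ⟨fun j => pos n ξ j + k * (2 * per n), ?_, ?_, ?_, ?_, ?_, ?_⟩
    · intro j j1 j2
      rw [← H.wheel_pos j1 j2]
      exact H.wheel_of_two_per_dvd ⟨k, by ring⟩
    · intro j j1 j2
      have := H.pos_parity j1 j2
      have : (2 : ℤ) ∣ k * (2 * per n) := ⟨k * per n, by ring⟩
      omega
    · intro m hm
      rcases H.pos_valley hm with hv | hv
      · left; intro j j1 j2; have := hv j j1 j2; omega
      · right; intro j j1 j2; have := hv j j1 j2; omega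
    · intro i j i1 i2 j1 j2
      have := hwin i j i1 i2 j1 j2
      omega
    · intro z hz
      obtain ⟨j, j1, j2, m, rfl⟩ := H.exists_pos_add_mul hz
      exact ⟨j, j1, j2, ⟨m - 2 * k, by ring⟩⟩
    · rcases hk with hk | hk
      · exact Or.inl ⟨by omega, hk.2⟩
      · exact Or.inr ⟨by omega, hk.2⟩
  -- comparing positions: `x` is a position of `ε_i` and `y` one of `-ε_j`
  have cmp : ∀ i j, 1 ≤ i → i ≤ n - 1 → 1 ≤ j → j ≤ n - 1 →
      wheel n ξ (x + per n) = wheel n ξ (pos n ξ i) → wheel n ξ y = wheel n ξ (pos n ξ j) →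
      pos n ξ j < pos n ξ i ∧ ∃ k : ℤ, x = pos n ξ i + k * (2 * per n) - per n ∧
        y = pos n ξ j + k * (2 * per n) := by
    intro i j i1 i2 j1 j2 e1 e2
    obtain ⟨k, hk⟩ := H.two_per_dvd_of_wheel_eq (by omega) (H.pos_parity i1 i2) e1
    obtain ⟨m, hm⟩ := H.two_per_dvd_of_wheel_eq hy (H.pos_parity j1 j2) e2
    have w1 := hwin i j i1 i2 j1 j2
    have w2 := hwin j i j1 j2 i1 i2
    have hkm : m - k = 0 := by
      by_contra hne
      have hd : 2 * per n ∣ (y - pos n ξ j) - (x + per n - pos n ξ i) := ⟨m - k, by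
        rw [hk, hm]; ring⟩
      have h0 := Int.eq_zero_of_abs_lt_dvd hd (by rw [abs_lt]; omega)
      have : 2 * per n * (m - k) = 0 := by linarith
      rcases mul_eq_zero.1 this with h | h <;> omega
    obtain rfl : m = k := by omega
    have e3 : m * (2 * per n) = 2 * per n * m := mul_comm _ _
    refine ⟨by omega, m, by omega, by omega⟩
  rw [sub_eq_add_neg] at h
  rcases (H.isUnitVec_wheel hx).add_eq_add (isUnitVec_eps ha (by omega))
    (isUnitVec_eps (show 1 ≤ b by omega) (by omega)) (by rw [dotProduct_neg, hdot, neg_zero]) h with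
    ⟨e1, e2⟩ | ⟨e1, e2⟩
  · have e2' : wheel n ξ y = -eps n b := by rw [← e2, neg_neg]
    obtain ⟨c1, k, c2, c3⟩ := cmp a b ha (by omega) (by omega) (by omega)
      (by rw [wheel_add_per h4, e1, hwa]) (by rw [e2', hwb])
    exact mk k (Or.inl ⟨c1, c2, c3, e1, e2'⟩)
  · have e2' : wheel n ξ y = -eps n a := by rw [← e2, neg_neg]
    obtain ⟨c1, k, c2, c3⟩ := cmp b a (by omega) (by omega) ha (by omega)
      (by rw [wheel_add_per h4, e1, hwb]) (by rw [e2', hwa])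
    exact mk k (Or.inr ⟨c1, c2, c3, e1, e2'⟩)

section
variable {a b : ℕ} {x y : ℤ} {q : ℕ → ℤ}

theorem RootData.lt (D : RootData n ξ a b x y q) (H : IsHeight n ξ) (ha : 1 ≤ a) (hab : a < b)
    (hb : b ≤ n - 2) : x < y ∧ y < x + per n := by
  have w1 := D.window a b ha (by omega) (by omega) (by omega)
  have w2 := D.window b a (by omega) (by omega) ha (by omega)
  have := H.per_pos
  rcases D.cases with h | h <;> omega

/-- A value `±ε_c` of the wheel between the coordinates of `ε_a + ε_b` has `c > b`, or `c < b` and a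
sign for which one member of the corresponding crossing pair would be `ε_b - ε_c`, which is not
positive. -/
theorem RootData.index_of_mem (D : RootData n ξ a b x y q) (H : IsHeight n ξ) (ha : 1 ≤ a)
    (hab : a < b) (hb : b ≤ n - 2) {z : ℤ} (hz : (2 : ℤ) ∣ z - leftEnd ξ 0) (h1 : x < z)
    (h2 : z < y) : ∃ c, 1 ≤ c ∧ c ≤ n ∧ c ≠ twist n ξ ∧
      (wheel n ξ z = eps n c ∨ wheel n ξ z = -eps n c) ∧
      (c ≤ b → c < b ∧ ((wheel n ξ y = -eps n b ∧ wheel n ξ z = eps n c) ∨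
        (wheel n ξ x = eps n b ∧ wheel n ξ z = -eps n c))) := by
  have h4 := H.four_le
  have hpp := H.per_pos
  have hlt := D.lt H ha hab hb
  obtain ⟨j, j1, j2, m, hm⟩ := D.rep z hz
  obtain ⟨c, c1, c2, c3, c4, c5⟩ := H.unitVec_eq j1 j2
  have hw : wheel n ξ z = (m.negOnePow : ℤ) • -unitVec n ξ j := by
    rw [show z = q j + m * per n by rw [mul_comm]; omega, wheel_add_mul_per h4, D.wheel_q j j1 j2]
  refine ⟨c, by omega, c2, c3, ?_, ?_⟩
  · rw [hw]
    rcases negOnePow_cases m with h | h <;> rw [h] <;> rcases c5 with c5 | c5 <;> simp [c5]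
  · intro hcb
    obtain rfl : c = j := c4 (by omega)
    have hu : unitVec n ξ c = eps n c := unitVec_of_le (by omega)
    rw [hu] at hw
    have wa := D.window a c ha (by omega) j1 j2
    have wa' := D.window c a j1 j2 ha (by omega)
    have wb := D.window b c (by omega) (by omega) j1 j2
    have wb' := D.window c b j1 j2 (by omega) (by omega)
    have hcb' : c ≠ b := by
      rintro rfl
      rcases D.cases with hD | hD
      · have := Int.eq_zero_of_abs_lt_dvd ⟨m, hm⟩ (by rw [abs_lt]; omega)
        omega
      · have := Int.eq_zero_of_abs_lt_dvd (dvd_add ⟨m, hm⟩ (dvd_refl (per n)))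
          (by rw [abs_lt]; omega)
        omega
    refine ⟨by omega, ?_⟩
    rcases D.valley b (by omega) with hv | hv
    · have v1 := hv a ha hab
      have v2 := hv c j1 (by omega)
      rcases D.cases with hD | hD
      · left
        -- here `z` is a position of `+ε_c`, one period to the left of `q c`
        have h0 : m = -1 := by
          have hlo : per n * (-2) < per n * m := by omega
          have hhi : per n * m < per n * 0 := by omega
          have := lt_of_mul_lt_mul_left hlo (by omega)
          have := lt_of_mul_lt_mul_left hhi (by omega)
          omega
        refine ⟨hD.2.2.2.2, ?_⟩
        rw [hw, h0]
        simp
      · omega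
    · have v1 := hv a ha hab
      have v2 := hv c j1 (by omega)
      rcases D.cases with hD | hD
      · omega
      · right
        have h0 := Int.eq_zero_of_abs_lt_dvd ⟨m, hm⟩ (by rw [abs_lt]; omega)
        refine ⟨hD.2.2.2.1, ?_⟩
        rw [show z = q c by omega, D.wheel_q c j1 j2, hu]

/-- All `ε_c` with `c > b`, except for `ε_t`, occur up to sign between the coordinates of
`ε_a + ε_b`. -/
theorem RootData.exists_mem (D : RootData n ξ a b x y q) (H : IsHeight n ξ) (ha : 1 ≤ a)
    (hab : a < b) (hb : b ≤ n - 2) {c : ℕ} (hbc : b < c) (hcn : c ≤ n) (hct : c ≠ twist n ξ) :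
    ∃ z, (2 : ℤ) ∣ z - leftEnd ξ 0 ∧ x < z ∧ z < y ∧
      (wheel n ξ z = eps n c ∨ wheel n ξ z = -eps n c) := by
  have h4 := H.four_le
  have hpp := H.per_pos
  have hpe := per_even n
  obtain ⟨j, j1, j2, hj⟩ : ∃ j, b < j ∧ j ≤ n - 1 ∧
      (unitVec n ξ j = eps n c ∨ unitVec n ξ j = -eps n c) := by
    by_cases h : c ≤ n - 2
    · exact ⟨c, hbc, by omega, Or.inl (unitVec_of_le h)⟩
    · obtain ⟨d, d1, d2, d3⟩ := H.unitVec_last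
      have := twist_mem (n := n) (ξ := ξ)
      obtain rfl : c = d := by omega
      exact ⟨n - 1, by omega, le_rfl, d3⟩
  have hp := D.parity_q j (by omega) j2
  have hw := D.wheel_q j (by omega) j2
  have wa := D.window a j ha (by omega) (by omega) j2
  have wa' := D.window j a (by omega) j2 ha (by omega)
  have wb := D.window b j (by omega) (by omega) (by omega) j2
  have wb' := D.window j b (by omega) j2 (by omega) (by omega)
  rcases D.valley j j2 with hv | hv
  · have v1 := hv a ha (by omega)
    have v2 := hv b (by omega) j1
    refine ⟨q j, hp, ?_, ?_, ?_⟩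
    · rcases D.cases with hD | hD <;> omega
    · rcases D.cases with hD | hD <;> omega
    · rw [hw]
      rcases hj with hj | hj <;> simp [hj]
  · have v1 := hv a ha (by omega)
    have v2 := hv b (by omega) j1
    refine ⟨q j - per n, by omega, ?_, ?_, ?_⟩
    · rcases D.cases with hD | hD <;> omega
    · rcases D.cases with hD | hD <;> omega
    · rw [wheel_sub_per h4, hw]
      rcases hj with hj | hj <;> simp [hj]

end

/-! ### Crossing pairs -/

variable {Q : DynkinQuiver n} {w : List ℕ} {a b : ℕ} {x y : ℤ} {q : ℕ → ℤ} {γ : PosRoot n}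

theorem not_isPosRoot_eps_sub {b c : ℕ} (hb : 1 ≤ b) (hbn : b ≤ n) (hc : 1 ≤ c) (hcb : c < b) :
    ¬ IsPosRoot n (eps n b - eps n c) := by
  intro h
  have := h.weight_pos
  rw [weight_sub, weight_eps hb hbn, weight_eps hc (by omega)] at this
  omega

/-- The members of a crossing pair, on the wheel. -/
theorem IsHeight.crossing_values (H : IsHeight n ξ) (D : RootData n ξ a b x y q) (ha : 1 ≤ a)
    (hab : a < b) (hb : b ≤ n - 2) {α β : PosRoot n}
    (h : IsCrossing n x y (place n ξ H β) (place n ξ H α)) :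
    ∃ z c, (2 : ℤ) ∣ z - leftEnd ξ 0 ∧ x < z ∧ z < y ∧ α.1 = wheel n ξ x + wheel n ξ z ∧
      β.1 = -wheel n ξ y - wheel n ξ z ∧ b < c ∧ c ≤ n ∧ c ≠ twist n ξ ∧
      (wheel n ξ z = eps n c ∨ wheel n ξ z = -eps n c) := by
  have h4 := H.four_le
  have hlt := D.lt H ha hab hb
  obtain ⟨z, z1, z2, z3, z4, z5, z6⟩ := h
  have hz : (2 : ℤ) ∣ z - leftEnd ξ 0 := by rw [← z4]; exact H.cy_parity (place_inAR H β).1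
  have hα : (place n ξ H α).1 ≤ n - 2 := by
    by_contra hc
    have := cy_of_gt h4 hc
    omega
  have hβ : (place n ξ H β).1 ≤ n - 2 := by
    by_contra hc
    have := cy_of_gt h4 hc
    omega
  have e1 : α.1 = wheel n ξ x + wheel n ξ z := by
    rw [← label_place H α, label_of_le' hα, z5, z6, wheel_add_per h4]; abel
  have e2 : β.1 = -wheel n ξ y - wheel n ξ z := by
    rw [← label_place H β, label_of_le' hβ, z3, z4, wheel_sub_per h4]
  obtain ⟨c, c1, c2, c3, c4, c5⟩ := D.index_of_mem H ha hab hb hz z1 z2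
  refine ⟨z, c, hz, z1, z2, e1, e2, ?_, c2, c3, c4⟩
  by_contra hcb
  obtain ⟨c6, ⟨k1, k2⟩ | ⟨k1, k2⟩⟩ := c5 (by omega)
  · have := β.2
    rw [e2, k1, k2, neg_neg] at this
    exact not_isPosRoot_eps_sub (by omega) (by omega) c1 c6 this
  · have := α.2
    rw [e1, k1, k2, ← sub_eq_add_neg] at this
    exact not_isPosRoot_eps_sub (by omega) (by omega) c1 c6 this

/-- Each `u = ±ε_c` with `c > b` splits `ε_a + ε_b` into two positive roots. -/
theorem RootData.isPosRoot_crossing (D : RootData n ξ a b x y q) (ha : 1 ≤ a)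
    (hab : a < b) {c : ℕ} {u : Fin n → ℤ} (hbc : b < c) (hcn : c ≤ n)
    (hu : u = eps n c ∨ u = -eps n c) :
    IsPosRoot n (wheel n ξ x + u) ∧ IsPosRoot n (-wheel n ξ y - u) := by
  have hu' : -u = eps n c ∨ -u = -eps n c := by rcases hu with rfl | rfl <;> simp
  rw [sub_eq_add_neg]
  rcases D.cases with ⟨_, _, _, e1, e2⟩ | ⟨_, _, _, e1, e2⟩ <;> rw [e1, e2, neg_neg]
  · exact ⟨isPosRoot_add_signed ha (by omega) hcn hu,
      isPosRoot_add_signed (by omega) hbc hcn hu'⟩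
  · exact ⟨isPosRoot_add_signed (by omega) hbc hcn hu,
      isPosRoot_add_signed ha (by omega) hcn hu'⟩

end

section
variable {n : ℕ} {ξ : ℕ → ℤ}
variable {Q : DynkinQuiver n} {w : List ℕ} {a b : ℕ} {q : ℕ → ℤ} {α β γ : PosRoot n}

/-- The root `ε_a + ε_b` with `a, b ≤ n - 2` does not involve `ε_t`, so its residue is at most
`n - 2`. -/
theorem IsHeight.place_le_of_eps_add (H : IsHeight n ξ) (ha : 1 ≤ a) (hb1 : 1 ≤ b)
    (hab : a ≤ n - 2) (hb : b ≤ n - 2) (h : γ.1 = eps n a + eps n b) :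
    (place n ξ H γ).1 ≤ n - 2 := by
  have h4 := H.four_le
  have ht := twist_mem (n := n) (ξ := ξ)
  by_contra hγ
  obtain ⟨s, hs, e⟩ := label_of_gt' (ξ := ξ) h4 hγ
  have hl := label_place H γ
  rw [e, h] at hl
  -- the coefficients at `ε_t` do not agree
  have h5 := congrArg (fun v => v ⬝ᵥ eps n (twist n ξ)) hl
  simp only [add_dotProduct, smul_dotProduct] at h5
  rw [H.wheel_dot_twist (H.cx_parity (place_inAR H γ).1), H.isUnitVec_twist.dot_self,
    eps_dot_eps ha (by omega), eps_dot_eps hb1 (by omega), if_neg (by omega), if_neg (by omega)] at h5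
  rw [smul_eq_mul] at h5
  omega

/-- A position strictly between the coordinates of a root gives a crossing pair, as soon as the two
vectors it determines are positive roots. -/
theorem IsHeight.isCrossing_of_values (H : IsHeight n ξ) (hγ : (place n ξ H γ).1 ≤ n - 2) {z : ℤ}
    (hz : (2 : ℤ) ∣ z - leftEnd ξ 0) (h1 : cx n (place n ξ H γ) < z)
    (h2 : z < cy n (place n ξ H γ))
    (hα : α.1 = wheel n ξ (cx n (place n ξ H γ)) + wheel n ξ z)
    (hβ : β.1 = -wheel n ξ (cy n (place n ξ H γ)) - wheel n ξ z) :
    IsCrossing n (cx n (place n ξ H γ)) (cy n (place n ξ H γ)) (place n ξ H β)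
      (place n ξ H α) := by
  have h4 := H.four_le
  have hpe := per_even n
  have hAR := place_inAR H γ
  have hlα := label_place H α
  have hlβ := label_place H β
  have hx := H.cx_parity hAR.1
  have hy := H.cy_parity hAR.1
  have hlt := cy_sub_cx_of_le h4 hAR.1.1 hγ
  set x := cx n (place n ξ H γ)
  set y := cy n (place n ξ H γ)
  obtain ⟨_, a1, a2⟩ := H.coords_of_wheel hAR (place_inAR H α) (x := z) (y := x + per n)
    hz (by omega) (by omega) (by omega) (by rw [hlα, hα, wheel_add_per h4]; abel)
    (by omega) (by omega) (by omega) (by omega)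
  obtain ⟨_, b1, b2⟩ := H.coords_of_wheel hAR (place_inAR H β) (x := y - per n) (y := z)
    (by omega) hz (by omega) (by omega) (by rw [hlβ, hβ, wheel_sub_per h4])
    (by omega) (by omega) (by omega) (by omega)
  exact ⟨z, h1, h2, b1, b2, a1, a2⟩

/-- Between the members of a crossing pair of the root with coordinates `(x, y)` lies the pair with
the members `(y - N, y)` and `(x, x + N)`, where `N` is the period. Hence a crossing pair is not
minimal for any compatible order. -/
theorem DynkinQuiver.IsHeightFunction.isNonMinimalPair_of_isCrossing (hn : 4 ≤ n)
    (hξ : Q.IsHeightFunction ξ) (hw : Q.IsCoxeterWord w) (ha : 1 ≤ a) (hab : a < b)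
    (hb : b ≤ n - 2) (hγ : (place n ξ (hξ.isHeight hn) γ).1 ≤ n - 2)
    (D : RootData n ξ a b (cx n (place n ξ (hξ.isHeight hn) γ))
      (cy n (place n ξ (hξ.isHeight hn) γ)) q)
    (h : γ.1 = α.1 + β.1)
    (hc : IsCrossing n (cx n (place n ξ (hξ.isHeight hn) γ)) (cy n (place n ξ (hξ.isHeight hn) γ))
      (place n ξ (hξ.isHeight hn) β) (place n ξ (hξ.isHeight hn) α)) :
    IsNonMinimalPair Q ξ w γ α β := by
  have H := hξ.isHeight hn
  have hpe := per_even n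
  have hAR := place_inAR H γ
  have hx := H.cx_parity hAR.1
  have hy := H.cy_parity hAR.1
  have hlt := cy_sub_cx_of_le hn hAR.1.1 hγ
  have ht := twist_mem (n := n) (ξ := ξ)
  have hl := label_place H γ
  rw [label_of_le' hγ] at hl
  obtain ⟨p1, p2⟩ := D.isPosRoot_crossing ha hab (c := twist n ξ) (by omega) (by omega) (Or.inl rfl)
  set α' : PosRoot n := ⟨_, p1⟩ with hα'
  set β' : PosRoot n := ⟨_, p2⟩ with hβ'
  have hlα := label_place H α'
  have hlβ := label_place H β'
  obtain ⟨_, a1, a2⟩ := H.coords_of_twist hAR (place_inAR H α') hx (Or.inl rfl)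
    (by rw [hlα, hα', one_smul]) (by omega) (by omega) (by omega) (by omega)
  obtain ⟨_, b1, b2⟩ := H.coords_of_twist hAR (place_inAR H β')
    (x := cy n (place n ξ H γ) - per n) (by omega) (Or.inr rfl)
    (by rw [hlβ, hβ', wheel_sub_per hn]; module) (by omega) (by omega) (by omega) (by omega)
  have sum : γ.1 = α'.1 + β'.1 := by
    rw [← hl]
    show _ = (_ + _) + (_ - _)
    abel
  have q1 := cx_add_cy (n := n) (place n ξ H α)
  have q2 := cx_add_cy (n := n) (place n ξ H β)
  have q3 := cx_add_cy (n := n) (place n ξ H γ)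
  have q4 := cx_add_cy (n := n) (place n ξ H α')
  have q5 := cx_add_cy (n := n) (place n ξ H β')
  obtain ⟨z, z1, z2, z3, z4, z5, z6⟩ := hc
  have before : Before n (place n ξ H α') (place n ξ H α) ∧
      Before n (place n ξ H γ) (place n ξ H α') ∧ Before n (place n ξ H β') (place n ξ H γ) ∧
      Before n (place n ξ H β) (place n ξ H β') := by
    unfold Before
    omega
  obtain ⟨k1, k2, k3, k4⟩ := before
  refine ⟨h, fun lt hST _ hcomp => ?_⟩
  have hlt' : ∀ δ δ', Before n (place n ξ H δ') (place n ξ H δ) → lt δ δ' :=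
    fun δ δ' hb => hcomp _ _ ((hξ.precQ_iff hn hw).2 hb)
  refine ⟨fun hm => hm.2.2 ⟨α', β', sum, hlt' _ _ k1, hlt' _ _ k2, hlt' _ _ k3, hlt' _ _ k4⟩,
    fun hm => ?_⟩
  exact _root_.asymm hm.1 (hlt' _ _ (((k4.trans k3).trans k2).trans k1))

/-- The non-minimal pairs are the crossing pairs. -/
theorem DynkinQuiver.IsHeightFunction.isNonMinimalPair_iff (hn : 4 ≤ n)
    (hξ : Q.IsHeightFunction ξ) (hw : Q.IsCoxeterWord w) (ha : 1 ≤ a) (hab : a < b)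
    (hb : b ≤ n - 2) (hγ : (place n ξ (hξ.isHeight hn) γ).1 ≤ n - 2)
    (D : RootData n ξ a b (cx n (place n ξ (hξ.isHeight hn) γ))
      (cy n (place n ξ (hξ.isHeight hn) γ)) q) :
    IsNonMinimalPair Q ξ w γ α β ↔ γ.1 = α.1 + β.1 ∧
      (IsCrossing n (cx n (place n ξ (hξ.isHeight hn) γ)) (cy n (place n ξ (hξ.isHeight hn) γ))
        (place n ξ (hξ.isHeight hn) β) (place n ξ (hξ.isHeight hn) α) ∨
      IsCrossing n (cx n (place n ξ (hξ.isHeight hn) γ)) (cy n (place n ξ (hξ.isHeight hn) γ))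
        (place n ξ (hξ.isHeight hn) α) (place n ξ (hξ.isHeight hn) β)) := by
  constructor
  · intro h
    refine ⟨h.1, ?_⟩
    rcases (hξ.isHeight hn).pair_coords hγ h.1 with (hs | hc) | (hs | hc)
    · exact absurd h.symm (hξ.not_isNonMinimalPair_of_isStraight hn hw hγ h.symm.1 hs)
    · exact Or.inr hc
    · exact absurd h (hξ.not_isNonMinimalPair_of_isStraight hn hw hγ h.1 hs)
    · exact Or.inl hc
  · rintro ⟨h, hc | hc⟩
    · exact hξ.isNonMinimalPair_of_isCrossing hn hw ha hab hb hγ D h hc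
    · exact (hξ.isNonMinimalPair_of_isCrossing hn hw ha hab hb hγ D
        (by rw [h, add_comm]) hc).symm

/-- The crossing pairs are those without a member on a sectional path through the root. -/
theorem DynkinQuiver.IsHeightFunction.isCrossing_iff (hn : 4 ≤ n)
    (hξ : Q.IsHeightFunction ξ) (hw : Q.IsCoxeterWord w)
    (hγ : (place n ξ (hξ.isHeight hn) γ).1 ≤ n - 2) (h : γ.1 = α.1 + β.1) :
    (IsCrossing n (cx n (place n ξ (hξ.isHeight hn) γ)) (cy n (place n ξ (hξ.isHeight hn) γ))
        (place n ξ (hξ.isHeight hn) β) (place n ξ (hξ.isHeight hn) α) ∨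
      IsCrossing n (cx n (place n ξ (hξ.isHeight hn) γ)) (cy n (place n ξ (hξ.isHeight hn) γ))
        (place n ξ (hξ.isHeight hn) α) (place n ξ (hξ.isHeight hn) β)) ↔
      ¬ LieOnCommonSectionalPath Q ξ w α γ ∧ ¬ LieOnCommonSectionalPath Q ξ w β γ := by
  have H := hξ.isHeight hn
  have hlt := cy_sub_cx_of_le hn (place_inAR H γ).1.1 hγ
  have hcomp := H.before_of_pair h
  rw [hξ.lieOnCommonSectionalPath_iff hn hw (hcomp.imp And.left And.right),
    hξ.lieOnCommonSectionalPath_iff hn hw (hcomp.symm.imp And.left And.right)]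
  constructor
  · unfold IsCrossing
    rintro (⟨z, _⟩ | ⟨z, _⟩) <;> omega
  · intro hno
    rcases H.pair_coords hγ h with (hs | hc) | (hs | hc)
    · exfalso
      unfold IsStraight at hs
      rcases hs with _ | ⟨z, _⟩ <;> omega
    · exact Or.inr hc
    · exfalso
      unfold IsStraight at hs
      rcases hs with _ | ⟨z, _⟩ <;> omega
    · exact Or.inl hc

theorem IsSplitPair.symm (h : IsSplitPair a b α β) : IsSplitPair a b β α := by
  obtain ⟨c, h1, h2, σ, h3, h4⟩ := h
  exact ⟨c, h1, h2, σ, h3, h4.symm⟩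

theorem IsSplitPair.add_eq (h : IsSplitPair a b α β) : α.1 + β.1 = eps n a + eps n b := by
  obtain ⟨c, h1, h2, σ, h3, ⟨e1, e2⟩ | ⟨e1, e2⟩⟩ := h <;> rw [e1, e2] <;> abel

theorem IsHeight.isSplitPair_of_isCrossing (H : IsHeight n ξ) {x y : ℤ}
    (D : RootData n ξ a b x y q) (ha : 1 ≤ a) (hab : a < b) (hb : b ≤ n - 2)
    (h : IsCrossing n x y (place n ξ H β) (place n ξ H α)) : IsSplitPair a b α β := by
  obtain ⟨z, c, _, _, _, e1, e2, hbc, hcn, _, hz⟩ := H.crossing_values D ha hab hb h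
  obtain ⟨s, hs, es⟩ : ∃ s : ℤ, (s = 1 ∨ s = -1) ∧ wheel n ξ z = s • eps n c := by
    rcases hz with hz | hz
    · exact ⟨1, Or.inl rfl, by rw [hz, one_smul]⟩
    · exact ⟨-1, Or.inr rfl, by rw [hz, neg_smul, one_smul]⟩
  rw [es] at e1 e2
  rcases D.cases with ⟨_, _, _, k1, k2⟩ | ⟨_, _, _, k1, k2⟩ <;> rw [k1] at e1 <;> rw [k2] at e2
  · exact ⟨c, hbc, hcn, s, hs, Or.inl ⟨e1, by rw [e2]; abel⟩⟩
  · exact ⟨c, hbc, hcn, -s, by omega, Or.inr ⟨by rw [e2]; module, by rw [e1]; module⟩⟩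

/-! ### The number of crossing pairs -/

/-- The crossing pairs are parametrized by the `c` with `b < c ≤ n`, except for the index `t` of the
vector which does not occur on the wheel. -/
theorem DynkinQuiver.IsHeightFunction.ncard_isNonMinimalPair (hn : 4 ≤ n)
    (hξ : Q.IsHeightFunction ξ) (hw : Q.IsCoxeterWord w) (ha : 1 ≤ a) (hab : a < b)
    (hb : b ≤ n - 2) (hγ : (place n ξ (hξ.isHeight hn) γ).1 ≤ n - 2)
    (D : RootData n ξ a b (cx n (place n ξ (hξ.isHeight hn) γ))
      (cy n (place n ξ (hξ.isHeight hn) γ)) q) :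
    {s : Sym2 (PosRoot n) | ∃ α β, s = s(α, β) ∧ IsNonMinimalPair Q ξ w γ α β}.ncard =
      n - b - 1 := by
  have H := hξ.isHeight hn
  have ht := twist_mem (n := n) (ξ := ξ)
  have hAR := place_inAR H γ
  have hx := H.cx_parity hAR.1
  have hy := H.cy_parity hAR.1
  have hlt := cy_sub_cx_of_le hn hAR.1.1 hγ
  have hl := label_place H γ
  rw [label_of_le' hγ] at hl
  have hiff := fun α β => hξ.isNonMinimalPair_iff hn hw ha hab hb hγ D (α := α) (β := β)
  have hcr := fun α β z => H.isCrossing_of_values hγ (α := α) (β := β) (z := z)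
  set x := cx n (place n ξ H γ)
  set y := cy n (place n ξ H γ)
  choose z z1 z2 z3 z4 using fun (c : {c // b < c ∧ c ≤ n ∧ c ≠ twist n ξ}) =>
    D.exists_mem H ha hab hb c.2.1 c.2.2.1 c.2.2.2
  have pos := fun (c : {c // b < c ∧ c ≤ n ∧ c ≠ twist n ξ}) =>
    D.isPosRoot_crossing ha hab c.2.1 c.2.2.1 (z4 c)
  let α' : {c // b < c ∧ c ≤ n ∧ c ≠ twist n ξ} → PosRoot n := fun c => ⟨_, (pos c).1⟩
  let β' : {c // b < c ∧ c ≤ n ∧ c ≠ twist n ξ} → PosRoot n := fun c => ⟨_, (pos c).2⟩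
  -- the position is determined by the index
  have index : ∀ (c d : {c // b < c ∧ c ≤ n ∧ c ≠ twist n ξ}),
      wheel n ξ (z c) = wheel n ξ (z d) → c = d := by
    intro c d h
    have hc := c.2
    have hd := d.2
    have e := eps_dot_eps (n := n) (i := c.1) (j := d.1) (by omega) hc.2.1
    have e' := (H.isUnitVec_wheel (z1 d)).dot_self
    nth_rewrite 1 [← h] at e'
    by_contra hne
    rw [if_neg fun h => hne (Subtype.ext h)] at e
    rcases z4 c with k | k <;> rcases z4 d with k' | k' <;> rw [k, k'] at e' <;> simp [e] at e'
  have inj : Function.Injective fun c => s(α' c, β' c) := by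
    intro c d h
    rcases Sym2.eq_iff.1 h with ⟨h1, _⟩ | ⟨h1, _⟩
    · exact index c d (add_left_cancel (congrArg Subtype.val h1))
    · exfalso
      -- only one member of a pair involves the value at `x`
      have h1' : wheel n ξ x + wheel n ξ (z c) = -wheel n ξ y - wheel n ξ (z d) :=
        congrArg Subtype.val h1
      have h2 := congrArg (fun v => wheel n ξ x ⬝ᵥ v) h1'
      have m1 := z2 c
      have m2 := z3 c
      have m3 := z2 d
      have m4 := z3 d
      simp only [dotProduct_add, dotProduct_sub, dotProduct_neg] at h2
      rw [(H.isUnitVec_wheel hx).dot_self, H.wheel_dot_of_lt hx hy hlt.1 hlt.2,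
        H.wheel_dot_of_lt hx (z1 c) m1 (by omega),
        H.wheel_dot_of_lt hx (z1 d) m3 (by omega)] at h2
      omega
  have surj : ∀ α β, IsCrossing n x y (place n ξ H β) (place n ξ H α) →
      ∃ c, s(α' c, β' c) = s(α, β) := by
    intro α β hc
    obtain ⟨z', c, p1, p2, p3, e1, e2, hbc, hcn, hct, hz⟩ := H.crossing_values D ha hab hb hc
    set c' : {c // b < c ∧ c ≤ n ∧ c ≠ twist n ξ} := ⟨c, hbc, hcn, hct⟩ with hc'
    have m1 := z2 c'
    have m2 := z3 c'
    have hzz : z c' = z' := by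
      by_contra hne
      have h0 : wheel n ξ (z c') ⬝ᵥ wheel n ξ z' = 0 := by
        refine H.wheel_dot_wheel (z1 c') p1 fun hd => ?_
        have := Int.eq_zero_of_abs_lt_dvd hd (by rw [abs_lt]; omega)
        omega
      have e := (isUnitVec_eps (n := n) (c := c) (by omega) hcn).dot_self
      have k : wheel n ξ (z c') = eps n c ∨ wheel n ξ (z c') = -eps n c := z4 c'
      rcases k with k | k <;> rcases hz with hz | hz <;> rw [k, hz] at h0 <;> simp [e] at h0
    refine ⟨c', ?_⟩
    have r1 : α' c' = α := Subtype.ext (by rw [e1, ← hzz])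
    have r2 : β' c' = β := Subtype.ext (by rw [e2, ← hzz])
    rw [r1, r2]
  have range : {s : Sym2 (PosRoot n) | ∃ α β, s = s(α, β) ∧ IsNonMinimalPair Q ξ w γ α β} =
      Set.range fun c => s(α' c, β' c) := by
    ext s
    simp only [Set.mem_ofPred_eq, Set.mem_range]
    constructor
    · rintro ⟨α, β, rfl, h⟩
      rcases ((hiff α β).1 h).2 with hc | hc
      · exact surj α β hc
      · rw [Sym2.eq_swap]
        exact surj β α hc
    · rintro ⟨c, rfl⟩
      refine ⟨α' c, β' c, rfl, (hiff _ _).2 ⟨?_, Or.inl (hcr _ _ _ (z1 c) (z2 c) (z3 c) rfl rfl)⟩⟩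
      rw [← hl]
      show _ = (_ + _) + (_ - _)
      abel
  rw [range, ← Set.image_univ, Set.ncard_image_of_injective _ inj, Set.ncard_univ]
  have card : Nat.card {c // b < c ∧ c ≤ n ∧ c ≠ twist n ξ} =
      ((Finset.Ioc b n).erase (twist n ξ)).card := by
    rw [← Nat.card_eq_finsetCard]
    refine Nat.card_congr (Equiv.subtypeEquivRight fun c => ?_)
    rw [Finset.mem_erase, Finset.mem_Ioc]
    tauto
  rw [card, Finset.card_erase_of_mem (by rw [Finset.mem_Ioc]; omega), Nat.card_Ioc]

end
end TypeD

theorem mainTheorem2 {n : ℕ} (hn : 4 ≤ n) (Q : TypeD.DynkinQuiver n)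
    (ξ : ℕ → ℤ) (hξ : Q.IsHeightFunction ξ) (w : List ℕ) (hw : Q.IsCoxeterWord w)
    (γ : TypeD.PosRoot n) (hγ : ¬ TypeD.IsMultiplicityFree γ)
    (a b : ℕ) (ha : 1 ≤ a) (hab : a < b) (hb : b ≤ n)
    (hγab : γ.1 = TypeD.eps n a + TypeD.eps n b) :
    b ≤ n - 2 ∧
      {s : Sym2 (TypeD.PosRoot n) |
        ∃ α β, s = s(α, β) ∧ TypeD.IsNonMinimalPair Q ξ w γ α β}.ncard = n - b - 1 ∧
      ∀ α β : TypeD.PosRoot n, TypeD.IsNonMinimalPair Q ξ w γ α β ↔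
        (TypeD.IsSplitPair a b α β ∧ ¬ TypeD.LieOnCommonSectionalPath Q ξ w α γ ∧
          ¬ TypeD.LieOnCommonSectionalPath Q ξ w β γ) := by
  have hb' := TypeD.le_of_not_isMultiplicityFree hn hγ ha hab hb hγab
  have H := hξ.isHeight hn
  have hAR := TypeD.place_inAR H γ
  have hres := H.place_le_of_eps_add ha (by omega) (by omega) hb' hγab
  have hlt := TypeD.cy_sub_cx_of_le hn hAR.1.1 hres
  have hl := TypeD.label_place H γ
  rw [TypeD.label_of_le' hres, hγab] at hl
  obtain ⟨q, D⟩ := H.exists_rootData ha hab hb' (H.cx_parity hAR.1) (H.cy_parity hAR.1) hlt.1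
    hlt.2 hl
  refine ⟨hb', hξ.ncard_isNonMinimalPair hn hw ha hab hb' hres D, fun α β => ?_⟩
  rw [hξ.isNonMinimalPair_iff hn hw ha hab hb' hres D]
  constructor
  · rintro ⟨h, hc⟩
    refine ⟨?_, (hξ.isCrossing_iff hn hw hres h).1 hc⟩
    rcases hc with hc | hc
    · exact H.isSplitPair_of_isCrossing D ha hab hb' hc
    · exact (H.isSplitPair_of_isCrossing D ha hab hb' hc).symm
  · rintro ⟨hs, hno⟩
    have h : γ.1 = α.1 + β.1 := by rw [hγab, hs.add_eq]
    exact ⟨h, (hξ.isCrossing_iff hn hw hres h).2 hno⟩
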